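/- Let $K$ be a field, $x=(x_1,\dots,x_n)$, and let $s\ge 0$. For $y=(y_1,\dots,y_p)$, a mother code is a polynomial vector $H\in K[x,y]^p$ with $H(0,0)=0$ and $D_yH(0,0)\in \mathrm{GL}_p(K)$; its baby series vector is the unique $h\in K[[x]]^p$ with $h(0)=0$ and $H(x,h(x))=0$ (its components are algebraic over $K[x]$). A family code of vectors $g_1,\dots,g_r\in K[[x]]^s$ is a pair $(H,G)$ of a mother code $H\in K[x,y]^p$ and polynomial vectors $G_1,\dots,G_r\in K[x,y]^s$ with $g_k=G_k(x,h(x))$ for all $k$, where $h$ is the baby series vector of $H$. A monomial order on $\mathbb N^n\times\{1,\dots,s\}$ is a well-founded total order $<$ such that $(\alpha,\ell)<(\beta,m)$ implies $(\alpha+\gamma,\ell)<(\beta+\gamma,m)$ for all $\gamma\in\mathbb N^n$. The initial monomial vector $\mathrm{in}(g)$ of a nonzero $g=\sum c_{\alpha\ell}x^\alpha e_\ell\in K[[x]]^s$ is the $x^\alpha e_\ell$ for which $(\alpha,\ell)$ is the minimal element of the support of $g$. For a submodule $I\subset K[[x]]^s$, the initial module $\mathrm{in}(I)$ is the submodule generated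 by the $\mathrm{in}(g)$ with $0\ne g\in I$, and a standard basis of $I$ is a finite system of generators of $I$ whose initial monomial vectors generate $\mathrm{in}(I)$. **Theorem 9.1.** There is a finite algorithm which computes the family code of a standard basis from any family code. More precisely, there is a program, working on finite trees with entries in $K$, which uses the elements of $K$ only through the field operations and the test for zero, uses the monomial order only through comparisons of given pairs $(\alpha,\ell)$, and does not depend on $K$, $n$, $s$, $p$, $r$ or the order, such that the following holds. Let $<$ be a monomial order on $\mathbb N^n\times\{1,\dots,s\}$, and let $I=\langle g_1,\dots,g_r\rangle\subset K[[x]]^s$ be the submodule generated by algebraic power series vectors $g_1,\dots,g_r$ with family code $(H,G)$. On the input $(n,s,p,r,H,G)$ (polynomials being given as lists of terms) the program halts, and its output consists of a family code $(H',G')$ of a (not necessarily reduced) standard basis $b_1,\dots,b_{r'}$ of $I$ with respect to $<$, whose elements are nonzero with initial coefficient $1$, and of the exponents $a_1,\dots,a_{r'}\in\mathbb N^n\times\{1,\dots,s\}$ of their initial monomial vectors. In particular these monomial vectors, computed by the program, generate the initial module $\mathrm{in}(I)$. -/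

import Mathlib

universe u

/-! ### Power series vectors, monomial orders, standard bases -/

/-- Formal power series vectors: the module `K[[x_1, …, x_n]]^s`. -/
abbrev SeriesVec (K : Type u) [Field K] (n s : ℕ) : Type u :=
  Fin s → MvPowerSeries (Fin n) K

/-- Pairs `(α, ℓ)` in `ℕ^n × {1, …, s}`; they index the monomial vectors `x^α e_ℓ`. -/
abbrev MonIdx (n s : ℕ) : Type :=
  (Fin n →₀ ℕ) × Fin s

/-- (Strict) monomial orders on `ℕ^n × {1, …, s}`: total orders which are compatible with the
action of `ℕ^n` and noetherian (well-founded). -/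
structure IsMonomialOrder {n s : ℕ} (lt : MonIdx n s → MonIdx n s → Prop) : Prop where
  total : ∀ a b, lt a b ∨ a = b ∨ lt b a
  trans : ∀ a b c, lt a b → lt b c → lt a c
  wf : WellFounded lt
  add : ∀ (α β γ : Fin n →₀ ℕ) (ℓ m : Fin s), lt (α, ℓ) (β, m) → lt (α + γ, ℓ) (β + γ, m)

/-- In each component, the exponent `0` is automatically the smallest one. -/
theorem IsMonomialOrder.zero_lt {n s : ℕ} {lt : MonIdx n s → MonIdx n s → Prop}
    (h : IsMonomialOrder lt) (α : Fin n →₀ ℕ) (hα : α ≠ 0) (ℓ : Fin s) : lt (0, ℓ) (α, ℓ) := by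
  rcases h.total (0, ℓ) (α, ℓ) with h1 | h1 | h1
  · exact h1
  · exact absurd (congrArg Prod.fst h1).symm hα
  · exfalso
    have key : ∀ a : MonIdx n s, a.2 = ℓ → False := by
      intro a
      induction a using h.wf.induction with
      | _ a ih =>
        intro ha
        obtain ⟨β, m⟩ := a
        obtain rfl : m = ℓ := ha
        have h2 := h.add _ _ β _ _ h1
        rw [zero_add] at h2
        exact ih _ h2 rfl
    exact key (0, ℓ) rfl

/-- The coefficient `c_{αℓ}` of the monomial vector `x^α e_ℓ` in the expansion of `g`. -/
noncomputable def vecCoeff {K : Type u} [Field K] {n s : ℕ} (a : MonIdx n s)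
    (g : SeriesVec K n s) : K :=
  MvPowerSeries.coeff a.1 (g a.2)

/-- The monomial vector `x^α e_ℓ`. -/
noncomputable def monVec (K : Type u) [Field K] {n s : ℕ} (a : MonIdx n s) : SeriesVec K n s :=
  Pi.single a.2 (MvPowerSeries.monomial a.1 1)

/-- `x^α e_ℓ`, `a = (α, ℓ)`, is the initial monomial vector of `g`: `a` is the minimal element
of the support of `g` (in particular `g ≠ 0`). -/
def IsInitial {K : Type u} [Field K] {n s : ℕ} (lt : MonIdx n s → MonIdx n s → Prop)
    (g : SeriesVec K n s) (a : MonIdx n s) : Prop :=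
  vecCoeff a g ≠ 0 ∧ ∀ b, lt b a → vecCoeff b g = 0

/-- The initial module `in(I)`, generated by all initial monomial vectors of elements of `I`. -/
noncomputable def initialModule {K : Type u} [Field K] {n s : ℕ}
    (lt : MonIdx n s → MonIdx n s → Prop)
    (I : Submodule (MvPowerSeries (Fin n) K) (SeriesVec K n s)) :
    Submodule (MvPowerSeries (Fin n) K) (SeriesVec K n s) :=
  Submodule.span _ {v | ∃ g ∈ I, ∃ a, IsInitial lt g a ∧ v = monVec K a}

/-- `b_1, …, b_r` is a standard basis of `I`: these vectors generate `I`, and their initial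
monomial vectors generate `in(I)`. -/
structure IsStandardBasis {K : Type u} [Field K] {n s r : ℕ}
    (lt : MonIdx n s → MonIdx n s → Prop)
    (I : Submodule (MvPowerSeries (Fin n) K) (SeriesVec K n s))
    (b : Fin r → SeriesVec K n s) : Prop where
  span_eq : Submodule.span (MvPowerSeries (Fin n) K) (Set.range b) = I
  span_initial : Submodule.span (MvPowerSeries (Fin n) K)
    {v | ∃ k a, IsInitial lt (b k) a ∧ v = monVec K a} = initialModule lt I

/-! ### Codes of algebraic power series -/

/-- Polynomials in `K[x, y] = K[x_1, …, x_n, y_1, …, y_p]`. -/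
abbrev XYPoly (K : Type u) [Field K] (n p : ℕ) : Type u :=
  MvPolynomial (Fin n ⊕ Fin p) K

/-- Mother codes: `H(0,0) = 0` and the Jacobian matrix `D_y H(0,0)` is invertible. -/
structure IsMotherCode {K : Type u} [Field K] {n p : ℕ} (H : Fin p → XYPoly K n p) : Prop where
  zero : ∀ i, MvPolynomial.constantCoeff (H i) = 0
  jacobian : IsUnit (Matrix.of fun i j : Fin p =>
    MvPolynomial.constantCoeff (MvPolynomial.pderiv (Sum.inr j) (H i)))

/-- The substitution `F ↦ F(x, h(x))`. -/
noncomputable def substBaby {K : Type u} [Field K] {n p : ℕ}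
    (h : Fin p → MvPowerSeries (Fin n) K) : XYPoly K n p →ₐ[K] MvPowerSeries (Fin n) K :=
  MvPolynomial.aeval (Sum.elim MvPowerSeries.X h)

/-- `h` is the baby series vector of `H`: `h(0) = 0` and `H(x, h(x)) = 0`. (For a mother code
there is exactly one such `h`, by the implicit function theorem for formal power series, and its
components are algebraic over `K[x]`.) -/
structure IsBabySeries {K : Type u} [Field K] {n p : ℕ} (H : Fin p → XYPoly K n p)
    (h : Fin p → MvPowerSeries (Fin n) K) : Prop where
  zero : ∀ i, MvPowerSeries.constantCoeff (h i) = 0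
  eq_zero : ∀ i, substBaby h (H i) = 0

/-- The vectors `g_1, …, g_r` have family code `(H, G)`: `H` is a mother code, and
`g_k = G_k(x, h(x))` for its baby series vector `h`. -/
def HasFamilyCode {K : Type u} [Field K] {n s p r : ℕ} (H : Fin p → XYPoly K n p)
    (G : Fin r → Fin s → XYPoly K n p) (g : Fin r → SeriesVec K n s) : Prop :=
  IsMotherCode H ∧ ∃ h, IsBabySeries H h ∧ ∀ k ℓ, g k ℓ = substBaby h (G k ℓ)

/-! ### Algorithms over a field with a monomial order

The objects handled by an algorithm are finite binary trees whose leaves are empty or carry a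
scalar. A program is a finite piece of syntax which mentions neither the field nor the order. It
builds and inspects trees, branches, loops, and accesses the scalars only through the field
operations and the test for zero, and the monomial order only through comparisons of two given
pairs `(α, ℓ)`. -/

/-- Binary trees with leaves that are empty or carry an element of `K`. -/
inductive ScalarTree (K : Type u) : Type u
  | nil : ScalarTree K
  | atom (a : K) : ScalarTree K
  | cons (l r : ScalarTree K) : ScalarTree K

namespace ScalarTree

variable {K : Type u}

/-- First component (`nil` if the tree is not a pair). -/
def fst : ScalarTree K → ScalarTree K
  | cons l _ => l
  | _ => nil

/-- Second component (`nil` if the tree is not a pair). -/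
def snd : ScalarTree K → ScalarTree K
  | cons _ r => r
  | _ => nil

/-- Truth values: false is `nil`; every other tree counts as true. -/
def tt : ScalarTree K := cons nil nil

open Classical in
/-- The truth value of a proposition, as a tree. -/
noncomputable def ofProp (P : Prop) : ScalarTree K := if P then tt else nil

/-- Apply a unary operation on scalars to a leaf. -/
def map₁ (f : K → K) : ScalarTree K → ScalarTree K
  | atom a => atom (f a)
  | _ => nil

/-- Apply a binary operation on scalars to a pair of leaves. -/
def map₂ (f : K → K → K) : ScalarTree K → ScalarTree K
  | cons (atom a) (atom b) => atom (f a b)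
  | _ => nil

/-- Natural numbers, in unary. -/
def ofNat : ℕ → ScalarTree K
  | 0 => nil
  | m + 1 => cons nil (ofNat m)

/-- Finite lists. -/
def ofList : List (ScalarTree K) → ScalarTree K
  | [] => nil
  | t :: l => cons t (ofList l)

/-- Finite sequences, listed in order. -/
def ofFn {m : ℕ} (f : Fin m → ScalarTree K) : ScalarTree K := ofList (List.ofFn f)

/-- The tree for a pair `(α, ℓ)`: the list `α_1, …, α_n` together with `ℓ`. -/
def ofMonIdx {n s : ℕ} (a : MonIdx n s) : ScalarTree K :=
  cons (ofFn fun i => ofNat (a.1 i)) (ofNat a.2)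

end ScalarTree

/-- Programs. -/
inductive Prog : Type
  /-- return the input -/
  | id : Prog
  /-- return the empty tree -/
  | nil : Prog
  /-- first component -/
  | fst : Prog
  /-- second component -/
  | snd : Prog
  /-- run both programs on the input and return the pair of their results -/
  | pair (f g : Prog) : Prog
  /-- run `g`, then run `f` on its result -/
  | comp (f g : Prog) : Prog
  /-- if the result of `t` is not `nil` then run `f` else run `g`, each on the input -/
  | ite (t f g : Prog) : Prog
  /-- as long as the result of `t` is not `nil`, replace the current tree by the result of `f` -/
  | loop (t f : Prog) : Prog
  /-- the scalar `0` -/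
  | zero : Prog
  /-- the scalar `1` -/
  | one : Prog
  /-- sum of a pair of scalars -/
  | add : Prog
  /-- product of a pair of scalars -/
  | mul : Prog
  /-- negative of a scalar -/
  | neg : Prog
  /-- inverse of a scalar (`0` for the scalar `0`) -/
  | inv : Prog
  /-- is the input the scalar `0`? -/
  | isZero : Prog
  /-- is the input a pair of `(α, ℓ)` and `(β, m)` with `(α, ℓ)` smaller than `(β, m)`? -/
  | less : Prog

/-- `Runs lt A v w`: over the field `K` with the order `lt`, the program `A`, started on the input
`v`, halts after finitely many steps with the output `w`. -/
inductive Prog.Runs {K : Type u} [Field K] {n s : ℕ} (lt : MonIdx n s → MonIdx n s → Prop) :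
    Prog → ScalarTree K → ScalarTree K → Prop
  | id (v) : Runs lt .id v v
  | nil (v) : Runs lt .nil v .nil
  | fst (v) : Runs lt .fst v v.fst
  | snd (v) : Runs lt .snd v v.snd
  | pair {f g v a b} : Runs lt f v a → Runs lt g v b → Runs lt (.pair f g) v (.cons a b)
  | comp {f g v a b} : Runs lt g v a → Runs lt f a b → Runs lt (.comp f g) v b
  | ite_true {t f g v b w} : Runs lt t v b → b ≠ .nil → Runs lt f v w →
      Runs lt (.ite t f g) v w
  | ite_false {t f g v w} : Runs lt t v .nil → Runs lt g v w → Runs lt (.ite t f g) v w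
  | loop_step {t f v b a w} : Runs lt t v b → b ≠ .nil → Runs lt f v a →
      Runs lt (.loop t f) a w → Runs lt (.loop t f) v w
  | loop_stop {t f v} : Runs lt t v .nil → Runs lt (.loop t f) v v
  | zero (v) : Runs lt .zero v (.atom 0)
  | one (v) : Runs lt .one v (.atom 1)
  | add (v) : Runs lt .add v (v.map₂ fun a b => a + b)
  | mul (v) : Runs lt .mul v (v.map₂ fun a b => a * b)
  | neg (v) : Runs lt .neg v (v.map₁ fun a => -a)
  | inv (v) : Runs lt .inv v (v.map₁ fun a => a⁻¹)
  | isZero (v) : Runs lt .isZero v (.ofProp (v = .atom 0))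
  | less (v) : Runs lt .less v
      (.ofProp (∃ a b, v = .cons (.ofMonIdx a) (.ofMonIdx b) ∧ lt a b))

/-- Programs are deterministic: there is at most one output. -/
theorem Prog.Runs.unique {K : Type u} [Field K] {n s : ℕ} {lt : MonIdx n s → MonIdx n s → Prop}
    {A : Prog} {v w w' : ScalarTree K} (h : A.Runs lt v w) (h' : A.Runs lt v w') : w = w' := by
  induction h generalizing w' with
  | pair _ _ ih1 ih2 =>
    cases h' with
    | pair k1 k2 => rw [ih1 k1, ih2 k2]
  | comp _ _ ih1 ih2 =>
    cases h' with
    | comp k1 k2 => exact ih2 (ih1 k1 ▸ k2)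
  | ite_true _ hb _ ih1 ih2 =>
    cases h' with
    | ite_true k1 k2 k3 => exact ih2 k3
    | ite_false k1 k2 => exact absurd (ih1 k1) hb
  | ite_false _ _ ih1 ih2 =>
    cases h' with
    | ite_true k1 k2 k3 => exact absurd (ih1 k1).symm k2
    | ite_false k1 k2 => exact ih2 k2
  | loop_step _ hb _ _ ih1 ih2 ih3 =>
    cases h' with
    | loop_step k1 k2 k3 k4 => exact ih3 (ih2 k3 ▸ k4)
    | loop_stop k1 => exact absurd (ih1 k1) hb
  | loop_stop _ ih1 =>
    cases h' with
    | loop_step k1 k2 k3 k4 => exact absurd (ih1 k1).symm k2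
    | loop_stop k1 => rfl
  | _ => cases h'; rfl

/-! ### Codes as input and output of programs -/

/-- A polynomial in `K[x, y]` written down as a list of terms (exponent, coefficient). The list
is in any order; repeated exponents and zero coefficients are allowed. -/
abbrev PolyData (K : Type u) (n p : ℕ) : Type u :=
  List (((Fin n ⊕ Fin p) →₀ ℕ) × K)

/-- The polynomial which a list of terms denotes: the sum of its terms. -/
noncomputable def PolyData.toPoly {K : Type u} [Field K] {n p : ℕ} (F : PolyData K n p) :
    XYPoly K n p :=
  (F.map fun t => MvPolynomial.monomial t.1 t.2).sum

/-- The tree for a list of terms: a term is the triple consisting of the `x`-exponents, the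
`y`-exponents and the coefficient. -/
def PolyData.toTree {K : Type u} {n p : ℕ} (F : PolyData K n p) : ScalarTree K :=
  .ofList (F.map fun t =>
    .cons (.ofFn fun i => .ofNat (t.1 (Sum.inl i)))
      (.cons (.ofFn fun j => .ofNat (t.1 (Sum.inr j))) (.atom t.2)))

/-- A pair `(H, G)` of `p` polynomials in `K[x, y]` and `r` vectors in `K[x, y]^s`, written down
as lists of terms. -/
structure CodeData (K : Type u) (n s p r : ℕ) : Type u where
  H : Fin p → PolyData K n p
  G : Fin r → Fin s → PolyData K n p

namespace CodeData

variable {K : Type u} {n s p r : ℕ}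

/-- The polynomial vector `H`. -/
noncomputable def mother [Field K] (C : CodeData K n s p r) : Fin p → XYPoly K n p :=
  fun i => (C.H i).toPoly

/-- The polynomial vectors `G_1, …, G_r`. -/
noncomputable def father [Field K] (C : CodeData K n s p r) : Fin r → Fin s → XYPoly K n p :=
  fun k ℓ => (C.G k ℓ).toPoly

/-- The tree for `(H, G)`. -/
def toTree (C : CodeData K n s p r) : ScalarTree K :=
  .cons (.ofFn fun i => (C.H i).toTree) (.ofFn fun k => .ofFn fun ℓ => (C.G k ℓ).toTree)

/-- The input handed to a program: the numbers `n, s, p, r` and the pair `(H, G)`. -/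
def input (C : CodeData K n s p r) : ScalarTree K :=
  .cons (.ofList [.ofNat n, .ofNat s, .ofNat p, .ofNat r]) C.toTree

/-- The output of a program: the numbers `p, r`, the pair `(H, G)` and a list of `r` pairs
`(α, ℓ)`. -/
def output (C : CodeData K n s p r) (a : Fin r → MonIdx n s) : ScalarTree K :=
  .cons (.ofList [.ofNat p, .ofNat r]) (.cons C.toTree (.ofFn fun k => .ofMonIdx (a k)))

end CodeData

/-! ### Formal division by a family of power series vectors -/

section Order

variable {n s : ℕ} {lt : MonIdx n s → MonIdx n s → Prop}

/-! Everything is computed in `K[x,y]^s`, with the vectors `G_k` and `H_i e_ℓ`. The substitution `y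
= h(x)` sends them to `g_k` and to `0`. Monomial vectors `x^α y^β e_ℓ` are ordered by their `x`-part
first and then degree-lexicographically in `y`. As initial terms are minimal terms, ordinary
polynomial division need not stop, and no division is carried out. Instead the polynomial submodule
is filtered by the degree of the coefficients allowed in front of the generators (`XYVec.filt`).
Each layer has finite dimension, and Gauss elimination yields a basis of it with distinct initial
monomial vectors.

The search stops at a level `i` if, during the next `k` levels, every initial monomial vector is an
old one or a variable times an old one; here `k` bounds the degrees of the initial monomial vectors
at level `i`. Then S-vectors of level `i` lie in level `i + k`, where they can be reduced by
multiples of level `i` without leaving that finite-dimensional space (`XYVec.isReducing_of_isStep`,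
`XYVec.sub_shift_mem_stdSpan`). So Buchberger's criterion holds. Such a level exists by Dickson's
lemma, applied to exponents together with a homogenizing degree (`XYVec.exists_forall_isStep`).

The standard basis consists of the values `F(x, h(x))` of those basis elements whose initial
monomial vector is free of `y`. Since `h(0) = 0`, the substitution keeps these initial monomial
vectors (`XYVec.isInitial_subst`). To see that nothing is missing, consider the coefficient
functionals of the remainder of formal division by these values; each depends on finitely many
degrees only. If one of them were nonzero on the value of some multiple of a basis element, choose
such a multiple with the largest initial monomial vector. If that vector contains some `y_j`, it is
also the initial monomial vector of a multiple of a combination of the `H_i e_ℓ` which begins with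
`y_j e_ℓ` (`CodeData.isMonic_varVec`, from the invertible Jacobian) and vanishes at `h`. Otherwise
it belongs to a multiple of a divisor, whose remainder is zero. In both cases the difference is a
combination of multiples with larger initial monomial vectors, a contradiction
(`XYVec.IsComplete.divCoeff_subst_shift`). Hence all remainders of elements of `I` vanish, which
gives the generation of `I` and of `in(I)` at once.

That one program does all this uniformly follows from closure properties of `Computes`. -/

theorem IsMonomialOrder.irrefl (h : IsMonomialOrder lt) (a : MonIdx n s) : ¬ lt a a :=
  fun h1 => h.wf.asymmetric _ _ h1 h1

theorem IsMonomialOrder.asymm (h : IsMonomialOrder lt) {a b : MonIdx n s} (h1 : lt a b) :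
    ¬ lt b a :=
  fun h2 => h.wf.asymmetric _ _ h1 h2

/-- The product of a monomial and a monomial vector. -/
noncomputable def shiftIdx (γ : Fin n →₀ ℕ) (m : MonIdx n s) : MonIdx n s := (γ + m.1, m.2)

theorem IsMonomialOrder.shiftIdx_lt (h : IsMonomialOrder lt) (γ : Fin n →₀ ℕ)
    {a b : MonIdx n s} (hab : lt a b) : lt (shiftIdx γ a) (shiftIdx γ b) := by
  have := h.add a.1 b.1 γ a.2 b.2 hab
  simpa [shiftIdx, add_comm] using this

theorem IsMonomialOrder.lt_of_shiftIdx_lt (h : IsMonomialOrder lt) (γ : Fin n →₀ ℕ)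
    {a b : MonIdx n s} (hab : lt (shiftIdx γ a) (shiftIdx γ b)) : lt a b := by
  rcases h.total a b with h1 | h1 | h1
  · exact h1
  · exact absurd hab (h1 ▸ h.irrefl _)
  · exact absurd hab (h.asymm (h.shiftIdx_lt γ h1))

theorem shiftIdx_injective_left {γ γ' : Fin n →₀ ℕ} {m : MonIdx n s}
    (h : shiftIdx γ m = shiftIdx γ' m) : γ = γ' :=
  add_right_cancel (congrArg Prod.fst h)

theorem shiftIdx_injective (γ : Fin n →₀ ℕ) {m m' : MonIdx n s}
    (h : shiftIdx γ m = shiftIdx γ m') : m = m' :=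
  Prod.ext (add_left_cancel (congrArg Prod.fst h)) (congrArg Prod.snd h :)

end Order

namespace FormalDivision

variable {K : Type u} [Field K] {n s : ℕ} {ι : Type*} [Fintype ι]
  {lt : MonIdx n s → MonIdx n s → Prop}

/-- The coefficient functional. -/
noncomputable def coeffLin (c : MonIdx n s) : SeriesVec K n s →ₗ[K] K :=
  (MvPowerSeries.coeff c.1).restrictScalars K ∘ₗ LinearMap.proj c.2

@[simp] theorem coeffLin_apply (c : MonIdx n s) (f : SeriesVec K n s) :
    coeffLin c f = vecCoeff c f := rfl

open Classical in
/-- The functional which assigns to a vector the coefficient at `c` of the quotients (if `c` is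
assigned by `κ` to a divisor) or of the remainder (otherwise) of its division by `b`. -/
noncomputable def divCoeff (hlt : IsMonomialOrder lt) (b : ι → SeriesVec K n s)
    (a : ι → MonIdx n s) (κ : MonIdx n s → Option ι) :
    MonIdx n s → (SeriesVec K n s →ₗ[K] K) :=
  -- Infinitely many monomial vectors may precede `c`, hence the well-founded recursion; the sum at
  -- `c` is still finite, since only factorizations of `x^(c.1)` enter. The coefficient of `x^γ` in
  -- the `k`-th quotient is stored at the index `shiftIdx γ (a k)`.
  hlt.wf.fix fun c T => coeffLin c - ∑ k, ∑ x ∈ Finset.HasAntidiagonal.antidiagonal c.1,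
    if h : lt (shiftIdx x.1 (a k)) c then
      if κ (shiftIdx x.1 (a k)) = some k then vecCoeff (x.2, c.2) (b k) • T _ h else 0
    else 0

variable (hlt : IsMonomialOrder lt) (b : ι → SeriesVec K n s) (a : ι → MonIdx n s)
  (κ : MonIdx n s → Option ι)

open Classical in
theorem divCoeff_apply (c : MonIdx n s) (f : SeriesVec K n s) :
    divCoeff hlt b a κ c f = vecCoeff c f - ∑ k, ∑ x ∈ Finset.HasAntidiagonal.antidiagonal c.1,
      if lt (shiftIdx x.1 (a k)) c then
        if κ (shiftIdx x.1 (a k)) = some k then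
          vecCoeff (x.2, c.2) (b k) * divCoeff hlt b a κ (shiftIdx x.1 (a k)) f else 0
      else 0 := by
  conv_lhs => rw [divCoeff, WellFounded.fix_eq]
  rw [LinearMap.sub_apply, LinearMap.sum_apply, coeffLin_apply]
  congr 1
  refine Finset.sum_congr rfl fun k _ => ?_
  rw [LinearMap.sum_apply]
  refine Finset.sum_congr rfl fun x _ => ?_
  split_ifs <;> simp [divCoeff]

/-- All earlier coefficients of the division vanish by induction, so nothing is subtracted at `c`.
Thus an initial term outside the multiples of the `a k` would survive in the remainder. -/
theorem divCoeff_eq_zero_of_forall_lt {c : MonIdx n s} {f : SeriesVec K n s}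
    (h : ∀ c', lt c' c → vecCoeff c' f = 0) :
    divCoeff hlt b a κ c f = vecCoeff c f := by
  induction c using hlt.wf.induction with
  | _ c ih =>
    rw [divCoeff_apply, sub_eq_self]
    refine Finset.sum_eq_zero fun k _ => Finset.sum_eq_zero fun x _ => ?_
    split_ifs with h1 h2
    · rw [ih _ h1 fun c' hc' => h c' (hlt.trans _ _ _ hc' h1), h _ h1, mul_zero]
    · rfl
    · rfl

/-- The recursion below `c` reaches only finitely many coefficients of `f`. This continuity in the
`x`-adic topology replaces all limit arguments. -/
theorem exists_degree_bound (c : MonIdx n s) :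
    ∃ N : ℕ, ∀ f : SeriesVec K n s, (∀ c' : MonIdx n s, c'.1.degree < N → vecCoeff c' f = 0) →
      divCoeff hlt b a κ c f = 0 := by
  induction c using hlt.wf.induction with
  | _ c ih =>
    choose! N hN using ih
    refine ⟨(c.1.degree + 1) ⊔ (Finset.univ.sup fun k => (Finset.HasAntidiagonal.antidiagonal c.1).sup fun x =>
      N (shiftIdx x.1 (a k))), fun f hf => ?_⟩
    rw [divCoeff_apply, hf c (lt_of_lt_of_le (Nat.lt_succ_self _) le_sup_left), zero_sub,
      neg_eq_zero]
    refine Finset.sum_eq_zero fun k hk => Finset.sum_eq_zero fun x hx => ?_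
    split_ifs with h1 h2
    · rw [hN _ h1 f fun c' hc' => hf c' (lt_of_lt_of_le hc' ?_), mul_zero]
      exact ((Finset.le_sup (f := fun x => N (shiftIdx x.1 (a k))) hx).trans
        (Finset.le_sup (f := fun k => (Finset.HasAntidiagonal.antidiagonal c.1).sup fun x =>
          N (shiftIdx x.1 (a k))) hk)).trans le_sup_right
    · rfl
    · rfl

variable {b a κ}

open Classical in
-- Uniqueness of division for `x^γ b_k`: if its initial monomial vector is assigned to `k`, the only
-- quotient term is `x^γ` and the remainder is zero.
theorem divCoeff_monomial_smul
    (hb : ∀ k, vecCoeff (a k) (b k) = 1) (hb' : ∀ k c, lt c (a k) → vecCoeff c (b k) = 0)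
    {γ : Fin n →₀ ℕ} {k : ι} (hk : κ (shiftIdx γ (a k)) = some k) (c : MonIdx n s) :
    divCoeff hlt b a κ c ((MvPowerSeries.monomial γ (1 : K)) • b k) =
      if c = shiftIdx γ (a k) then 1 else 0 := by
  have hcoeff : ∀ c : MonIdx n s, vecCoeff c ((MvPowerSeries.monomial γ (1 : K)) • b k) =
      ∑ x ∈ Finset.HasAntidiagonal.antidiagonal c.1, if x.1 = γ then vecCoeff (x.2, c.2) (b k) else 0 := by
    intro c
    rw [vecCoeff, Pi.smul_apply, smul_eq_mul, MvPowerSeries.coeff_mul]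
    refine Finset.sum_congr rfl fun x _ => ?_
    rw [MvPowerSeries.coeff_monomial]
    split_ifs <;> simp [vecCoeff]
  induction c using hlt.wf.induction with
  | _ c ih =>
    -- By induction the only earlier index with a nonzero value is `shiftIdx γ (a k)`, so the double
    -- sum collapses to the coefficient of `x^γ b_k` at `c`, provided that this index precedes `c`.
    have key : (∑ k', ∑ x ∈ Finset.HasAntidiagonal.antidiagonal c.1,
        if lt (shiftIdx x.1 (a k')) c then
          if κ (shiftIdx x.1 (a k')) = some k' then
            vecCoeff (x.2, c.2) (b k') * divCoeff hlt b a κ (shiftIdx x.1 (a k'))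
              ((MvPowerSeries.monomial γ (1 : K)) • b k) else 0
        else 0) = ∑ x ∈ Finset.HasAntidiagonal.antidiagonal c.1,
          if lt (shiftIdx γ (a k)) c then
            if x.1 = γ then vecCoeff (x.2, c.2) (b k) else 0 else 0 := by
      rw [Finset.sum_eq_single k]
      · refine Finset.sum_congr rfl fun x _ => ?_
        by_cases hx : x.1 = γ
        · subst hx
          by_cases h1 : lt (shiftIdx x.1 (a k)) c
          · rw [if_pos h1, if_pos hk, ih _ h1]; simp [h1]
          · simp [h1]
        · rw [if_neg hx, ite_self]
          split_ifs with h1 h2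
          · rw [ih _ h1, if_neg fun h => hx (shiftIdx_injective_left h), mul_zero]
          · rfl
          · rfl
      · intro k' _ hk'
        refine Finset.sum_eq_zero fun x _ => ?_
        split_ifs with h1 h2
        · rw [ih _ h1, if_neg, mul_zero]
          intro h
          rw [h, hk] at h2
          exact hk' (Option.some.inj h2).symm
        · rfl
        · rfl
      · intro h; exact absurd (Finset.mem_univ _) h
    rw [divCoeff_apply, key, hcoeff]
    rcases hlt.total (shiftIdx γ (a k)) c with h | h | h
    · rw [if_neg fun h' => hlt.irrefl c (by rw [h'] at h ⊢; exact h)]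
      simp [h]
    · have : ¬ lt (shiftIdx γ (a k)) c := by rw [h]; exact hlt.irrefl c
      simp only [this, if_false, Finset.sum_const_zero, sub_zero, if_pos h.symm]
      subst h
      rw [Finset.sum_eq_single (γ, (a k).1)]
      · simpa [shiftIdx] using hb k
      · rintro ⟨x, y⟩ hx hne
        rw [if_neg]
        rintro rfl
        simp only [shiftIdx, Finset.HasAntidiagonal.mem_antidiagonal, add_right_inj] at hx
        exact hne (by rw [hx])
      · intro h; simp [shiftIdx] at h
    · rw [if_neg fun h' => hlt.irrefl c (by rw [← h'] at h; exact h)]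
      simp only [hlt.asymm h, if_false, Finset.sum_const_zero, sub_zero]
      refine Finset.sum_eq_zero fun x hx => ?_
      split_ifs with h1
      · refine hb' _ _ (hlt.lt_of_shiftIdx_lt γ ?_)
        rw [Finset.HasAntidiagonal.mem_antidiagonal, h1] at hx
        rw [shiftIdx, hx]; exact h
      · rfl

open Classical in
-- The stored coefficients are assembled into power series `Q k`, and the recursion for `divCoeff`
-- is the comparison of coefficients in `f = ∑ k, Q k • b k`.
theorem mem_span_of_divCoeff_eq_zero (hκ : ∀ c k, κ c = some k → ∃ γ, shiftIdx γ (a k) = c)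
    (hb : ∀ k, vecCoeff (a k) (b k) = 1) (hb' : ∀ k c, lt c (a k) → vecCoeff c (b k) = 0)
    {f : SeriesVec K n s} (hf : ∀ c, κ c = none → divCoeff hlt b a κ c f = 0) :
    f ∈ Submodule.span (MvPowerSeries (Fin n) K) (Set.range b) := by
  let Q : ι → MvPowerSeries (Fin n) K := fun k γ =>
    if κ (shiftIdx γ (a k)) = some k then divCoeff hlt b a κ (shiftIdx γ (a k)) f else 0
  have hQ : ∀ k γ, MvPowerSeries.coeff γ (Q k) =
    if κ (shiftIdx γ (a k)) = some k then divCoeff hlt b a κ (shiftIdx γ (a k)) f else 0 :=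
    fun _ _ => rfl
  suffices h : f = ∑ k, Q k • b k by
    rw [h]
    exact Submodule.sum_mem _ fun k _ => Submodule.smul_mem _ _ (Submodule.subset_span ⟨k, rfl⟩)
  funext ℓ
  ext α
  set c : MonIdx n s := (α, ℓ) with hc
  have h1 : MvPowerSeries.coeff α ((∑ k, Q k • b k) ℓ) = ∑ k, ∑ x ∈ Finset.HasAntidiagonal.antidiagonal c.1,
      (if κ (shiftIdx x.1 (a k)) = some k then
        divCoeff hlt b a κ (shiftIdx x.1 (a k)) f else 0) * vecCoeff (x.2, c.2) (b k) := by
    rw [Finset.sum_apply, map_sum]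
    refine Finset.sum_congr rfl fun k _ => ?_
    rw [Pi.smul_apply, smul_eq_mul, MvPowerSeries.coeff_mul]
    rfl
  have h2 := divCoeff_apply hlt b a κ c f
  -- A summand with `shiftIdx x.1 (a k)` beyond `c` vanishes because `b k` starts at `a k`. Equality
  -- with `c` gives the term that the recursion does not subtract, with coefficient one.
  have h3 : ∀ k, ∀ x ∈ Finset.HasAntidiagonal.antidiagonal c.1,
      (if κ (shiftIdx x.1 (a k)) = some k then
        divCoeff hlt b a κ (shiftIdx x.1 (a k)) f else 0) * vecCoeff (x.2, c.2) (b k) =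
      (if lt (shiftIdx x.1 (a k)) c then
        if κ (shiftIdx x.1 (a k)) = some k then
          vecCoeff (x.2, c.2) (b k) * divCoeff hlt b a κ (shiftIdx x.1 (a k)) f else 0
      else 0) + if shiftIdx x.1 (a k) = c ∧ κ c = some k then divCoeff hlt b a κ c f else 0 := by
    intro k x hx
    have hx' : shiftIdx x.1 (x.2, c.2) = c := by
      rw [Finset.HasAntidiagonal.mem_antidiagonal] at hx
      rw [shiftIdx, hx]
    rcases hlt.total (shiftIdx x.1 (a k)) c with h | h | h
    · have hn : ¬ (shiftIdx x.1 (a k) = c ∧ κ c = some k) := fun h' =>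
        hlt.irrefl c (by rw [h'.1] at h; exact h)
      rw [if_pos h, if_neg hn, add_zero]
      split_ifs <;> ring
    · have h4 : vecCoeff (x.2, c.2) (b k) = 1 := by
        rw [← hb k]; congr 1; exact shiftIdx_injective x.1 (hx'.trans h.symm)
      rw [h4, h, if_neg (hlt.irrefl c), zero_add, mul_one]; simp
    · have hn : ¬ (shiftIdx x.1 (a k) = c ∧ κ c = some k) := fun h' =>
        hlt.irrefl c (by rw [h'.1] at h; exact h)
      rw [hb' k (x.2, c.2) (hlt.lt_of_shiftIdx_lt x.1 (by rw [hx']; exact h)),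
        if_neg (hlt.asymm h), if_neg hn, mul_zero, add_zero]
  rw [h1, Finset.sum_congr rfl fun k _ => Finset.sum_congr rfl (h3 k)]
  simp only [Finset.sum_add_distrib]
  have h5 : (∑ k, ∑ x ∈ Finset.HasAntidiagonal.antidiagonal c.1,
      if shiftIdx x.1 (a k) = c ∧ κ c = some k then divCoeff hlt b a κ c f else 0) =
      divCoeff hlt b a κ c f := by
    rcases hκc : κ c with _ | k
    · simp [hf c hκc]
    · obtain ⟨γ, hγ⟩ := hκ c k hκc
      rw [Finset.sum_eq_single k, Finset.sum_eq_single (γ, (a k).1)]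
      · simp [hγ]
      · rintro ⟨x, y⟩ hx hne
        rw [if_neg]
        rintro ⟨h, -⟩
        have hxγ : x = γ := shiftIdx_injective_left (h.trans hγ.symm)
        subst hxγ
        apply hne
        rw [← hγ] at hx
        simp only [shiftIdx, Finset.HasAntidiagonal.mem_antidiagonal, add_right_inj] at hx
        rw [hx]
      · intro h; exact absurd (by rw [← hγ]; simp [shiftIdx]) h
      · intro k' _ hk'
        refine Finset.sum_eq_zero fun x _ => if_neg fun h => hk' (Option.some.inj h.2).symm
      · intro h; exact absurd (Finset.mem_univ _) h
  rw [h5, h2]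
  exact (add_sub_cancel _ _).symm

end FormalDivision

/-! ### Monomial vectors in the variables `x` and `y` -/

/-- Triples `(α, ℓ, β)`; they index the monomial vectors `x^α y^β e_ℓ`. -/
abbrev XYMon (n s p : ℕ) : Type := MonIdx n s × (Fin p →₀ ℕ)

/-- Exponents of monomials in `x` and `y`. -/
abbrev XYExp (n p : ℕ) : Type := (Fin n →₀ ℕ) × (Fin p →₀ ℕ)

theorem exists_single_add {σ : Type*} {β : σ →₀ ℕ} (hβ : β ≠ 0) :
    ∃ i γ, β = Finsupp.single i 1 + γ := by
  obtain ⟨i, hi⟩ := DFunLike.ne_iff.mp hβ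
  refine ⟨i, β - Finsupp.single i 1, (add_tsub_cancel_of_le ?_).symm⟩
  rw [Finsupp.single_le_iff]
  exact Nat.one_le_iff_ne_zero.mpr hi

section XYOrder

variable {n s p : ℕ} {lt : MonIdx n s → MonIdx n s → Prop}

/-- The total degree. -/
noncomputable def XYExp.deg (u : XYExp n p) : ℕ := u.1.degree + u.2.degree

@[simp] theorem XYExp.deg_add (u v : XYExp n p) : XYExp.deg (u + v) = u.deg + XYExp.deg v := by
  simp only [XYExp.deg, Prod.fst_add, Prod.snd_add, map_add]; omega

/-- The exponent of a monomial vector. -/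
def XYMon.exp (m : XYMon n s p) : XYExp n p := (m.1.1, m.2)

/-- The product of a monomial and a monomial vector. -/
noncomputable def XYMon.act (u : XYExp n p) (m : XYMon n s p) : XYMon n s p :=
  (shiftIdx u.1 m.1, u.2 + m.2)

namespace XYMon

theorem ext_exp {m m' : XYMon n s p} (h : m.exp = m'.exp) (h' : m.1.2 = m'.1.2) : m = m' :=
  Prod.ext (Prod.ext (congrArg Prod.fst h :) h') (congrArg Prod.snd h :)

@[simp] theorem exp_act (u : XYExp n p) (m : XYMon n s p) : (act u m).exp = u + m.exp := rfl

@[simp] theorem comp_act (u : XYExp n p) (m : XYMon n s p) : (act u m).1.2 = m.1.2 := rfl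

@[simp] theorem act_zero (m : XYMon n s p) : act 0 m = m := ext_exp (by simp) rfl

theorem act_act (u v : XYExp n p) (m : XYMon n s p) : act u (act v m) = act (u + v) m :=
  ext_exp (by simp [add_assoc]) rfl

theorem act_injective (u : XYExp n p) : Function.Injective (act u : XYMon n s p → _) := by
  intro m m' h
  refine ext_exp ?_ (by simpa using congrArg (fun m : XYMon n s p => m.1.2) h)
  have := congrArg exp h
  simpa using this

/-- The degree-lexicographic key of an exponent. -/
noncomputable def yKey (β : Fin p →₀ ℕ) : List ℕ := β.degree :: List.ofFn β

theorem yKey_injective {β β' : Fin p →₀ ℕ} (h : yKey β = yKey β') : β = β' :=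
  DFunLike.coe_injective (List.ofFn_injective (List.cons.inj h).2)

theorem List_zipWith_add_lt {l l' : List ℕ} (h : l < l') (g : List ℕ) (hl : l.length = l'.length)
    (hg : l.length = g.length) : List.zipWith (· + ·) l g < List.zipWith (· + ·) l' g := by
  induction l generalizing l' g with
  | nil => cases l' with
    | nil => exact absurd h (List.lt_irrefl _)
    | cons a l' => simp at hl
  | cons a l ih =>
    cases l' with
    | nil => simp at hl
    | cons a' l' => cases g with
      | nil => simp at hg
      | cons b g =>
        rw [List.zipWith_cons_cons, List.zipWith_cons_cons, List.cons_lt_cons_iff]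
        rw [List.cons_lt_cons_iff] at h
        rcases h with h | ⟨rfl, h⟩
        · exact Or.inl (by omega)
        · exact Or.inr ⟨rfl, ih h g (by simpa using hl) (by simpa using hg)⟩

theorem yKey_add (β γ : Fin p →₀ ℕ) :
    yKey (β + γ) = List.zipWith (· + ·) (yKey β) (yKey γ) := by
  simp only [yKey, List.zipWith_cons_cons, map_add, List.cons.injEq, true_and]
  apply List.ext_getElem <;> simp

theorem yKey_add_lt {β β' : Fin p →₀ ℕ} (h : yKey β < yKey β') (γ : Fin p →₀ ℕ) :
    yKey (β + γ) < yKey (β' + γ) := by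
  rw [yKey_add, yKey_add]
  exact List_zipWith_add_lt h _ (by simp [yKey]) (by simp [yKey])

/-- The order on monomial vectors in `x` and `y`, in which the `x`-part is compared first. -/
def Lt (lt : MonIdx n s → MonIdx n s → Prop) (a b : XYMon n s p) : Prop :=
  lt a.1 b.1 ∨ a.1 = b.1 ∧ yKey a.2 < yKey b.2

variable (hlt : IsMonomialOrder lt)
include hlt

theorem Lt.irrefl (a : XYMon n s p) : ¬ Lt lt a a := by
  rintro (h | ⟨-, h⟩)
  · exact hlt.irrefl _ h
  · exact lt_irrefl _ h

theorem Lt.trans {a b c : XYMon n s p} (h : Lt lt a b) (h' : Lt lt b c) : Lt lt a c := by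
  rcases h with h | ⟨h1, h2⟩ <;> rcases h' with h' | ⟨h3, h4⟩
  · exact Or.inl (hlt.trans _ _ _ h h')
  · exact Or.inl (h3 ▸ h)
  · exact Or.inl (h1 ▸ h')
  · exact Or.inr ⟨h1.trans h3, h2.trans h4⟩

theorem Lt.asymm {a b : XYMon n s p} (h : Lt lt a b) : ¬ Lt lt b a :=
  fun h' => Lt.irrefl hlt a (Lt.trans hlt h h')

theorem Lt.total (a b : XYMon n s p) : Lt lt a b ∨ a = b ∨ Lt lt b a := by
  rcases hlt.total a.1 b.1 with h | h | h
  · exact Or.inl (Or.inl h)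
  · rcases lt_trichotomy (yKey a.2) (yKey b.2) with h' | h' | h'
    · exact Or.inl (Or.inr ⟨h, h'⟩)
    · exact Or.inr (Or.inl (Prod.ext h (yKey_injective h')))
    · exact Or.inr (Or.inr (Or.inr ⟨h.symm, h'⟩))
  · exact Or.inr (Or.inr (Or.inl h))

theorem Lt.act {a b : XYMon n s p} (h : Lt lt a b) (u : XYExp n p) :
    Lt lt (act u a) (XYMon.act u b) := by
  rcases h with h | ⟨h1, h2⟩
  · exact Or.inl (hlt.shiftIdx_lt _ h)
  · refine Or.inr ⟨by simp only [XYMon.act, h1], ?_⟩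
    have := yKey_add_lt h2 u.2
    rwa [add_comm a.2, add_comm b.2] at this

/-- The monomial vector `y_j e_ℓ` is smaller than all monomial vectors in the component `ℓ`
except for `e_ℓ` and the `y_i e_ℓ`. -/
theorem lt_of_ne (ℓ : Fin s) (j : Fin p) {c : XYMon n s p} (hc : c.1.2 = ℓ)
    (h0 : c ≠ ((0, ℓ), 0)) (h1 : ∀ i, c ≠ ((0, ℓ), Finsupp.single i 1)) :
    Lt lt ((0, ℓ), Finsupp.single j 1) c := by
  obtain ⟨⟨α, ℓ'⟩, β⟩ := c
  obtain rfl : ℓ' = ℓ := hc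
  by_cases hα : α = 0
  · subst hα
    refine Or.inr ⟨rfl, ?_⟩
    rw [yKey, yKey, List.cons_lt_cons_iff]
    left
    rw [Finsupp.degree_single]
    by_contra hle
    have hβ : β ≠ 0 := fun h => h0 (by rw [h])
    have hd : β.degree = 1 := by
      have : β.degree ≠ 0 := fun h => hβ ((Finsupp.degree_eq_zero_iff β).mp h)
      change ¬ 1 < β.degree at hle
      omega
    obtain ⟨i, γ, rfl⟩ := exists_single_add hβ
    rw [map_add, Finsupp.degree_single, Nat.add_eq_left, Finsupp.degree_eq_zero_iff] at hd
    exact h1 i (by rw [hd, add_zero])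
  · exact Or.inl (hlt.zero_lt α hα _)

end XYMon

end XYOrder

/-! ### Polynomial vectors as finitely supported functions on monomial vectors -/

namespace XYVec

variable {K : Type u} [Field K] {n s p : ℕ} {lt : MonIdx n s → MonIdx n s → Prop}

/-- Multiplication by a monomial. -/
noncomputable def shift (u : XYExp n p) : (XYMon n s p →₀ K) →ₗ[K] (XYMon n s p →₀ K) :=
  Finsupp.lmapDomain K K (XYMon.act u)

@[simp] theorem shift_single (u : XYExp n p) (m : XYMon n s p) (c : K) :
    shift u (Finsupp.single m c) = Finsupp.single (XYMon.act u m) c :=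
  Finsupp.mapDomain_single

theorem shift_act (u : XYExp n p) (F : XYMon n s p →₀ K) (m : XYMon n s p) :
    shift u F (XYMon.act u m) = F m :=
  Finsupp.mapDomain_apply (XYMon.act_injective u) _ _

theorem exists_of_shift_ne_zero {u : XYExp n p} {F : XYMon n s p →₀ K} {c : XYMon n s p}
    (h : shift u F c ≠ 0) : ∃ m, XYMon.act u m = c ∧ F m ≠ 0 := by
  by_cases hc : c ∈ Set.range (XYMon.act u)
  · obtain ⟨m, rfl⟩ := hc
    exact ⟨m, rfl, by rwa [shift_act] at h⟩
  · exact absurd (Finsupp.mapDomain_of_notMem_range _ _ hc) h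

theorem shift_shift (u v : XYExp n p) (F : XYMon n s p →₀ K) :
    shift u (shift v F) = shift (u + v) F := by
  induction F using Finsupp.induction_linear with
  | zero => simp
  | add f g hf hg => simp only [map_add, hf, hg]
  | single m c => simp [XYMon.act_act]

@[simp] theorem shift_zero (F : XYMon n s p →₀ K) : shift 0 F = F := by
  induction F using Finsupp.induction_linear with
  | zero => simp
  | add f g hf hg => simp only [map_add, hf, hg]
  | single m c => simp

/-- `a` is the initial monomial vector of `F`, with coefficient `1`. -/
def IsMonic (lt : MonIdx n s → MonIdx n s → Prop) (a : XYMon n s p) (F : XYMon n s p →₀ K) :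
    Prop :=
  F a = 1 ∧ ∀ c, F c ≠ 0 → c = a ∨ XYMon.Lt lt a c

/-- The polynomial vectors all of whose monomial vectors are larger than `l`. -/
def above (lt : MonIdx n s → MonIdx n s → Prop) (l : XYMon n s p) : Submodule K (XYMon n s p →₀ K) where
  carrier := {F | ∀ c, F c ≠ 0 → XYMon.Lt lt l c}
  zero_mem' := by intro c h; simp at h
  add_mem' := by
    intro F G hF hG c h
    by_cases h1 : F c = 0
    · exact hG c fun h2 => h (by simp [h1, h2])
    · exact hF c h1
  smul_mem' := by
    intro k F hF c h
    exact hF c fun h2 => h (by simp [h2])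

theorem IsMonic.shift (hlt : IsMonomialOrder lt) {a : XYMon n s p} {F : XYMon n s p →₀ K}
    (h : IsMonic lt a F) (u : XYExp n p) : IsMonic lt (XYMon.act u a) (shift u F) := by
  refine ⟨by rw [shift_act, h.1], fun c hc => ?_⟩
  obtain ⟨m, rfl, hm⟩ := exists_of_shift_ne_zero hc
  rcases h.2 m hm with rfl | h'
  · exact Or.inl rfl
  · exact Or.inr (h'.act hlt u)

theorem sub_mem_above {a : XYMon n s p} {F G : XYMon n s p →₀ K}
    (hF : ∀ c, F c ≠ 0 → c = a ∨ XYMon.Lt lt a c) (hG : IsMonic lt a G) :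
    F - F a • G ∈ above lt a := by
  intro c hc
  by_cases h : c = a
  · subst h; simp [hG.1] at hc
  · by_cases h1 : F c = 0
    · by_cases h2 : G c = 0
      · simp [h1, h2] at hc
      · exact (hG.2 c h2).resolve_left h
    · exact (hF c h1).resolve_left h

theorem exists_min (hlt : IsMonomialOrder lt) {F : XYMon n s p →₀ K} (hF : F ≠ 0) :
    ∃ a, F a ≠ 0 ∧ ∀ c, F c ≠ 0 → c = a ∨ XYMon.Lt lt a c := by
  have key : ∀ S : Finset (XYMon n s p), S.Nonempty →
      ∃ a ∈ S, ∀ c ∈ S, c = a ∨ XYMon.Lt lt a c := by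
    intro S hS
    induction hS using Finset.Nonempty.cons_induction with
    | singleton a => exact ⟨a, by simp, fun c hc => Or.inl (by simpa using hc)⟩
    | cons b S hb hS ih =>
      obtain ⟨a, ha, h⟩ := ih
      rcases XYMon.Lt.total hlt a b with h1 | h1 | h1
      · refine ⟨a, by simp [ha], fun c hc => ?_⟩
        rcases Finset.mem_cons.mp hc with rfl | hc
        · exact Or.inr h1
        · exact h c hc
      · exact absurd (h1 ▸ ha) hb
      · refine ⟨b, by simp, fun c hc => ?_⟩
        rcases Finset.mem_cons.mp hc with rfl | hc
        · exact Or.inl rfl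
        · rcases h c hc with rfl | h2
          · exact Or.inr h1
          · exact Or.inr (h1.trans hlt h2)
  obtain ⟨a, ha, h⟩ := key F.support (Finsupp.support_nonempty_iff.mpr hF)
  exact ⟨a, Finsupp.mem_support_iff.mp ha, fun c hc => h c (Finsupp.mem_support_iff.mpr hc)⟩

/-! #### Standard representations -/

/-- The multiples of the elements of `E` with initial monomial vector beyond `l` span the
standard representations. -/
noncomputable def stdSpan (lt : MonIdx n s → MonIdx n s → Prop)
    (E : Set (XYMon n s p × (XYMon n s p →₀ K))) (l : XYMon n s p) :
    Submodule K (XYMon n s p →₀ K) :=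
  Submodule.span K {f | ∃ e ∈ E, ∃ m, XYMon.Lt lt l (XYMon.act m e.1) ∧ f = shift m e.2}

theorem stdSpan_mono (hlt : IsMonomialOrder lt) {E : Set (XYMon n s p × (XYMon n s p →₀ K))}
    {l l' : XYMon n s p} (h : XYMon.Lt lt l l') : stdSpan lt E l' ≤ stdSpan lt E l := by
  refine Submodule.span_mono ?_
  rintro f ⟨e, he, m, hm, rfl⟩
  exact ⟨e, he, m, h.trans hlt hm, rfl⟩

theorem shift_mem_stdSpan (hlt : IsMonomialOrder lt)
    {E : Set (XYMon n s p × (XYMon n s p →₀ K))} {l : XYMon n s p} {f : XYMon n s p →₀ K}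
    (hf : f ∈ stdSpan lt E l) (u : XYExp n p) : shift u f ∈ stdSpan lt E (XYMon.act u l) := by
  induction hf using Submodule.span_induction with
  | mem f h =>
    obtain ⟨e, he, m, hm, rfl⟩ := h
    refine Submodule.subset_span ⟨e, he, u + m, ?_, shift_shift _ _ _⟩
    rw [← XYMon.act_act]
    exact hm.act hlt u
  | zero => rw [map_zero]; exact Submodule.zero_mem _
  | add f g _ _ hf hg => rw [map_add]; exact Submodule.add_mem _ hf hg
  | smul c f _ hf => rw [map_smul]; exact Submodule.smul_mem _ _ hf

/-- The initial monomial vectors of `W` lie in the finite set `S`, and each element of `S` is the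
initial monomial vector of a multiple in `W` of an element of `E`. -/
structure IsReducing (lt : MonIdx n s → MonIdx n s → Prop)
    (E : Set (XYMon n s p × (XYMon n s p →₀ K))) (W : Submodule K (XYMon n s p →₀ K))
    (S : Finset (XYMon n s p)) : Prop where
  monic : ∀ e ∈ E, IsMonic lt e.1 e.2
  initial : ∀ f ∈ W, ∀ a, f a ≠ 0 → (∀ c, f c ≠ 0 → c = a ∨ XYMon.Lt lt a c) → a ∈ S
  multiple : ∀ a ∈ S, ∃ e ∈ E, ∃ m, XYMon.act m e.1 = a ∧ shift m e.2 ∈ W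

/-- One reduction step: the multiple that cancels the initial term belongs to `W` itself, so the
result stays in `W`. -/
theorem IsReducing.exists_sub (hlt : IsMonomialOrder lt)
    {E : Set (XYMon n s p × (XYMon n s p →₀ K))} {W : Submodule K (XYMon n s p →₀ K)}
    {S : Finset (XYMon n s p)} (h : IsReducing lt E W S) {f : XYMon n s p →₀ K} (hf : f ∈ W)
    (h0 : f ≠ 0) : ∃ a ∈ S, f a ≠ 0 ∧ ∃ e ∈ E, ∃ m, XYMon.act m e.1 = a ∧
      f - f a • shift m e.2 ∈ W ⊓ above lt a := by
  obtain ⟨a, ha, hmin⟩ := exists_min hlt h0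
  have haS := h.initial f hf a ha hmin
  obtain ⟨e, he, m, rfl, hm⟩ := h.multiple a haS
  exact ⟨_, haS, ha, e, he, m, rfl, Submodule.sub_mem _ hf (Submodule.smul_mem _ _ hm),
    sub_mem_above hmin ((h.monic e he).shift hlt m)⟩

/-- Reduction inside `W` meets strictly increasing initial monomial vectors, all in the finite set
`S`; therefore it ends, although minimal terms are being cancelled. The induction counts the
elements of `S` beyond `l`. -/
theorem IsReducing.mem_stdSpan (hlt : IsMonomialOrder lt)
    {E : Set (XYMon n s p × (XYMon n s p →₀ K))} {W : Submodule K (XYMon n s p →₀ K)}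
    {S : Finset (XYMon n s p)} (h : IsReducing lt E W S) {l : XYMon n s p} :
    W ⊓ above lt l ≤ stdSpan lt E l := by
  classical
  induction hk : (S.filter fun a => XYMon.Lt lt l a).card using Nat.strong_induction_on
    generalizing l with
  | _ k ih =>
    rintro f ⟨hf, hfl⟩
    by_cases h0 : f = 0
    · rw [h0]; exact Submodule.zero_mem _
    obtain ⟨a, haS, ha, e, he, m, rfl, hsub⟩ := h.exists_sub hlt hf h0
    have hla := hfl _ ha
    have h1 : f - f (XYMon.act m e.1) • shift m e.2 ∈ stdSpan lt E (XYMon.act m e.1) := by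
      -- The initial monomial vector just cancelled lies beyond `l` but not beyond itself, so the
      -- count drops.
      refine ih _ ?_ rfl hsub
      rw [← hk]
      refine Finset.card_lt_card (Finset.ssubset_iff_of_subset ?_ |>.mpr
        ⟨XYMon.act m e.1, by simp [haS, hla], by simp [XYMon.Lt.irrefl hlt]⟩)
      intro c hc
      simp only [Finset.mem_filter] at hc ⊢
      exact ⟨hc.1, hla.trans hlt hc.2⟩
    have h2 := Submodule.add_mem _ (stdSpan_mono hlt hla h1)
      (Submodule.smul_mem _ (f (XYMon.act m e.1)) (Submodule.subset_span ⟨e, he, m, hla, rfl⟩))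
    simpa using h2

theorem IsReducing.mem_span (hlt : IsMonomialOrder lt)
    {E : Set (XYMon n s p × (XYMon n s p →₀ K))} {W : Submodule K (XYMon n s p →₀ K)}
    {S : Finset (XYMon n s p)} (h : IsReducing lt E W S) {f : XYMon n s p →₀ K} (hf : f ∈ W) :
    f ∈ Submodule.span K {f | ∃ e ∈ E, ∃ m, f = shift m e.2} := by
  by_cases h0 : f = 0
  · rw [h0]; exact Submodule.zero_mem _
  obtain ⟨a, haS, ha, e, he, m, rfl, hsub⟩ := h.exists_sub hlt hf h0
  have h1 : stdSpan lt E (XYMon.act m e.1) ≤ Submodule.span K {f | ∃ e ∈ E, ∃ m, f = shift m e.2} :=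
    Submodule.span_mono fun f ⟨e, he, m, _, hm⟩ => ⟨e, he, m, hm⟩
  have h2 := Submodule.add_mem _ (h1 (h.mem_stdSpan hlt hsub))
    (Submodule.smul_mem _ (f (XYMon.act m e.1)) (Submodule.subset_span ⟨e, he, m, rfl⟩))
  simpa using h2

/-! #### Substitution of the baby series -/

variable (h : Fin p → MvPowerSeries (Fin n) K)

/-- The value of a monomial vector. -/
noncomputable def substMon (m : XYMon n s p) : SeriesVec K n s :=
  Pi.single m.1.2 (MvPowerSeries.monomial m.1.1 (1 : K) * ∏ j, h j ^ m.2 j)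

/-- The substitution `F ↦ F(x, h(x))` on polynomial vectors. -/
noncomputable def subst : (XYMon n s p →₀ K) →ₗ[K] SeriesVec K n s :=
  Finsupp.linearCombination K (substMon h)

theorem subst_single (m : XYMon n s p) (c : K) :
    subst h (Finsupp.single m c) = c • substMon h m :=
  Finsupp.linearCombination_single _ _ _

theorem subst_shift (u : XYExp n p) (F : XYMon n s p →₀ K) :
    subst h (shift u F) =
      (MvPowerSeries.monomial u.1 (1 : K) * ∏ j, h j ^ u.2 j) • subst h F := by
  induction F using Finsupp.induction_linear with
  | zero => simp
  | add f g hf hg => simp only [map_add, hf, hg, smul_add]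
  | single m c =>
    rw [shift_single, subst_single, subst_single, smul_comm]
    congr 1
    rw [substMon, substMon, ← Pi.single_smul]
    simp only [XYMon.act, shiftIdx, Finsupp.add_apply, pow_add, Finset.prod_mul_distrib,
      smul_eq_mul]
    congr 1
    have : MvPowerSeries.monomial (u.1 + m.1.1) (1 : K) =
        MvPowerSeries.monomial u.1 1 * MvPowerSeries.monomial m.1.1 1 := by
      rw [MvPowerSeries.monomial_mul_monomial, one_mul]
    rw [this]; ring

theorem vecCoeff_substMon_self (a : MonIdx n s) :
    vecCoeff a (substMon h ((a, 0) : XYMon n s p)) = 1 := by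
  classical
  simp [vecCoeff, substMon]

variable {h} (hh : ∀ j, MvPowerSeries.constantCoeff (h j) = 0)
include hh

/-- Every factor `x_i` or `h_j` raises the order by at least one, as `h_j` has no constant term. -/
theorem le_order_monomial (u : XYExp n p) :
    (u.deg : ℕ∞) ≤ (MvPowerSeries.monomial u.1 (1 : K) * ∏ j, h j ^ u.2 j).order := by
  classical
  refine le_trans ?_ MvPowerSeries.le_order_mul
  rw [MvPowerSeries.order_monomial_of_ne_zero one_ne_zero, XYExp.deg, Nat.cast_add]
  gcongr
  refine le_trans ?_ (MvPowerSeries.le_order_prod _ _)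
  rw [Finsupp.degree_eq_sum, Nat.cast_sum]
  exact Finset.sum_le_sum fun j _ => MvPowerSeries.le_order_pow_of_constantCoeff_eq_zero _ (hh j)

theorem vecCoeff_subst_shift_eq_zero {u : XYExp n p} {F : XYMon n s p →₀ K} {c : MonIdx n s}
    (hc : c.1.degree < u.deg) : vecCoeff c (subst h (shift u F)) = 0 := by
  rw [subst_shift, vecCoeff, Pi.smul_apply, smul_eq_mul]
  refine MvPowerSeries.coeff_of_lt_order ?_
  refine lt_of_lt_of_le ?_ ((le_order_monomial hh u).trans
    (le_trans (le_add_right le_rfl) MvPowerSeries.le_order_mul))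
  exact_mod_cast hc

/-- Multiplying `x^α e_ℓ` by powers of the `h_j` produces multiples of it only, and `x^α e_ℓ` itself
does not occur once some `h_j` is a factor. -/
theorem vecCoeff_substMon (m : XYMon n s p) {c : MonIdx n s} (h0 : vecCoeff c (substMon h m) ≠ 0) :
    ∃ γ, shiftIdx γ m.1 = c ∧ (γ = 0 → m.2 = 0) := by
  classical
  by_cases hℓ : c.2 = m.1.2
  · rw [vecCoeff, substMon, hℓ, Pi.single_eq_same, MvPowerSeries.coeff_monomial_mul] at h0
    split_ifs at h0 with hle
    · rw [one_mul] at h0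
      refine ⟨c.1 - m.1.1, Prod.ext (tsub_add_cancel_of_le hle) hℓ.symm, fun hγ => ?_⟩
      rw [hγ] at h0
      by_contra hm
      refine h0 ?_
      rw [MvPowerSeries.coeff_zero_eq_constantCoeff_apply, map_prod]
      obtain ⟨j, hj⟩ := DFunLike.ne_iff.mp hm
      exact Finset.prod_eq_zero (Finset.mem_univ j) (by
        rw [map_pow, hh, zero_pow hj])
    · exact absurd rfl h0
  · rw [vecCoeff, substMon, Pi.single_eq_of_ne hℓ] at h0
    exact absurd (map_zero _) h0

/-- This is why the `x`-part is compared first. A term with larger `x`-part contributes only still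
larger monomial vectors, and a term with `x`-part `a` and a nontrivial power of `y` contributes
nothing at `a`. -/
theorem isInitial_subst (hlt : IsMonomialOrder lt) {a : MonIdx n s} {F : XYMon n s p →₀ K}
    (hF : IsMonic lt ((a, 0) : XYMon n s p) F) :
    vecCoeff a (subst h F) = 1 ∧ ∀ c, lt c a → vecCoeff c (subst h F) = 0 := by
  have hsum : ∀ c, vecCoeff c (subst h F) =
      ∑ m ∈ F.support, F m * vecCoeff c (substMon h m) := by
    intro c
    rw [subst, Finsupp.linearCombination_apply, Finsupp.sum, ← FormalDivision.coeffLin_apply,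
      map_sum]
    simp
  have hz : ∀ m, F m ≠ 0 → m ≠ ((a, 0) : XYMon n s p) → ∀ c, (lt c a ∨ c = a) →
      vecCoeff c (substMon h m) = 0 := by
    intro m hm hne c hc
    by_contra h0
    obtain ⟨γ, hγ, hγ0⟩ := vecCoeff_substMon hh m h0
    have h1 : ¬ lt c m.1 := by
      intro hcm
      rcases eq_or_ne γ 0 with rfl | hγn
      · rw [shiftIdx, zero_add] at hγ
        exact hlt.irrefl c (by rw [← hγ] at hcm; exact hγ ▸ hcm)
      · have := hlt.add 0 γ m.1.1 m.1.2 m.1.2 (hlt.zero_lt γ hγn m.1.2)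
        rw [zero_add] at this
        exact hlt.asymm hcm (hγ ▸ this)
    rcases (hF.2 m hm).resolve_left hne with h2 | ⟨h2, h3⟩
    · rcases hc with hc | rfl
      · exact h1 (hlt.trans _ _ _ hc h2)
      · exact h1 h2
    · have h2' : a = m.1 := h2
      rcases hc with hc | rfl
      · exact h1 (h2' ▸ hc)
      · have : γ = 0 := by
          rw [← h2'] at hγ
          exact shiftIdx_injective_left (hγ.trans (by simp [shiftIdx] : c = shiftIdx 0 c))
        exact hne (Prod.ext h2'.symm (hγ0 this))
  refine ⟨?_, fun c hc => ?_⟩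
  · rw [hsum, Finset.sum_eq_single ((a, 0) : XYMon n s p), hF.1, vecCoeff_substMon_self, one_mul]
    · intro m hm hne
      rw [hz m (Finsupp.mem_support_iff.mp hm) hne a (Or.inr rfl), mul_zero]
    · intro h; rw [Finsupp.notMem_support_iff.mp h, zero_mul]
  · rw [hsum]
    refine Finset.sum_eq_zero fun m hm => ?_
    by_cases hne : m = ((a, 0) : XYMon n s p)
    · have : vecCoeff c (substMon h m) = 0 := by
        by_contra h0
        obtain ⟨γ, hγ, -⟩ := vecCoeff_substMon hh m h0
        rw [hne] at hγ
        rcases eq_or_ne γ 0 with rfl | hγn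
        · rw [shiftIdx, zero_add] at hγ
          exact hlt.irrefl a (by rw [← hγ] at hc; exact hc)
        · have := hlt.add 0 γ a.1 a.2 a.2 (hlt.zero_lt γ hγn a.2)
          rw [zero_add] at this
          exact hlt.asymm hc (hγ ▸ this)
      rw [this, mul_zero]
    · rw [hz m (Finsupp.mem_support_iff.mp hm) hne c (Or.inl hc), mul_zero]

end XYVec

namespace XYVec

variable {K : Type u} [Field K] {n s p : ℕ} {lt : MonIdx n s → MonIdx n s → Prop}

/-! #### The filtration of the polynomial submodule generated by a set -/

/-- The combinations of elements of `P` with polynomial coefficients of degree at most `j`. -/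
noncomputable def filt (P : Set (XYMon n s p →₀ K)) (j : ℕ) : Submodule K (XYMon n s p →₀ K) :=
  Submodule.span K {f | ∃ F ∈ P, ∃ u : XYExp n p, u.deg ≤ j ∧ f = shift u F}

variable {P : Set (XYMon n s p →₀ K)}

theorem filt_mono {i j : ℕ} (h : i ≤ j) : filt P i ≤ filt P j := by
  refine Submodule.span_mono ?_
  rintro f ⟨F, hF, u, hu, rfl⟩
  exact ⟨F, hF, u, hu.trans h, rfl⟩

theorem shift_mem_filt {j : ℕ} {f : XYMon n s p →₀ K} (hf : f ∈ filt P j) (u : XYExp n p) :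
    shift u f ∈ filt P (j + u.deg) := by
  induction hf using Submodule.span_induction with
  | mem f h =>
    obtain ⟨F, hF, v, hv, rfl⟩ := h
    refine Submodule.subset_span ⟨F, hF, u + v, ?_, shift_shift _ _ _⟩
    rw [XYExp.deg_add]; omega
  | zero => rw [map_zero]; exact Submodule.zero_mem _
  | add f g _ _ hf hg => rw [map_add]; exact Submodule.add_mem _ hf hg
  | smul c f _ hf => rw [map_smul]; exact Submodule.smul_mem _ _ hf

theorem _root_.XYExp.exists_unit_add {u : XYExp n p} (hu : u ≠ 0) :
    ∃ z v : XYExp n p, z.deg = 1 ∧ u = z + v := by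
  obtain ⟨α, β⟩ := u
  by_cases hα : α = 0
  · have hβ : β ≠ 0 := fun h => hu (by rw [hα, h]; rfl)
    obtain ⟨i, γ, rfl⟩ := exists_single_add hβ
    exact ⟨(0, Finsupp.single i 1), (α, γ), by simp [XYExp.deg], by simp⟩
  · obtain ⟨i, γ, rfl⟩ := exists_single_add hα
    exact ⟨(Finsupp.single i 1, 0), (γ, β), by simp [XYExp.deg], by simp⟩

/-- A monomial of degree at most `j + 1` is `1` or a variable times one of degree at most `j`. Hence
multiplying the current basis by single variables reaches the next layer. -/
theorem filt_succ_le {j : ℕ} {W : Submodule K (XYMon n s p →₀ K)} (h : filt P j ≤ W)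
    (h' : ∀ z : XYExp n p, z.deg = 1 → ∀ f ∈ filt P j, shift z f ∈ W) : filt P (j + 1) ≤ W := by
  refine Submodule.span_le.mpr ?_
  rintro f ⟨F, hF, u, hu, rfl⟩
  by_cases h0 : u = 0
  · exact h (Submodule.subset_span ⟨F, hF, u, by simp [h0, XYExp.deg], rfl⟩)
  · obtain ⟨z, v, hz, rfl⟩ := XYExp.exists_unit_add h0
    rw [← shift_shift]
    refine h' z hz _ (Submodule.subset_span ⟨F, hF, v, ?_, rfl⟩)
    rw [XYExp.deg_add] at hu
    omega

/-! #### Echelon bases -/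

/-- `E` consists of elements of a basis of `W` with different initial monomial vectors. -/
structure IsEchelon (lt : MonIdx n s → MonIdx n s → Prop)
    (E : List (XYMon n s p × (XYMon n s p →₀ K))) (W : Submodule K (XYMon n s p →₀ K)) : Prop where
  monic : ∀ e ∈ E, IsMonic lt e.1 e.2
  nodup : (E.map Prod.fst).Nodup
  span_eq : Submodule.span K {f | ∃ e ∈ E, f = e.2} = W

/-- Different initial terms cannot cancel: in `c • e.2 + g` with both parts nonzero, the smaller of
the two initial monomial vectors survives. -/
theorem initial_mem_of_mem_span (hlt : IsMonomialOrder lt)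
    {E : List (XYMon n s p × (XYMon n s p →₀ K))} (hE : ∀ e ∈ E, IsMonic lt e.1 e.2)
    (hE' : (E.map Prod.fst).Nodup) {f : XYMon n s p →₀ K}
    (hf : f ∈ Submodule.span K {f | ∃ e ∈ E, f = e.2}) {a : XYMon n s p} (ha : f a ≠ 0)
    (hmin : ∀ c, f c ≠ 0 → c = a ∨ XYMon.Lt lt a c) : a ∈ E.map Prod.fst := by
  induction E generalizing f a with
  | nil =>
    simp only [List.not_mem_nil, false_and, exists_false, Set.ofPred_false, Submodule.span_empty,
      Submodule.mem_bot] at hf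
    exact absurd (by rw [hf]; rfl) ha
  | cons e E ih =>
    have hset : {f | ∃ e' ∈ e :: E, f = e'.2} = insert e.2 {f | ∃ e' ∈ E, f = e'.2} := by
      ext f; simp
    rw [hset, Submodule.mem_span_insert] at hf
    obtain ⟨c, g, hg, rfl⟩ := hf
    rw [List.map_cons, List.nodup_cons] at hE'
    have he := hE e (List.mem_cons_self ..)
    have ih' := fun {a} => ih (fun e' h => hE e' (List.mem_cons_of_mem _ h)) hE'.2 hg (a := a)
    rw [List.map_cons, List.mem_cons]
    by_cases hc : c = 0
    · subst hc
      simp only [zero_smul, zero_add] at ha hmin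
      exact Or.inr (ih' ha hmin)
    have cmp : ∀ x, (c • e.2 + g) x = c * e.2 x + g x := fun x => by simp
    rw [cmp] at ha
    by_cases hg0 : g = 0
    · subst hg0
      have h1 := hmin e.1 (by rw [cmp, he.1]; simpa using hc)
      have h2 := he.2 a (fun h => ha (by simp [h]))
      rcases h1 with h1 | h1
      · exact Or.inl h1.symm
      · exact Or.inl (h2.resolve_right (XYMon.Lt.asymm hlt h1))
    obtain ⟨b, hb, hbmin⟩ := exists_min hlt hg0
    have hbE := ih' hb hbmin
    have hne : e.1 ≠ b := fun h => hE'.1 (h ▸ hbE)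
    have hsupp : ∀ x, (c • e.2 + g) x ≠ 0 → e.2 x ≠ 0 ∨ g x ≠ 0 := by
      intro x hx
      by_contra hcon
      push Not at hcon
      exact hx (by rw [cmp, hcon.1, hcon.2]; simp)
    rw [← cmp] at ha
    rcases XYMon.Lt.total hlt e.1 b with h1 | h1 | h1
    · left
      have h2 : g e.1 = 0 := by
        by_contra h
        rcases hbmin _ h with h | h
        · exact hne h
        · exact XYMon.Lt.asymm hlt h1 h
      have h3 := hmin e.1 (by rw [cmp, he.1, h2]; simpa using hc)
      have h4 : a = e.1 ∨ XYMon.Lt lt e.1 a := by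
        rcases hsupp a ha with h | h
        · exact he.2 a h
        · rcases hbmin a h with rfl | h
          · exact Or.inr h1
          · exact Or.inr (h1.trans hlt h)
      rcases h3 with h3 | h3
      · exact h3.symm
      · exact h4.resolve_right (XYMon.Lt.asymm hlt h3)
    · exact absurd h1 hne
    · right
      have h2 : e.2 b = 0 := by
        by_contra h
        rcases he.2 _ h with h | h
        · exact hne h.symm
        · exact XYMon.Lt.asymm hlt h1 h
      have h3 := hmin b (by rw [cmp, h2]; simpa using hb)
      have h4 : a = b ∨ XYMon.Lt lt b a := by
        rcases hsupp a ha with h | h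
        · rcases he.2 a h with rfl | h
          · exact Or.inr h1
          · exact Or.inr (h1.trans hlt h)
        · exact hbmin a h
      rcases h3 with h3 | h3
      · rwa [← h3]
      · rwa [h4.resolve_right (XYMon.Lt.asymm hlt h3)]

/-- Each element of `M'` lies in `M` or is the product of a variable and an element of `M`. -/
def IsStep (M M' : List (XYMon n s p)) : Prop :=
  ∀ a ∈ M', a ∈ M ∨ ∃ a' ∈ M, ∃ z : XYExp n p, z.deg = 1 ∧ a = XYMon.act z a'

/-- Tracing the steps back to level `i` collects at most one variable per level. -/
theorem exists_act_of_isStep {M : ℕ → List (XYMon n s p)} {i k : ℕ}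
    (h : ∀ j < k, IsStep (M (i + j)) (M (i + j + 1))) {a : XYMon n s p} (ha : a ∈ M (i + k)) :
    ∃ a' ∈ M i, ∃ m : XYExp n p, m.deg ≤ k ∧ XYMon.act m a' = a := by
  induction k generalizing a with
  | zero => exact ⟨a, ha, 0, by simp [XYExp.deg], by simp⟩
  | succ k ih =>
    rcases h k (Nat.lt_succ_self k) a ha with h1 | ⟨a', h1, z, hz, rfl⟩
    · obtain ⟨b, hb, m, hm, hm'⟩ := ih (fun j hj => h j (by omega)) h1
      exact ⟨b, hb, m, by omega, hm'⟩
    · obtain ⟨b, hb, m, hm, rfl⟩ := ih (fun j hj => h j (by omega)) h1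
      exact ⟨b, hb, z + m, by rw [XYExp.deg_add]; omega, (XYMon.act_act ..).symm⟩

/-- The degree bound on the cofactors is what matters: a cofactor of degree at most `k` keeps the
multiples of `E i` inside the layer `i + k`. -/
theorem isReducing_of_isStep (hlt : IsMonomialOrder lt)
    {E : ℕ → List (XYMon n s p × (XYMon n s p →₀ K))} (hE : ∀ j, IsEchelon lt (E j) (filt P j))
    {i k : ℕ} (h : ∀ j < k, IsStep ((E (i + j)).map Prod.fst) ((E (i + j + 1)).map Prod.fst)) :
    IsReducing lt {e | e ∈ E i} (filt P (i + k)) ((E (i + k)).map Prod.fst).toFinset where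
  monic := (hE i).monic
  initial f hf a ha hmin := by
    rw [List.mem_toFinset]
    rw [← (hE (i + k)).span_eq] at hf
    exact initial_mem_of_mem_span hlt (hE _).monic (hE _).nodup hf ha hmin
  multiple a ha := by
    rw [List.mem_toFinset] at ha
    obtain ⟨a', ha', m, hm, hma⟩ := exists_act_of_isStep (M := fun j => (E j).map Prod.fst) h ha
    obtain ⟨e, he, rfl⟩ := List.mem_map.mp ha'
    refine ⟨e, he, m, hma, filt_mono (Nat.add_le_add_left hm i) (shift_mem_filt ?_ m)⟩
    rw [← (hE i).span_eq]
    exact Submodule.subset_span ⟨e, he, rfl⟩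

/-! #### Termination -/

/-- The index of a layer bounds the degrees of the coefficients; the largest degree occurring in `P`
serves as the excess `δ`. -/
theorem exists_degree_bound_filt (hP : P.Finite) :
    ∃ δ : ℕ, ∀ j, ∀ f ∈ filt P j, ∀ c : XYMon n s p, f c ≠ 0 → c.exp.deg ≤ j + δ := by
  classical
  refine ⟨hP.toFinset.sup fun F => F.support.sup fun c => c.exp.deg, fun j f hf => ?_⟩
  induction hf using Submodule.span_induction with
  | mem f h =>
    obtain ⟨F, hF, u, hu, rfl⟩ := h
    intro c hc
    obtain ⟨m, rfl, hm⟩ := exists_of_shift_ne_zero hc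
    rw [XYMon.exp_act, XYExp.deg_add]
    refine Nat.add_le_add hu ?_
    refine le_trans ?_ (Finset.le_sup (f := fun F : XYMon n s p →₀ K =>
      F.support.sup fun c => c.exp.deg) (hP.mem_toFinset.mpr hF))
    exact Finset.le_sup (f := fun c : XYMon n s p => c.exp.deg) (Finsupp.mem_support_iff.mpr hm)
  | zero => intro c hc; simp at hc
  | add f g _ _ hf hg =>
    intro c hc
    by_cases h : f c = 0
    · exact hg c fun h' => hc (by simp [h, h'])
    · exact hf c h
  | smul k f _ hf => exact fun c hc => hf c fun h => hc (by simp [h])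

/-- Divisibility among the new initial monomial vectors is not enough, since the cofactor must also
fit into the number of levels passed. Dickson's lemma is therefore applied with one further
exponent, as in a homogenization. -/
theorem exists_forall_isStep (hlt : IsMonomialOrder lt) (hP : P.Finite)
    {E : ℕ → List (XYMon n s p × (XYMon n s p →₀ K))} (hE : ∀ j, IsEchelon lt (E j) (filt P j)) :
    ∃ i, ∀ j ≥ i, IsStep ((E j).map Prod.fst) ((E (j + 1)).map Prod.fst) := by
  classical
  obtain ⟨δ, hδ⟩ := exists_degree_bound_filt hP
  have hmem : ∀ {j a}, a ∈ (E j).map Prod.fst → ∃ f ∈ filt P j, IsMonic lt a f := by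
    intro j a ha
    obtain ⟨e, he, rfl⟩ := List.mem_map.mp ha
    refine ⟨e.2, ?_, (hE j).monic e he⟩
    rw [← (hE j).span_eq]
    exact Submodule.subset_span ⟨e, he, rfl⟩
  have hmem' : ∀ {j a f}, f ∈ filt P j → IsMonic lt a f → a ∈ (E j).map Prod.fst := by
    intro j a f hf ha
    rw [← (hE j).span_eq] at hf
    exact initial_mem_of_mem_span hlt (hE j).monic (hE j).nodup hf
      (by rw [ha.1]; exact one_ne_zero) ha.2
  have hact : ∀ {j a} (u : XYExp n p) {k}, a ∈ (E j).map Prod.fst → j + u.deg ≤ k →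
      XYMon.act u a ∈ (E k).map Prod.fst := by
    intro j a u k ha hk
    obtain ⟨f, hf, hm⟩ := hmem ha
    exact hmem' (filt_mono hk (shift_mem_filt hf u)) (hm.shift hlt u)
  by_contra! hcon
  have hinf : {j | ¬ IsStep ((E j).map Prod.fst) ((E (j + 1)).map Prod.fst)}.Infinite := by
    rw [Set.infinite_iff_exists_gt]
    intro i
    obtain ⟨j, hj, h⟩ := hcon (i + 1)
    exact ⟨j, h, hj⟩
  -- The sequence `d` enumerates the levels at which the step property fails; each failure provides
  -- a monomial vector `a i` that is new and not a variable times an old one.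
  let d : ℕ → ℕ := Nat.nth fun j => ¬ IsStep ((E j).map Prod.fst) ((E (j + 1)).map Prod.fst)
  have hd : StrictMono d := Nat.nth_strictMono hinf
  have hd' : ∀ i, ¬ IsStep ((E (d i)).map Prod.fst) ((E (d i + 1)).map Prod.fst) :=
    fun i => Nat.nth_mem_of_infinite hinf i
  have hfresh : ∀ i, ∃ a ∈ (E (d i + 1)).map Prod.fst, a ∉ (E (d i)).map Prod.fst ∧
      ∀ a' ∈ (E (d i)).map Prod.fst, ∀ z : XYExp n p, z.deg = 1 → a ≠ XYMon.act z a' := by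
    intro i
    have := hd' i
    rw [IsStep] at this
    push Not at this
    exact this
  choose a ha ha1 ha2 using hfresh
  have hbound : ∀ i, (a i).exp.deg ≤ d i + 1 + δ := by
    intro i
    obtain ⟨f, hf, hm⟩ := hmem (ha i)
    exact hδ _ f hf _ (by rw [hm.1]; exact one_ne_zero)
  -- The third entry is the exponent of the homogenizing variable. Its growth from `i` to `j` says
  -- that the degree of `a` grows by at most `d j - d i`; `hbound` makes the subtraction harmless.
  let w : ℕ → (Fin n → ℕ) × (Fin p → ℕ) × ℕ × Fin s := fun i =>
    (⇑(a i).1.1, ⇑(a i).2, d i + 1 + δ - (a i).exp.deg, (a i).1.2)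
  have hwqo : ∃ i j, i < j ∧ (w i).1 ≤ (w j).1 ∧ (w i).2.1 ≤ (w j).2.1 ∧
      (w i).2.2.1 ≤ (w j).2.2.1 ∧ (w i).2.2.2 = (w j).2.2.2 := by
    -- Components are compared by equality, so one first passes to infinitely many indices with the
    -- same component.
    obtain ⟨ℓ, hℓ⟩ := Finite.exists_infinite_fiber (fun i => (w i).2.2.2)
    rw [Set.infinite_coe_iff] at hℓ
    let e : ℕ → ℕ := Nat.nth fun i => (w i).2.2.2 = ℓ
    have he : StrictMono e := Nat.nth_strictMono hℓ
    have he' : ∀ i, (w (e i)).2.2.2 = ℓ := fun i => Nat.nth_mem_of_infinite hℓ i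
    obtain ⟨i, j, hij, hle⟩ := (wellQuasiOrdered_le (α := (Fin n → ℕ) × (Fin p → ℕ) × ℕ))
      fun i => ((w (e i)).1, (w (e i)).2.1, (w (e i)).2.2.1)
    exact ⟨e i, e j, he hij, hle.1, hle.2.1, hle.2.2, (he' i).trans (he' j).symm⟩
  obtain ⟨i, j, hij, h1, h2, h3, h4⟩ := hwqo
  have hdij : d i + 1 ≤ d j := hd hij
  let m : XYExp n p := ((a j).1.1 - (a i).1.1, (a j).2 - (a i).2)
  have hm : XYMon.act m (a i) = a j := by
    refine XYMon.ext_exp ?_ h4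
    exact Prod.ext (tsub_add_cancel_of_le h1) (tsub_add_cancel_of_le h2)
  have hmdeg : m.deg + (a i).exp.deg = (a j).exp.deg := by
    rw [← hm, XYMon.exp_act, XYExp.deg_add]
  have hb1 := hbound i
  have hb2 := hbound j
  change d i + 1 + δ - (a i).exp.deg ≤ d j + 1 + δ - (a j).exp.deg at h3
  -- If `m = 0`, then `a j` occurred already at level `d i + 1 ≤ d j`. Otherwise split off a
  -- variable `z` from `m`: the rest of the cofactor has small enough degree for its product with `a
  -- i` to occur at level `d j`, so `a j` is a variable times an old one.
  by_cases h0 : m = 0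
  · rw [h0, XYMon.act_zero] at hm
    refine ha1 j ?_
    rw [← hm, ← XYMon.act_zero (a i)]
    exact hact 0 (ha i) (by simpa [XYExp.deg] using hdij)
  · obtain ⟨z, v, hz, hzv⟩ := XYExp.exists_unit_add h0
    refine ha2 j (XYMon.act v (a i)) (hact v (ha i) ?_) z hz ?_
    · rw [hzv, XYExp.deg_add] at hmdeg
      omega
    · rw [XYMon.act_act, ← hzv, hm]

end XYVec

/-! ### S-vectors and their standard representations -/

namespace XYVec

variable {K : Type u} [Field K] {n s p : ℕ} {lt : MonIdx n s → MonIdx n s → Prop}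

/-- Removing the common factor `u ⊓ u'` leaves the cofactors of the least common multiple; each
divides the other monomial, which bounds its degree. -/
theorem exists_lcm_factor {σ : Type*} {u u' a a' : σ →₀ ℕ} (h : u + a = u' + a') :
    ∃ w v v', u = w + v ∧ u' = w + v' ∧ v + a = v' + a' ∧ v ≤ a' ∧ v' ≤ a := by
  have h' : ∀ i, u i + a i = u' i + a' i := fun i => DFunLike.congr_fun h i
  refine ⟨u ⊓ u', u - u ⊓ u', u' - u ⊓ u', ?_, ?_, ?_, ?_, ?_⟩
  · ext i; simp only [Finsupp.add_apply, Finsupp.tsub_apply, Finsupp.inf_apply]; omega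
  · ext i; simp only [Finsupp.add_apply, Finsupp.tsub_apply, Finsupp.inf_apply]; omega
  · ext i
    have := h' i
    simp only [Finsupp.add_apply, Finsupp.tsub_apply, Finsupp.inf_apply]
    omega
  · intro i
    have := h' i
    simp only [Finsupp.tsub_apply, Finsupp.inf_apply]
    omega
  · intro i
    have := h' i
    simp only [Finsupp.tsub_apply, Finsupp.inf_apply]
    omega

/-- For the minimal cofactors, of degree at most `k`, the S-vector lies in the layer `d + k`, where
reduction is possible. The general case is a multiple of this one by the common factor. -/
theorem sub_shift_mem_stdSpan (hlt : IsMonomialOrder lt) {P : Set (XYMon n s p →₀ K)}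
    {E : Set (XYMon n s p × (XYMon n s p →₀ K))} {S : Finset (XYMon n s p)} {d k : ℕ}
    (hE : IsReducing lt E (filt P (d + k)) S) {a a' : XYMon n s p} {F F' : XYMon n s p →₀ K}
    (ha : IsMonic lt a F) (ha' : IsMonic lt a' F') (hF : F ∈ filt P d) (hF' : F' ∈ filt P d)
    (hk : a.exp.deg ≤ k) (hk' : a'.exp.deg ≤ k) {u u' : XYExp n p}
    (h : XYMon.act u a = XYMon.act u' a') :
    shift u F - shift u' F' ∈ stdSpan lt E (XYMon.act u a) := by
  have hexp : u + a.exp = u' + a'.exp := congrArg XYMon.exp h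
  have hcomp : a.1.2 = a'.1.2 := by simpa using congrArg (fun m : XYMon n s p => m.1.2) h
  obtain ⟨w₁, v₁, v₁', hu₁, hu₁', hv₁, hle₁, hle₁'⟩ := exists_lcm_factor (congrArg Prod.fst hexp)
  obtain ⟨w₂, v₂, v₂', hu₂, hu₂', hv₂, hle₂, hle₂'⟩ := exists_lcm_factor (congrArg Prod.snd hexp)
  obtain rfl : u = (w₁, w₂) + (v₁, v₂) := Prod.ext hu₁ hu₂
  obtain rfl : u' = (w₁, w₂) + (v₁', v₂') := Prod.ext hu₁' hu₂'
  have hv : XYMon.act (v₁, v₂) a = XYMon.act (v₁', v₂') a' :=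
    XYMon.ext_exp (Prod.ext hv₁ hv₂) hcomp
  rw [← shift_shift, ← shift_shift, ← map_sub, ← XYMon.act_act]
  refine shift_mem_stdSpan hlt (hE.mem_stdSpan hlt ⟨Submodule.sub_mem _ ?_ ?_, ?_⟩) _
  · refine filt_mono (Nat.add_le_add_left (le_trans ?_ hk') d) (shift_mem_filt hF _)
    exact Nat.add_le_add (Finsupp.degree_mono hle₁) (Finsupp.degree_mono hle₂)
  · refine filt_mono (Nat.add_le_add_left (le_trans ?_ hk) d) (shift_mem_filt hF' _)
    exact Nat.add_le_add (Finsupp.degree_mono hle₁') (Finsupp.degree_mono hle₂')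
  · have h1 := ha.shift hlt (v₁, v₂)
    have h2 := ha'.shift hlt (v₁', v₂')
    rw [← hv] at h2
    have h3 := sub_mem_above h1.2 h2
    rwa [h1.1, one_smul] at h3

/-! #### The standard basis property -/

open FormalDivision

/-- The data from which a standard basis is read off: a finite set `E` of polynomial vectors,
closed under formation of S-vectors, together with vectors which represent the variables `y_j` and
vanish upon substitution of the series `h`. -/
structure IsComplete (lt : MonIdx n s → MonIdx n s → Prop) (h : Fin p → MvPowerSeries (Fin n) K)
    (P : Set (XYMon n s p →₀ K)) (E : Set (XYMon n s p × (XYMon n s p →₀ K)))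
    (L : Fin s → Fin p → (XYMon n s p →₀ K)) : Prop where
  zero : ∀ j, MvPowerSeries.constantCoeff (h j) = 0
  finite : E.Finite
  monic : ∀ e ∈ E, IsMonic lt e.1 e.2
  mem : ∀ F ∈ P, F ∈ Submodule.span K {f | ∃ e ∈ E, ∃ m, f = shift m e.2}
  subst_mem : ∀ e ∈ E, subst h e.2 ∈ Submodule.span (MvPowerSeries (Fin n) K) (subst h '' P)
  pair : ∀ e ∈ E, ∀ e' ∈ E, ∀ u u', XYMon.act u e.1 = XYMon.act u' e'.1 →
    shift u e.2 - shift u' e'.2 ∈ stdSpan lt E (XYMon.act u e.1)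
  subst_eq_zero : ∀ ℓ j, subst h (L ℓ j) = 0
  pair_var : ∀ e ∈ E, ∀ ℓ j, ∀ u u', XYMon.act u e.1 = XYMon.act u' ((0, ℓ), Finsupp.single j 1) →
    shift u e.2 - shift u' (L ℓ j) ∈ stdSpan lt E (XYMon.act u e.1)

namespace IsComplete

variable {h : Fin p → MvPowerSeries (Fin n) K} {P : Set (XYMon n s p →₀ K)}
  {E : Set (XYMon n s p × (XYMon n s p →₀ K))} {L : Fin s → Fin p → (XYMon n s p →₀ K)}
  {ι : Type*} [Fintype ι] {a : ι → MonIdx n s} {F : ι → (XYMon n s p →₀ K)}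
  {κ : MonIdx n s → Option ι}

/-- Buchberger's argument from above instead of below: a multiple of largest initial monomial vector
on which the remainder functional does not vanish is exchanged, modulo larger ones, for a vector on
which it does. -/
theorem divCoeff_subst_shift (hlt : IsMonomialOrder lt) (hE : IsComplete lt h P E L)
    (haE : ∀ k, (((a k, 0), F k) : XYMon n s p × (XYMon n s p →₀ K)) ∈ E)
    (hEa : ∀ e ∈ E, e.1.2 = 0 → ∃ k, a k = e.1.1)
    (hκ : ∀ c k, κ c = some k → ∃ γ, shiftIdx γ (a k) = c)
    (hκ' : ∀ c, κ c = none → ∀ k γ, shiftIdx γ (a k) ≠ c)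
    {c : MonIdx n s} (hc : κ c = none)
    {e : XYMon n s p × (XYMon n s p →₀ K)} (he : e ∈ E) (u : XYExp n p) :
    divCoeff hlt (fun k => subst h (F k)) a κ c (subst h (shift u e.2)) = 0 := by
  classical
  set T := divCoeff hlt (fun k => subst h (F k)) a κ c with hT
  obtain ⟨N, hN⟩ := exists_degree_bound hlt (fun k => subst h (F k)) a κ c
  have hsmall : ∀ e u, T (subst h (shift u e)) ≠ 0 → XYExp.deg u < N := by
    intro e u hne
    by_contra hle
    exact hne (hN _ fun c' hc' => vecCoeff_subst_shift_eq_zero hE.zero (by omega))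
  let X : Set (XYExp n p × (XYMon n s p × (XYMon n s p →₀ K))) :=
    {x | x.2 ∈ E ∧ T (subst h (shift x.1 x.2.2)) ≠ 0}
  -- Large cofactors give values of large order, which `T` does not see, and `E` is finite.
  have hX : X.Finite := by
    refine Set.Finite.subset ((((Finsupp.finite_of_degree_lt (σ := Fin n) N).prod
      (Finsupp.finite_of_degree_lt (σ := Fin p) N))).prod hE.finite) ?_
    rintro ⟨⟨u₁, u₂⟩, e⟩ ⟨he, hne⟩
    have := hsmall _ _ hne
    rw [XYExp.deg] at this
    have h1 : u₁.degree < N := by dsimp only at this; omega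
    have h2 : u₂.degree < N := by dsimp only at this; omega
    exact ⟨⟨h1, h2⟩, he⟩
  -- The order is reversed, so that an `r`-minimal element has the largest initial monomial vector.
  let r : XYExp n p × (XYMon n s p × (XYMon n s p →₀ K)) →
      XYExp n p × (XYMon n s p × (XYMon n s p →₀ K)) → Prop :=
    fun x y => XYMon.Lt lt (XYMon.act y.1 y.2.1) (XYMon.act x.1 x.2.1)
  have : IsStrictOrder _ r :=
    { irrefl := fun x => XYMon.Lt.irrefl hlt _
      trans := fun x y z h1 h2 => XYMon.Lt.trans hlt h2 h1 }
  have hwf : X.WellFoundedOn r := hX.wellFoundedOn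
  suffices hemp : X = ∅ by
    by_contra hne
    have hx : (u, e) ∈ X := ⟨he, hne⟩
    rw [hemp] at hx
    exact hx
  by_contra hne
  rw [← ne_eq, ← Set.nonempty_iff_ne_empty] at hne
  obtain ⟨x, -, hmax⟩ := WellFounded.has_min hwf Set.univ (by
    obtain ⟨x, hx⟩ := hne; exact ⟨⟨x, hx⟩, trivial⟩)
  obtain ⟨⟨u, e⟩, he, hxe⟩ := x
  have hstd : ∀ f ∈ stdSpan lt E (XYMon.act u e.1), T (subst h f) = 0 := by
    intro f hf
    induction hf using Submodule.span_induction with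
    | mem f hf =>
      obtain ⟨e', he', m, hm, rfl⟩ := hf
      by_contra hne'
      exact hmax ⟨(m, e'), he', hne'⟩ trivial hm
    | zero => simp
    | add f g _ _ hf hg => rw [map_add, map_add, hf, hg, add_zero]
    | smul c f _ hf => rw [map_smul, map_smul, hf, smul_zero]
  have hred : ∀ G, shift u e.2 - G ∈ stdSpan lt E (XYMon.act u e.1) →
      T (subst h (shift u e.2)) = T (subst h G) := by
    intro G hG
    rw [← sub_eq_zero, ← map_sub, ← map_sub]
    exact hstd _ hG
  obtain ⟨⟨⟨α, ℓ⟩, β⟩, G⟩ := e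
  -- Without `y`, the multiple is compared with a multiple of the divisor chosen by `κ`, which need
  -- not be `e` itself. With some `y_j`, it is compared with a multiple of `L ℓ j`, whose value is
  -- zero.
  by_cases hy : u.2 + β = 0
  · rw [add_eq_zero] at hy
    obtain ⟨hu2, rfl⟩ := hy
    obtain ⟨k₀, hk₀⟩ := hEa _ he rfl
    rcases hk : κ (shiftIdx u.1 (α, ℓ)) with _ | k
    · exact hκ' _ hk k₀ u.1 (by rw [hk₀])
    · obtain ⟨γ, hγ⟩ := hκ _ _ hk
      refine hxe ((hred (shift (γ, 0) (F k)) (hE.pair _ he _ (haE k) _ _ ?_)).trans ?_)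
      · refine Prod.ext hγ.symm ?_
        simp [XYMon.act, hu2]
      · rw [subst_shift]
        simp only [Finsupp.coe_zero, Pi.zero_apply, pow_zero, Finset.prod_const_one, mul_one]
        rw [hT, divCoeff_monomial_smul hlt (b := fun k => subst h (F k))
          (fun k => (isInitial_subst hE.zero hlt (hE.monic _ (haE k))).1)
          (fun k => (isInitial_subst hE.zero hlt (hE.monic _ (haE k))).2) (hγ.symm ▸ hk), if_neg]
        rintro rfl
        rw [← hγ] at hk
        rw [hk] at hc
        exact Option.some_ne_none _ hc
  · obtain ⟨j, γ, hγ⟩ := exists_single_add hy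
    refine hxe ((hred (shift (u.1 + α, γ) (L ℓ j)) (hE.pair_var _ he _ _ _ _ ?_)).trans ?_)
    · refine XYMon.ext_exp (Prod.ext ?_ ?_) rfl
      · simp [XYMon.act, XYMon.exp, shiftIdx]
      · simpa [XYMon.act, XYMon.exp, add_comm] using hγ
    · rw [subst_shift, hE.subst_eq_zero, smul_zero, map_zero]

/-- Vanishing on polynomial multiples of the generators passes to power series multiples by
continuity of the functional. The statement is proved for all `q • f`, so that the induction over
the span goes through scalars. -/
theorem divCoeff_eq_zero (hlt : IsMonomialOrder lt) (hE : IsComplete lt h P E L)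
    (haE : ∀ k, (((a k, 0), F k) : XYMon n s p × (XYMon n s p →₀ K)) ∈ E)
    (hEa : ∀ e ∈ E, e.1.2 = 0 → ∃ k, a k = e.1.1)
    (hκ : ∀ c k, κ c = some k → ∃ γ, shiftIdx γ (a k) = c)
    (hκ' : ∀ c, κ c = none → ∀ k γ, shiftIdx γ (a k) ≠ c)
    {c : MonIdx n s} (hc : κ c = none) {f : SeriesVec K n s}
    (hf : f ∈ Submodule.span (MvPowerSeries (Fin n) K) (subst h '' P)) :
    divCoeff hlt (fun k => subst h (F k)) a κ c f = 0 := by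
  classical
  set T := divCoeff hlt (fun k => subst h (F k)) a κ c with hT
  obtain ⟨N, hN⟩ := exists_degree_bound hlt (fun k => subst h (F k)) a κ c
  suffices hq : ∀ q : MvPowerSeries (Fin n) K, T (q • f) = 0 by simpa using hq 1
  induction hf using Submodule.span_induction with
  | mem f hf =>
    obtain ⟨G, hG, rfl⟩ := hf
    intro q
    have h0 : ∀ u : XYExp n p, T (subst h (shift u G)) = 0 := by
      intro u
      have hmem := hE.mem G hG
      clear hG
      induction hmem using Submodule.span_induction with
      | mem f hf =>
        obtain ⟨e, he, m, rfl⟩ := hf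
        rw [shift_shift]
        exact hE.divCoeff_subst_shift hlt haE hEa hκ hκ' hc he _
      | zero => simp
      | add f g _ _ hf hg => rw [map_add, map_add, map_add, hf, hg, add_zero]
      | smul c f _ hf => rw [map_smul, map_smul, map_smul, hf, smul_zero]
    have h1 : ∀ q : MvPolynomial (Fin n) K,
        T ((q : MvPowerSeries (Fin n) K) • subst h G) = 0 := by
      intro q
      induction q using MvPolynomial.induction_on' with
      | monomial u c =>
        have h2 : ((MvPolynomial.monomial u c : MvPolynomial (Fin n) K) :
            MvPowerSeries (Fin n) K) • subst h G = c • subst h (shift (u, 0) G) := by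
          rw [subst_shift, MvPolynomial.coe_monomial]
          simp only [Finsupp.coe_zero, Pi.zero_apply, pow_zero, Finset.prod_const_one, mul_one]
          rw [← smul_assoc]
          congr 1
          rw [← map_smul, smul_eq_mul, mul_one]
        rw [h2, map_smul, h0, smul_zero]
      | add p q hp hq => rw [MvPolynomial.coe_add, add_smul, map_add, hp, hq, add_zero]
    -- The tail of `q` has order at least `N` and is invisible to `T`.
    have h2 : q • subst h G = ((MvPowerSeries.truncTotal N q : MvPolynomial (Fin n) K) :
        MvPowerSeries (Fin n) K) • subst h G +
        (q - (MvPowerSeries.truncTotal N q : MvPolynomial (Fin n) K)) • subst h G := by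
      rw [← add_smul, add_sub_cancel]
    rw [h2, map_add, h1, zero_add]
    refine hN _ fun c' hc' => ?_
    rw [vecCoeff, Pi.smul_apply, smul_eq_mul]
    refine MvPowerSeries.coeff_of_lt_order (lt_of_lt_of_le (b := (N : ℕ∞)) (by exact_mod_cast hc')
      (le_trans (MvPowerSeries.nat_le_order fun d hd => ?_)
        (le_trans (le_add_right le_rfl) MvPowerSeries.le_order_mul)))
    rw [map_sub, MvPolynomial.coeff_coe, MvPowerSeries.coeff_truncTotal _ hd, sub_self]
  | zero => intro q; simp
  | add f g _ _ hf hg => intro q; rw [smul_add, map_add, hf, hg, add_zero]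
  | smul r f _ hf => intro q; rw [smul_smul]; exact hf _

/-- The vectors `F(x, h(x))`, `F` in `E` with initial monomial vector independent of `y`, form a
standard basis. -/
theorem isStandardBasis (hlt : IsMonomialOrder lt) (hE : IsComplete lt h P E L)
    {r : ℕ} {a : Fin r → MonIdx n s} {F : Fin r → (XYMon n s p →₀ K)}
    (haE : ∀ k, (((a k, 0), F k) : XYMon n s p × (XYMon n s p →₀ K)) ∈ E)
    (hEa : ∀ e ∈ E, e.1.2 = 0 → ∃ k, a k = e.1.1) :
    let I := Submodule.span (MvPowerSeries (Fin n) K) (subst h '' P)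
    IsStandardBasis lt I (fun k => subst h (F k)) ∧
    (∀ k, IsInitial lt (subst h (F k)) (a k) ∧ vecCoeff (a k) (subst h (F k)) = 1) ∧
    initialModule lt I =
      Submodule.span (MvPowerSeries (Fin n) K) (Set.range fun k => monVec K (a k)) := by
  classical
  intro I
  have hinit : ∀ k, IsInitial lt (subst h (F k)) (a k) ∧ vecCoeff (a k) (subst h (F k)) = 1 := by
    intro k
    have := isInitial_subst hE.zero hlt (hE.monic _ (haE k))
    exact ⟨⟨by rw [this.1]; exact one_ne_zero, this.2⟩, this.1⟩
  have huniq : ∀ f a a', IsInitial (K := K) lt f a → IsInitial lt f a' → a = a' := by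
    intro f a a' h1 h2
    rcases hlt.total a a' with h' | h' | h'
    · exact absurd (h2.2 a h') h1.1
    · exact h'
    · exact absurd (h1.2 a' h') h2.1
  -- Any assignment of a divisor to each multiple of some `a k` will do.
  let κ : MonIdx n s → Option (Fin r) := fun c =>
    if hc : ∃ k γ, shiftIdx γ (a k) = c then some hc.choose else none
  have hκ : ∀ c k, κ c = some k → ∃ γ, shiftIdx γ (a k) = c := by
    intro c k hk
    by_cases hc : ∃ k γ, shiftIdx γ (a k) = c
    · simp only [κ, dif_pos hc, Option.some.injEq] at hk
      exact hk ▸ hc.choose_spec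
    · simp [κ, dif_neg hc] at hk
  have hκ' : ∀ c, κ c = none → ∀ k γ, shiftIdx γ (a k) ≠ c := by
    intro c hk k γ hγ
    have hc : ∃ k γ, shiftIdx γ (a k) = c := ⟨k, γ, hγ⟩
    simp [κ, dif_pos hc] at hk
  have hspan : Submodule.span (MvPowerSeries (Fin n) K) (Set.range fun k => subst h (F k)) = I := by
    apply le_antisymm
    · rw [Submodule.span_le]
      rintro _ ⟨k, rfl⟩
      exact hE.subst_mem _ (haE k)
    · intro f hf
      exact mem_span_of_divCoeff_eq_zero hlt hκ (fun k => (hinit k).2) (fun k => (hinit k).1.2)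
        fun c hc => hE.divCoeff_eq_zero hlt haE hEa hκ hκ' hc hf
  have hin : initialModule lt I =
      Submodule.span (MvPowerSeries (Fin n) K) (Set.range fun k => monVec K (a k)) := by
    apply le_antisymm
    · refine Submodule.span_le.mpr ?_
      rintro _ ⟨f, hf, c, hc, rfl⟩
      -- The coefficient of the remainder at the initial monomial vector of `f` is the initial
      -- coefficient, so `c` cannot lie outside the multiples of the `a k`.
      have hdiv : κ c ≠ none := by
        intro h0
        have h1 := hE.divCoeff_eq_zero hlt haE hEa hκ hκ' h0 hf
        rw [divCoeff_eq_zero_of_forall_lt hlt _ _ _ hc.2] at h1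
        exact hc.1 h1
      obtain ⟨k, hk⟩ := Option.ne_none_iff_exists'.mp hdiv
      obtain ⟨γ, rfl⟩ := hκ _ _ hk
      have h2 : monVec K (shiftIdx γ (a k)) =
          (MvPowerSeries.monomial γ (1 : K)) • monVec K (a k) := by
        rw [monVec, monVec, ← Pi.single_smul, smul_eq_mul, MvPowerSeries.monomial_mul_monomial,
          one_mul]
        rfl
      rw [h2]
      exact Submodule.smul_mem _ _ (Submodule.subset_span ⟨k, rfl⟩)
    · rw [Submodule.span_le]
      rintro _ ⟨k, rfl⟩
      refine Submodule.subset_span ⟨subst h (F k), ?_, a k, (hinit k).1, rfl⟩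
      exact hE.subst_mem _ (haE k)
  refine ⟨⟨hspan, ?_⟩, hinit, hin⟩
  rw [hin]
  congr 1
  ext v
  constructor
  · rintro ⟨k, c, hc, rfl⟩
    exact ⟨k, by rw [huniq _ _ _ hc (hinit k).1]⟩
  · rintro ⟨k, rfl⟩
    exact ⟨k, a k, (hinit k).1, rfl⟩

end IsComplete

/-- The number `k` must bound the degrees of the initial monomial vectors in `E i` and also the
degree `1` of `y_j e_ℓ`, so that S-vectors with the `L ℓ j` are covered as well. -/
theorem isComplete_of_isStep (hlt : IsMonomialOrder lt) {h : Fin p → MvPowerSeries (Fin n) K}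
    (hh : ∀ j, MvPowerSeries.constantCoeff (h j) = 0) {P : Set (XYMon n s p →₀ K)}
    {E : ℕ → List (XYMon n s p × (XYMon n s p →₀ K))} (hE : ∀ j, IsEchelon lt (E j) (filt P j))
    {i k : ℕ} (hstep : ∀ j < k, IsStep ((E (i + j)).map Prod.fst) ((E (i + j + 1)).map Prod.fst))
    (hk : 1 ≤ k) (hdeg : ∀ e ∈ E i, e.1.exp.deg ≤ k) {L : Fin s → Fin p → (XYMon n s p →₀ K)}
    (hL : ∀ ℓ j, L ℓ j ∈ filt P 0) (hL' : ∀ ℓ j, IsMonic lt ((0, ℓ), Finsupp.single j 1) (L ℓ j))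
    (hL0 : ∀ ℓ j, subst h (L ℓ j) = 0) : IsComplete lt h P {e | e ∈ E i} L := by
  have hred := isReducing_of_isStep hlt hE hstep
  have hmem : ∀ e ∈ E i, e.2 ∈ filt P i := fun e he => by
    rw [← (hE i).span_eq]; exact Submodule.subset_span ⟨e, he, rfl⟩
  refine ⟨hh, List.finite_toSet _, (hE i).monic, fun F hF => ?_, fun e he => ?_,
    fun e he e' he' u u' huu => ?_, hL0, fun e he ℓ j u u' huu => ?_⟩
  · exact hred.mem_span hlt (Submodule.subset_span ⟨F, hF, 0, by simp [XYExp.deg], by simp⟩)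
  · have hf := hmem e he
    generalize e.2 = f at hf
    induction hf using Submodule.span_induction with
    | mem f hf =>
      obtain ⟨F, hF, u, -, rfl⟩ := hf
      rw [subst_shift]
      exact Submodule.smul_mem _ _ (Submodule.subset_span ⟨F, hF, rfl⟩)
    | zero => rw [map_zero]; exact Submodule.zero_mem _
    | add f g _ _ hf hg => rw [map_add]; exact Submodule.add_mem _ hf hg
    | smul c f _ hf =>
      rw [map_smul, ← algebraMap_smul (MvPowerSeries (Fin n) K) c]
      exact Submodule.smul_mem _ _ hf
  · exact sub_shift_mem_stdSpan hlt hred ((hE i).monic e he) ((hE i).monic e' he') (hmem e he)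
      (hmem e' he') (hdeg e he) (hdeg e' he') huu
  · refine sub_shift_mem_stdSpan hlt hred ((hE i).monic e he) (hL' ℓ j) (hmem e he)
      (filt_mono (Nat.zero_le i) (hL ℓ j)) (hdeg e he) ?_ huu
    simpa [XYExp.deg, XYMon.exp] using hk

end XYVec

universe v w

/-! ### Functions computed by programs -/

/-- The situations in which a program may run. -/
structure Context : Type (u + 1) where
  K : Type u
  [field : Field K]
  n : ℕ
  s : ℕ
  p : ℕ
  lt : MonIdx n s → MonIdx n s → Prop
  ord : IsMonomialOrder lt

attribute [instance] Context.field

/-- Encodings of a family of types by trees. -/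
abbrev Enc (α : Context.{u} → Type v) : Type _ := ∀ c : Context.{u}, α c → ScalarTree c.K

namespace Enc

variable {α β : Context.{u} → Type*}

def tree : Enc.{u} fun c => ScalarTree c.K := fun _ t => t

def unit : Enc.{u} fun _ => Unit := fun _ _ => .nil

def nat : Enc.{u} fun _ => ℕ := fun _ => .ofNat

def bool : Enc.{u} fun _ => Bool := fun _ b => cond b .tt .nil

def scalar : Enc.{u} fun c => c.K := fun _ => .atom

def list (e : Enc.{u} α) : Enc.{u} fun c => List (α c) := fun c l => .ofList (l.map (e c))

def prod (e : Enc.{u} α) (e' : Enc.{u} β) : Enc.{u} fun c => α c × β c :=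
  fun c x => .cons (e c x.1) (e' c x.2)

end Enc

/-- The function `f` is computed by a program which does not depend on the context. -/
def Computes {Γ : Context.{u} → Type v} {α : Context.{u} → Type w} (eΓ : Enc Γ) (eα : Enc α)
    (f : ∀ c, Γ c → α c) : Prop :=
  ∃ A : Prog, ∀ c x, A.Runs c.lt (eΓ c x) (eα c (f c x))

namespace Computes

variable {Γ α β γ δ : Context.{u} → Type*} {eΓ : Enc Γ} {eα : Enc α} {eβ : Enc β} {eγ : Enc γ}
  {eδ : Enc δ}

theorem congr {f g : ∀ c, Γ c → α c} (hf : Computes eΓ eα f) (h : ∀ c x, f c x = g c x) :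
    Computes eΓ eα g := by
  obtain rfl : f = g := funext fun c => funext (h c)
  exact hf

/-- Programs see only trees, so values of different types may be exchanged when their trees agree.
This is how data are reinterpreted without any computation. -/
theorem of_enc_eq {f : ∀ c, Γ c → α c} {g : ∀ c, Γ c → β c} (hf : Computes eΓ eα f)
    (h : ∀ c x, eα c (f c x) = eβ c (g c x)) : Computes eΓ eβ g := by
  obtain ⟨A, hA⟩ := hf
  exact ⟨A, fun c x => h c x ▸ hA c x⟩

theorem id : Computes eΓ eΓ fun _ x => x := ⟨.id, fun _ _ => .id _⟩

theorem comp {f : ∀ c, Γ c → α c} {g : ∀ c, α c → β c} (hg : Computes eα eβ g)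
    (hf : Computes eΓ eα f) : Computes eΓ eβ fun c x => g c (f c x) := by
  obtain ⟨A, hA⟩ := hf
  obtain ⟨B, hB⟩ := hg
  exact ⟨.comp B A, fun c x => .comp (hA c x) (hB c _)⟩

theorem pair {f : ∀ c, Γ c → α c} {g : ∀ c, Γ c → β c} (hf : Computes eΓ eα f)
    (hg : Computes eΓ eβ g) : Computes eΓ (eα.prod eβ) fun c x => (f c x, g c x) := by
  obtain ⟨A, hA⟩ := hf
  obtain ⟨B, hB⟩ := hg
  exact ⟨.pair A B, fun c x => .pair (hA c x) (hB c x)⟩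

theorem fst {f : ∀ c, Γ c → α c × β c} (hf : Computes eΓ (eα.prod eβ) f) :
    Computes eΓ eα fun c x => (f c x).1 := by
  obtain ⟨A, hA⟩ := hf
  exact ⟨.comp .fst A, fun c x => .comp (hA c x) (.fst _)⟩

theorem snd {f : ∀ c, Γ c → α c × β c} (hf : Computes eΓ (eα.prod eβ) f) :
    Computes eΓ eβ fun c x => (f c x).2 := by
  obtain ⟨A, hA⟩ := hf
  exact ⟨.comp .snd A, fun c x => .comp (hA c x) (.snd _)⟩

/-- Weakening of the environment. -/
theorem weak {f : ∀ c, Γ c → α c} (hf : Computes eΓ eα f) :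
    Computes (eΓ.prod eβ) eα fun c x => f c x.1 :=
  hf.comp (fst id)

theorem treeFst {f : ∀ c, Γ c → ScalarTree c.K} (hf : Computes eΓ .tree f) :
    Computes eΓ .tree fun c x => (f c x).fst := by
  obtain ⟨A, hA⟩ := hf
  exact ⟨.comp .fst A, fun c x => .comp (hA c x) (.fst _)⟩

theorem treeSnd {f : ∀ c, Γ c → ScalarTree c.K} (hf : Computes eΓ .tree f) :
    Computes eΓ .tree fun c x => (f c x).snd := by
  obtain ⟨A, hA⟩ := hf
  exact ⟨.comp .snd A, fun c x => .comp (hA c x) (.snd _)⟩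

/-! #### Truth values -/

theorem true : Computes eΓ .bool fun _ _ => Bool.true :=
  ⟨.pair .nil .nil, fun _ _ => .pair (.nil _) (.nil _)⟩

theorem false : Computes eΓ .bool fun _ _ => Bool.false := ⟨.nil, fun _ _ => .nil _⟩

theorem cond {b : ∀ c, Γ c → Bool} {f g : ∀ c, Γ c → α c} (hb : Computes eΓ .bool b)
    (hf : Computes eΓ eα f) (hg : Computes eΓ eα g) :
    Computes eΓ eα fun c x => bif b c x then f c x else g c x := by
  obtain ⟨B, hB⟩ := hb
  obtain ⟨A, hA⟩ := hf
  obtain ⟨A', hA'⟩ := hg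
  refine ⟨.ite B A A', fun c x => ?_⟩
  have := hB c x
  beta_reduce
  cases h : b c x with
  | true => rw [h] at this; exact .ite_true this (by simp [Enc.bool, ScalarTree.tt]) (hA c x)
  | false => rw [h] at this; exact .ite_false this (hA' c x)

theorem not {b : ∀ c, Γ c → Bool} (hb : Computes eΓ .bool b) :
    Computes eΓ .bool fun c x => !(b c x) :=
  (cond hb false true).congr fun c x => by cases b c x <;> rfl

theorem and {b b' : ∀ c, Γ c → Bool} (hb : Computes eΓ .bool b) (hb' : Computes eΓ .bool b') :
    Computes eΓ .bool fun c x => b c x && b' c x :=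
  (cond hb hb' false).congr fun c x => by cases b c x <;> rfl

theorem or {b b' : ∀ c, Γ c → Bool} (hb : Computes eΓ .bool b) (hb' : Computes eΓ .bool b') :
    Computes eΓ .bool fun c x => b c x || b' c x :=
  (cond hb true hb').congr fun c x => by cases b c x <;> rfl

/-! #### Scalars -/

theorem zero : Computes eΓ .scalar fun _ _ => 0 := ⟨.zero, fun _ _ => .zero _⟩

theorem scalarAdd {f g : ∀ c, Γ c → c.K} (hf : Computes eΓ .scalar f) (hg : Computes eΓ .scalar g) :
    Computes eΓ .scalar fun c x => f c x + g c x := by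
  obtain ⟨A, hA⟩ := pair hf hg
  exact ⟨.comp .add A, fun c x => .comp (hA c x) (.add _)⟩

theorem scalarMul {f g : ∀ c, Γ c → c.K} (hf : Computes eΓ .scalar f) (hg : Computes eΓ .scalar g) :
    Computes eΓ .scalar fun c x => f c x * g c x := by
  obtain ⟨A, hA⟩ := pair hf hg
  exact ⟨.comp .mul A, fun c x => .comp (hA c x) (.mul _)⟩

theorem scalarNeg {f : ∀ c, Γ c → c.K} (hf : Computes eΓ .scalar f) :
    Computes eΓ .scalar fun c x => -f c x := by
  obtain ⟨A, hA⟩ := hf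
  exact ⟨.comp .neg A, fun c x => .comp (hA c x) (.neg _)⟩

theorem scalarInv {f : ∀ c, Γ c → c.K} (hf : Computes eΓ .scalar f) :
    Computes eΓ .scalar fun c x => (f c x)⁻¹ := by
  obtain ⟨A, hA⟩ := hf
  exact ⟨.comp .inv A, fun c x => .comp (hA c x) (.inv _)⟩

open Classical in
theorem isZero {f : ∀ c, Γ c → c.K} (hf : Computes eΓ .scalar f) :
    Computes eΓ .bool fun c x => decide (f c x = 0) := by
  obtain ⟨A, hA⟩ := hf
  refine ⟨.comp .isZero A, fun c x => .comp (hA c x) ?_⟩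
  have h : Enc.bool c (decide (f c x = 0)) =
      .ofProp (Enc.scalar c (f c x) = ScalarTree.atom 0) := by
    by_cases h : f c x = 0 <;> simp [Enc.bool, Enc.scalar, ScalarTree.ofProp, h]
  rw [h]
  exact .isZero _

/-! #### Lists -/

theorem nil : Computes eΓ (.list eα) fun _ _ => [] := ⟨.nil, fun _ _ => .nil _⟩

theorem cons {f : ∀ c, Γ c → α c} {l : ∀ c, Γ c → List (α c)} (hf : Computes eΓ eα f)
    (hl : Computes eΓ (.list eα) l) : Computes eΓ (.list eα) fun c x => f c x :: l c x :=
  (pair hf hl).of_enc_eq fun _ _ => rfl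

/-- The empty list is the tree `nil`, so `Prog.ite` tests for it directly. The result `r` is given
through its two equations, to suit definitions by `match`. -/
theorem listCases {l : ∀ c, Γ c → List (α c)} {f : ∀ c, Γ c → β c}
    {g : ∀ c, Γ c × α c × List (α c) → β c} {r : ∀ c, Γ c → β c}
    (hl : Computes eΓ (.list eα) l) (hf : Computes eΓ eβ f)
    (hg : Computes (eΓ.prod (eα.prod (.list eα))) eβ g)
    (hr : ∀ c x, l c x = [] → r c x = f c x)
    (hr' : ∀ c x a t, l c x = a :: t → r c x = g c (x, a, t)) : Computes eΓ eβ r := by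
  obtain ⟨L, hL⟩ := hl
  obtain ⟨A, hA⟩ := hf
  obtain ⟨B, hB⟩ := hg
  refine ⟨.ite L (.comp B (.pair .id L)) A, fun c x => ?_⟩
  have h1 := hL c x
  cases h : l c x with
  | nil =>
    rw [h] at h1
    rw [hr c x h]
    exact .ite_false h1 (hA c x)
  | cons a t =>
    rw [h] at h1
    rw [hr' c x a t h]
    exact .ite_true h1 (by simp [Enc.list, ScalarTree.ofList]) (.comp (.pair (.id _) h1) (hB c (x, a, t)))

theorem isEmpty {l : ∀ c, Γ c → List (α c)} (hl : Computes eΓ (.list eα) l) :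
    Computes eΓ .bool fun c x => (l c x).isEmpty :=
  listCases (g := fun _ _ => Bool.false) hl true false (fun c x h => by simp [h])
    fun c x a t h => by simp [h]

theorem tail {l : ∀ c, Γ c → List (α c)} (hl : Computes eΓ (.list eα) l) :
    Computes eΓ (.list eα) fun c x => (l c x).tail :=
  listCases (g := fun _ y => y.2.2) hl nil (snd (snd id)) (fun c x h => by simp [h])
    fun c x a t h => by simp [h]

/-- The loop state consists of the environment, the accumulator and the remaining list, and the loop
ends when the latter is `nil`. The other list operations and bounded iteration are derived from this
one. -/
theorem foldl {l : ∀ c, Γ c → List (α c)} {b : ∀ c, Γ c → β c}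
    {f : ∀ c, Γ c × β c × α c → β c} (hl : Computes eΓ (.list eα) l) (hb : Computes eΓ eβ b)
    (hf : Computes (eΓ.prod (eβ.prod eα)) eβ f) :
    Computes eΓ eβ fun c x => (l c x).foldl (fun y a => f c (x, y, a)) (b c x) := by
  obtain ⟨L, hL⟩ := hl
  obtain ⟨B, hB⟩ := hb
  obtain ⟨A, hA⟩ := hf
  let rest : Prog := .comp .snd .snd
  let step : Prog := .pair .fst (.pair
    (.comp A (.pair .fst (.pair (.comp .fst .snd) (.comp .fst rest)))) (.comp .snd rest))
  refine ⟨.comp (.comp .fst .snd) (.comp (.loop rest step) (.pair .id (.pair B L))), fun c x => ?_⟩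
  have key : ∀ (l : List (α c)) (y : β c), Prog.Runs c.lt (.loop rest step)
      (.cons (eΓ c x) (.cons (eβ c y) (Enc.list eα c l)))
      (.cons (eΓ c x) (.cons (eβ c (l.foldl (fun y a => f c (x, y, a)) y)) .nil)) := by
    intro l
    induction l with
    | nil => exact fun y => Prog.Runs.loop_stop (.comp (.snd _) (.snd _))
    | cons a l ih =>
      intro y
      refine .loop_step (a := .cons (eΓ c x) (.cons (eβ c (f c (x, y, a))) (Enc.list eα c l)))
        (.comp (.snd _) (.snd _)) (by simp [Enc.list, ScalarTree.ofList, ScalarTree.snd]) ?_ (ih _)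
      refine .pair (.fst _) (.pair (.comp (.pair (.fst _) (.pair (.comp (.snd _) (.fst _))
        (.comp (.comp (.snd _) (.snd _)) (.fst _)))) (hA c (x, y, a)))
        (.comp (.comp (.snd _) (.snd _)) (.snd _)))
  exact .comp (.comp (.pair (.id _) (.pair (hB c x) (hL c x))) (key _ _))
    (.comp (.snd _) (.fst _))

theorem reverse {l : ∀ c, Γ c → List (α c)} (hl : Computes eΓ (.list eα) l) :
    Computes eΓ (.list eα) fun c x => (l c x).reverse :=
  (foldl (f := fun _ y => y.2.2 :: y.2.1) hl nil
    (cons (snd (snd id)) (fst (snd id)))).congr fun c x => by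
      have : ∀ l o : List (α c), l.foldl (fun y a => a :: y) o = l.reverse ++ o := by
        intro l
        induction l with
        | nil => intro o; rfl
        | cons a l ih => intro o; rw [List.foldl_cons, ih]; simp
      exact (this _ _).trans (List.append_nil _)

theorem foldr {l : ∀ c, Γ c → List (α c)} {b : ∀ c, Γ c → β c}
    {f : ∀ c, Γ c × α c × β c → β c} (hl : Computes eΓ (.list eα) l) (hb : Computes eΓ eβ b)
    (hf : Computes (eΓ.prod (eα.prod eβ)) eβ f) :
    Computes eΓ eβ fun c x => (l c x).foldr (fun a y => f c (x, a, y)) (b c x) := by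
  have h : Computes (eΓ.prod (eβ.prod eα)) (eΓ.prod (eα.prod eβ))
      fun _ y => (y.1, y.2.2, y.2.1) :=
    pair (fst id) (pair (snd (snd id)) (fst (snd id)))
  exact (foldl hl.reverse hb (hf.comp h)).congr fun c x => by rw [List.foldl_reverse]

theorem map {l : ∀ c, Γ c → List (α c)} {f : ∀ c, Γ c × α c → β c}
    (hl : Computes eΓ (.list eα) l) (hf : Computes (eΓ.prod eα) eβ f) :
    Computes eΓ (.list eβ) fun c x => (l c x).map fun a => f c (x, a) :=
  (foldr (f := fun c y => f c (y.1, y.2.1) :: y.2.2) hl nil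
    (cons (hf.comp (pair (fst id) (fst (snd id)))) (snd (snd id)))).congr fun c x => by
      induction l c x with
      | nil => rfl
      | cons a l ih => simp only [List.foldr_cons, List.map_cons, ih]

theorem append {l l' : ∀ c, Γ c → List (α c)} (hl : Computes eΓ (.list eα) l)
    (hl' : Computes eΓ (.list eα) l') : Computes eΓ (.list eα) fun c x => l c x ++ l' c x :=
  (foldr (f := fun _ y => y.2.1 :: y.2.2) hl hl' (snd id)).congr fun c x => by
    induction l c x with
    | nil => rfl
    | cons a l ih => simp only [List.foldr_cons, List.cons_append, ih]

theorem flatten {l : ∀ c, Γ c → List (List (α c))} (hl : Computes eΓ (.list (.list eα)) l) :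
    Computes eΓ (.list eα) fun c x => (l c x).flatten :=
  (foldr (f := fun _ y => y.2.1 ++ y.2.2) hl nil
    (append (fst (snd id)) (snd (snd id)))).congr fun c x => by
      induction l c x with
      | nil => rfl
      | cons a l ih => simp only [List.foldr_cons, List.flatten_cons, ih]

theorem flatMap {l : ∀ c, Γ c → List (α c)} {f : ∀ c, Γ c × α c → List (β c)}
    (hl : Computes eΓ (.list eα) l) (hf : Computes (eΓ.prod eα) (.list eβ) f) :
    Computes eΓ (.list eβ) fun c x => (l c x).flatMap fun a => f c (x, a) :=
  (flatten (map hl hf)).congr fun _ _ => rfl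

theorem filter {l : ∀ c, Γ c → List (α c)} {f : ∀ c, Γ c × α c → Bool}
    (hl : Computes eΓ (.list eα) l) (hf : Computes (eΓ.prod eα) .bool f) :
    Computes eΓ (.list eα) fun c x => (l c x).filter fun a => f c (x, a) :=
  (foldr (f := fun c y => bif f c (y.1, y.2.1) then y.2.1 :: y.2.2 else y.2.2) hl nil
    (cond (hf.comp (pair (fst id) (fst (snd id)))) (snd id) (snd (snd id)))).congr
    fun c x => by
      induction l c x with
      | nil => rfl
      | cons a l ih =>
        simp only [List.foldr_cons, List.filter_cons, ih]
        cases f c (x, a) <;> rfl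

theorem any {l : ∀ c, Γ c → List (α c)} {f : ∀ c, Γ c × α c → Bool}
    (hl : Computes eΓ (.list eα) l) (hf : Computes (eΓ.prod eα) .bool f) :
    Computes eΓ .bool fun c x => (l c x).any fun a => f c (x, a) :=
  (foldr (f := fun c y => f c (y.1, y.2.1) || y.2.2) hl false
    (or (hf.comp (pair (fst id) (fst (snd id)))) (snd (snd id)))).congr fun c x => by
      induction l c x with
      | nil => rfl
      | cons a l ih => simp only [List.foldr_cons, List.any_cons, ih]

theorem all {l : ∀ c, Γ c → List (α c)} {f : ∀ c, Γ c × α c → Bool}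
    (hl : Computes eΓ (.list eα) l) (hf : Computes (eΓ.prod eα) .bool f) :
    Computes eΓ .bool fun c x => (l c x).all fun a => f c (x, a) :=
  (foldr (f := fun c y => f c (y.1, y.2.1) && y.2.2) hl true
    (and (hf.comp (pair (fst id) (fst (snd id)))) (snd (snd id)))).congr fun c x => by
      induction l c x with
      | nil => rfl
      | cons a l ih => simp only [List.foldr_cons, List.all_cons, ih]

/-- A step in the computation of `List.zip`. -/
def zipStep {α β : Type*} (y : List β × List (α × β)) (a : α) : List β × List (α × β) :=
  match y.1 with
  | [] => y
  | b :: t => (t, (a, b) :: y.2)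

theorem foldl_zipStep {α β : Type*} (l : List α) (l' : List β) (o : List (α × β)) :
    (l.foldl zipStep (l', o)).2 = (l.zip l').reverse ++ o := by
  induction l generalizing l' o with
  | nil => rfl
  | cons a l ih =>
    cases l' with
    | nil => simpa [zipStep] using ih [] o
    | cons b l' => simpa [zipStep] using ih l' ((a, b) :: o)

theorem zipStep_computes : Computes
    (eΓ.prod ((Enc.prod (.list eβ) (.list (eα.prod eβ))).prod eα))
    (Enc.prod (.list eβ) (.list (eα.prod eβ))) fun _ y => zipStep y.2.1 y.2.2 := by
  refine listCases (eα := eβ) (l := fun _ y => y.2.1.1) (f := fun _ y => y.2.1)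
    (g := fun _ z => (z.2.2, (z.1.2.2, z.2.1) :: z.1.2.1.2))
    (fst (fst (snd id))) (fst (snd id)) ?_ ?_ ?_
  · exact pair (snd (snd id)) (cons (pair (snd (snd (fst id))) (fst (snd id)))
      (snd (fst (snd (fst id)))))
  · intro c x h
    simp only [zipStep, h]
  · intro c x a t h
    simp only [zipStep, h]

theorem zip {l : ∀ c, Γ c → List (α c)} {l' : ∀ c, Γ c → List (β c)}
    (hl : Computes eΓ (.list eα) l) (hl' : Computes eΓ (.list eβ) l') :
    Computes eΓ (.list (eα.prod eβ)) fun c x => (l c x).zip (l' c x) := by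
  have h := reverse (snd (foldl hl (pair hl' (nil (eα := eα.prod eβ))) zipStep_computes))
  refine h.congr fun c x => ?_
  have := foldl_zipStep (l c x) (l' c x) []
  rw [List.append_nil] at this
  exact (congrArg List.reverse this).trans (List.reverse_reverse _)

/-! #### Natural numbers -/

/-- A unary number is the list of that many empty trees; arithmetic thus reduces to list programs.
-/
theorem enc_nat (c : Context.{u}) (k : ℕ) :
    Enc.list Enc.unit c (List.replicate k ()) = Enc.nat c k := by
  induction k with
  | zero => rfl
  | succ k ih =>
    rw [List.replicate_succ]
    exact congrArg (ScalarTree.cons .nil) ih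

theorem natZero : Computes eΓ .nat fun _ _ => 0 := ⟨.nil, fun _ _ => .nil _⟩

theorem succ {k : ∀ c, Γ c → ℕ} (hk : Computes eΓ .nat k) :
    Computes eΓ .nat fun c x => k c x + 1 := by
  obtain ⟨A, hA⟩ := hk
  exact ⟨.pair .nil A, fun c x => .pair (.nil _) (hA c x)⟩

theorem length {l : ∀ c, Γ c → List (α c)} (hl : Computes eΓ (.list eα) l) :
    Computes eΓ .nat fun c x => (l c x).length :=
  (foldr (f := fun _ y => y.2.2 + 1) hl natZero (succ (snd (snd id)))).congr fun c x => by
    induction l c x with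
    | nil => rfl
    | cons a l ih => simp only [List.foldr_cons, List.length_cons, ih]

theorem iterate {k : ∀ c, Γ c → ℕ} {b : ∀ c, Γ c → β c} {f : ∀ c, Γ c × β c → β c}
    (hk : Computes eΓ .nat k) (hb : Computes eΓ eβ b) (hf : Computes (eΓ.prod eβ) eβ f) :
    Computes eΓ eβ fun c x => (fun y => f c (x, y))^[k c x] (b c x) := by
  have hk' : Computes eΓ (.list .unit) fun c x => List.replicate (k c x) () :=
    hk.of_enc_eq fun c x => (enc_nat c _).symm
  refine (foldl (f := fun c y => f c (y.1, y.2.1)) hk' hb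
    (hf.comp (pair (fst id) (fst (snd id))))).congr fun c x => ?_
  generalize b c x = y
  induction k c x generalizing y with
  | zero => rfl
  | succ k ih => rw [List.replicate_succ, List.foldl_cons, ih, Function.iterate_succ_apply]

theorem pred {k : ∀ c, Γ c → ℕ} (hk : Computes eΓ .nat k) :
    Computes eΓ .nat fun c x => k c x - 1 := by
  have hk' : Computes eΓ (.list .unit) fun c x => List.replicate (k c x) () :=
    hk.of_enc_eq fun c x => (enc_nat c _).symm
  exact hk'.tail.of_enc_eq fun c x => by rw [List.tail_replicate, enc_nat]

theorem natIsZero {k : ∀ c, Γ c → ℕ} (hk : Computes eΓ .nat k) :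
    Computes eΓ .bool fun c x => k c x == 0 := by
  have hk' : Computes eΓ (.list .unit) fun c x => List.replicate (k c x) () :=
    hk.of_enc_eq fun c x => (enc_nat c _).symm
  exact hk'.isEmpty.congr fun c x => by cases k c x <;> rfl

theorem natAdd {k k' : ∀ c, Γ c → ℕ} (hk : Computes eΓ .nat k) (hk' : Computes eΓ .nat k') :
    Computes eΓ .nat fun c x => k c x + k' c x :=
  (iterate hk' hk (succ (snd id))).congr fun c x => by
    induction k' c x with
    | zero => rfl
    | succ j ih => rw [Function.iterate_succ_apply', ih]; rfl

theorem natSub {k k' : ∀ c, Γ c → ℕ} (hk : Computes eΓ .nat k) (hk' : Computes eΓ .nat k') :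
    Computes eΓ .nat fun c x => k c x - k' c x :=
  (iterate hk' hk (pred (snd id))).congr fun c x => by
    induction k' c x with
    | zero => rfl
    | succ j ih => rw [Function.iterate_succ_apply', ih]; rfl

theorem natLe {k k' : ∀ c, Γ c → ℕ} (hk : Computes eΓ .nat k) (hk' : Computes eΓ .nat k') :
    Computes eΓ .bool fun c x => decide (k c x ≤ k' c x) :=
  (natIsZero (natSub hk hk')).congr fun c x => by
    rw [Bool.eq_iff_iff]; simp [Nat.sub_eq_zero_iff_le]

theorem natLt {k k' : ∀ c, Γ c → ℕ} (hk : Computes eΓ .nat k) (hk' : Computes eΓ .nat k') :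
    Computes eΓ .bool fun c x => decide (k c x < k' c x) :=
  (natLe (succ hk) hk').congr fun _ _ => rfl

theorem natEq {k k' : ∀ c, Γ c → ℕ} (hk : Computes eΓ .nat k) (hk' : Computes eΓ .nat k') :
    Computes eΓ .bool fun c x => decide (k c x = k' c x) :=
  (and (natLe hk hk') (natLe hk' hk)).congr fun c x => by
    rw [Bool.eq_iff_iff]; simp only [Bool.and_eq_true, decide_eq_true_eq]; omega

theorem sum {l : ∀ c, Γ c → List ℕ} (hl : Computes eΓ (.list .nat) l) :
    Computes eΓ .nat fun c x => (l c x).sum :=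
  (foldr (f := fun _ y => y.2.1 + y.2.2) hl natZero (natAdd (fst (snd id)) (snd (snd id)))).congr
    fun _ _ => rfl

theorem range {k : ∀ c, Γ c → ℕ} (hk : Computes eΓ .nat k) :
    Computes eΓ (.list .nat) fun c x => List.range (k c x) :=
  (snd (iterate (f := fun _ y => (y.2.1 + 1, y.2.2 ++ [y.2.1])) hk (pair natZero nil)
    (pair (succ (fst (snd id))) (append (snd (snd id)) (cons (fst (snd id)) nil))))).congr
    fun c x => by
      have : ∀ k : ℕ, (fun y : ℕ × List ℕ => (y.1 + 1, y.2 ++ [y.1]))^[k] (0, []) =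
          (k, List.range k) := by
        intro k
        induction k with
        | zero => rfl
        | succ k ih => rw [Function.iterate_succ_apply', ih, List.range_succ]
      exact congrArg Prod.snd (this (k c x))

/-! #### Unbounded iteration -/

/-- Here the number of passes is not known beforehand; termination is a mathematical hypothesis, and
`Nat.find` is the pass at which the test first fails. -/
theorem loop {b : ∀ c, Γ c → β c} {t : ∀ c, Γ c × β c → Bool} {f : ∀ c, Γ c × β c → β c}
    (hb : Computes eΓ eβ b) (ht : Computes (eΓ.prod eβ) .bool t)
    (hf : Computes (eΓ.prod eβ) eβ f)
    (hterm : ∀ c x, ∃ k, t c (x, (fun y => f c (x, y))^[k] (b c x)) = Bool.false) :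
    Computes eΓ eβ fun c x => (fun y => f c (x, y))^[Nat.find (hterm c x)] (b c x) := by
  obtain ⟨B, hB⟩ := hb
  obtain ⟨T, hT⟩ := ht
  obtain ⟨A, hA⟩ := hf
  refine ⟨.comp .snd (.comp (.loop T (.pair .fst A)) (.pair .id B)), fun c x =>
    .comp (.comp (.pair (.id _) (hB c x)) ?_)
      (.snd (.cons (eΓ c x) (eβ c ((fun y => f c (x, y))^[Nat.find (hterm c x)] (b c x)))))⟩
  have key : ∀ (k : ℕ) (y : β c), (∀ j < k, t c (x, (fun y => f c (x, y))^[j] y) = Bool.true) →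
      t c (x, (fun y => f c (x, y))^[k] y) = Bool.false →
      Prog.Runs c.lt (.loop T (.pair .fst A)) (.cons (eΓ c x) (eβ c y))
        (.cons (eΓ c x) (eβ c ((fun y => f c (x, y))^[k] y))) := by
    intro k
    induction k with
    | zero =>
      intro y _ h
      have := hT c (x, y)
      rw [show t c (x, y) = Bool.false from h] at this
      exact Prog.Runs.loop_stop this
    | succ k ih =>
      intro y h h'
      have h1 := hT c (x, y)
      rw [show t c (x, y) = Bool.true from h 0 (Nat.succ_pos k)] at h1
      refine .loop_step h1 (by simp [Enc.bool, ScalarTree.tt]) (.pair (.fst _) (hA c (x, y))) ?_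
      exact ih (f c (x, y)) (fun j hj => h (j + 1) (by omega)) h'
  refine key _ _ (fun j hj => ?_) (Nat.find_spec (hterm c x))
  have := Nat.find_min (hterm c x) hj
  simpa using this

end Computes

/-! ### The algorithm -/

section Algorithm

variable {K : Type u} [Field K] {n s p : ℕ}

/-- Polynomial vectors written down as lists of terms. -/
abbrev VecData (K : Type u) (n s p : ℕ) : Type u := List (XYMon n s p × K)

/-- Lists of polynomial vectors, with designated monomial vectors. -/
abbrev BasisData (K : Type u) (n s p : ℕ) : Type u := List (XYMon n s p × VecData K n s p)

variable (lt : MonIdx n s → MonIdx n s → Prop)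

open Classical in
/-- The order, with values in `Bool`. -/
noncomputable def XYMon.ltB (a b : XYMon n s p) : Bool := decide (XYMon.Lt lt a b)

/-- Equality, with values in `Bool`. -/
noncomputable def XYMon.eqB (a b : XYMon n s p) : Bool := !XYMon.ltB lt a b && !XYMon.ltB lt b a

namespace VecData

/-- The coefficient of a monomial vector. -/
noncomputable def coeff (a : XYMon n s p) (F : VecData K n s p) : K :=
  F.foldr (fun t y => bif XYMon.eqB lt t.1 a then t.2 + y else y) 0

/-- The product with a scalar. -/
def scale (k : K) (F : VecData K n s p) : VecData K n s p := F.map fun t => (t.1, k * t.2)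

/-- The product with a monomial. -/
noncomputable def mulMon (u : XYExp n p) (F : VecData K n s p) : VecData K n s p :=
  F.map fun t => (XYMon.act u t.1, t.2)

open Classical in
/-- The monomial vectors with nonzero coefficient. -/
noncomputable def supp (F : VecData K n s p) : List (XYMon n s p) :=
  (F.filter fun t => !decide (coeff lt t.1 F = 0)).map fun t => t.1

/-- The minimal elements of the support. -/
noncomputable def lead (F : VecData K n s p) : List (XYMon n s p) :=
  (supp lt F).filter fun a => (supp lt F).all fun a' => !XYMon.ltB lt a' a

end VecData

namespace BasisData

/-- Elimination of the designated monomial vectors. -/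
noncomputable def reduce (E : BasisData K n s p) (F : VecData K n s p) : VecData K n s p :=
  E.foldl (fun F e => F ++ VecData.scale (-VecData.coeff lt e.1 F) e.2) F

/-- A step of the Gauss algorithm. -/
noncomputable def insert (E : BasisData K n s p) (F : VecData K n s p) : BasisData K n s p :=
  -- An empty list means that the reduced vector is zero. Repeated exponents may list the minimum
  -- several times, so only the head is used.
  match VecData.lead lt (reduce lt E F) with
  | [] => E
  | a :: _ => E ++ [(a, VecData.scale (VecData.coeff lt a (reduce lt E F))⁻¹ (reduce lt E F))]

/-- All products with elements of `U`. -/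
noncomputable def multiples (U : List (XYExp n p)) (E : BasisData K n s p) : BasisData K n s p :=
  E.flatMap fun e => U.map fun u => (XYMon.act u e.1, VecData.mulMon u e.2)

/-- The Gauss algorithm, applied to `E` and its products with elements of `U`. -/
noncomputable def extend (U : List (XYExp n p)) (E : BasisData K n s p) : BasisData K n s p :=
  (multiples U E).foldl (fun E e => insert lt E e.2) E

/-- Are all designated monomial vectors of `E'` products of those of `E` with `1` or elements
of `U`? -/
noncomputable def stepB (U : List (XYExp n p)) (E E' : BasisData K n s p) : Bool :=
  E'.all fun e' => (E ++ multiples U E).any fun e => XYMon.eqB lt e.1 e'.1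

/-- A number larger than the degrees of the designated monomial vectors. -/
def bound (E : BasisData K n s p) : ℕ :=
  -- The sum of all degrees is a crude maximum; the summand `1` keeps the bound positive even for
  -- degree zero, as S-vectors with `y_j e_ℓ` require.
  (E.map fun e => (List.ofFn e.1.1.1).sum + (List.ofFn e.1.2).sum).sum + 1

/-- The stopping criterion. -/
noncomputable def check (U : List (XYExp n p)) (E : BasisData K n s p) : Bool :=
  -- The pair carries the current level and the conjunction of the step tests so far.
  ((fun y : BasisData K n s p × Bool =>
    (extend lt U y.1, y.2 && stepB lt U y.1 (extend lt U y.1)))^[bound E] (E, true)).2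

end BasisData

variable (n p) in
/-- The exponents of degree one. -/
noncomputable def unitExps : List (XYExp n p) :=
  (List.finRange n).map (fun i => (Finsupp.single i 1, 0)) ++
    (List.finRange p).map fun j => (0, Finsupp.single j 1)

/-- The polynomial vector `F e_ℓ`. -/
noncomputable def PolyData.tag (ℓ : Fin s) (F : PolyData K n p) : VecData K n s p :=
  F.map fun t => (((t.1.comapDomain Sum.inl Sum.inl_injective.injOn, ℓ),
    t.1.comapDomain Sum.inr Sum.inr_injective.injOn), t.2)

/-- A component of a polynomial vector. -/
noncomputable def VecData.comp (ℓ : Fin s) (F : VecData K n s p) : PolyData K n p :=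
  (F.filter fun t => decide ((t.1.1.2 : ℕ) = ℓ)).map fun t =>
    (Finsupp.sumFinsuppEquivProdFinsupp.symm (t.1.1.1, t.1.2), t.2)

/-- The generators of the polynomial submodule defined by a code. -/
noncomputable def CodeData.gens {r : ℕ} (C : CodeData K n s p r) : List (VecData K n s p) :=
  ((List.ofFn fun k => List.ofFn (C.G k)).map fun g =>
    ((List.finRange s).zip g).flatMap fun x => PolyData.tag x.1 x.2) ++
  (List.ofFn C.H).flatMap fun F => (List.finRange s).map fun ℓ => PolyData.tag ℓ F

/-- The start of the algorithm. -/
noncomputable def CodeData.start {r : ℕ} (C : CodeData K n s p r) : BasisData K n s p :=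
  C.gens.foldl (fun E F => BasisData.insert lt E F) []

end Algorithm

/-! ### Programs for the steps of the algorithm -/

namespace Enc

def monIdx : Enc.{u} fun c => MonIdx c.n c.s := fun _ => .ofMonIdx

def exp : Enc.{u} fun c => XYExp c.n c.p := fun _ u =>
  .cons (.ofFn fun i => .ofNat (u.1 i)) (.ofFn fun j => .ofNat (u.2 j))

def mon : Enc.{u} fun c => XYMon c.n c.s c.p := fun _ m =>
  .cons (.ofMonIdx m.1) (.ofFn fun j => .ofNat (m.2 j))

abbrev vec : Enc.{u} fun c => VecData c.K c.n c.s c.p := list (prod mon scalar)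

abbrev basis : Enc.{u} fun c => BasisData c.K c.n c.s c.p := list (prod mon vec)

def fin : Enc.{u} fun c => Fin c.s := fun _ ℓ => .ofNat ℓ

def poly : Enc.{u} fun c => PolyData c.K c.n c.p := fun _ F => F.toTree

end Enc

theorem ScalarTree.ofNat_injective {K : Type u} :
    Function.Injective (ScalarTree.ofNat : ℕ → ScalarTree K) := by
  intro a
  induction a with
  | zero => intro b h; cases b with
    | zero => rfl
    | succ b => cases h
  | succ a ih => intro b h; cases b with
    | zero => cases h
    | succ b => rw [ih (ScalarTree.cons.inj h).2]

theorem ScalarTree.ofList_injective {K : Type u} :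
    Function.Injective (ScalarTree.ofList : List (ScalarTree K) → ScalarTree K) := by
  intro a
  induction a with
  | nil => intro b h; cases b with
    | nil => rfl
    | cons t b => cases h
  | cons t a ih => intro b h; cases b with
    | nil => cases h
    | cons t' b =>
      obtain ⟨h1, h2⟩ := ScalarTree.cons.inj h
      rw [h1, ih h2]

/-- `Prog.less` refers to some pairs with the given trees; injectivity ensures that these are the
intended ones. -/
theorem ScalarTree.ofMonIdx_injective {K : Type u} {n s : ℕ} :
    Function.Injective (ScalarTree.ofMonIdx : MonIdx n s → ScalarTree K) := by
  intro a b h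
  obtain ⟨h1, h2⟩ := ScalarTree.cons.inj h
  refine Prod.ext (Finsupp.ext fun i => ?_) (Fin.ext (ScalarTree.ofNat_injective h2))
  exact ScalarTree.ofNat_injective
    (congrFun (List.ofFn_injective (ScalarTree.ofList_injective h1)) i)

theorem Enc.list_ofFn {α : Context.{u} → Type*} (e : Enc α) (c : Context.{u}) {k : ℕ}
    (f : Fin k → α c) : Enc.list e c (List.ofFn f) = .ofFn fun i => e c (f i) := by
  rw [Enc.list, ScalarTree.ofFn, List.map_ofFn]
  rfl

namespace Computes

variable {Γ : Context.{u} → Type*} {eΓ : Enc Γ}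

/-! #### Monomial vectors -/

/-- An exponent and the lists of its values have the same tree, so programs for lists apply to
exponents. -/
theorem exp_iff {u : ∀ c, Γ c → XYExp c.n c.p} : Computes eΓ .exp u ↔
    Computes eΓ (.prod (.list .nat) (.list .nat)) fun c x =>
      (List.ofFn (u c x).1, List.ofFn (u c x).2) := by
  have h : ∀ c x, Enc.prod (.list .nat) (.list .nat) c
      (List.ofFn (u c x).1, List.ofFn (u c x).2) = Enc.exp c (u c x) := by
    intro c x
    simp only [Enc.prod, Enc.list_ofFn, Enc.exp, Enc.nat]
  exact ⟨fun hu => hu.of_enc_eq fun c x => (h c x).symm, fun hu => hu.of_enc_eq h⟩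

theorem mon_iff {m : ∀ c, Γ c → XYMon c.n c.s c.p} : Computes eΓ .mon m ↔
    Computes eΓ (.prod (.prod (.list .nat) .fin) (.list .nat)) fun c x =>
      ((List.ofFn (m c x).1.1, (m c x).1.2), List.ofFn (m c x).2) := by
  have h : ∀ c x, Enc.prod (.prod (.list .nat) .fin) (.list .nat) c
      ((List.ofFn (m c x).1.1, (m c x).1.2), List.ofFn (m c x).2) = Enc.mon c (m c x) := by
    intro c x
    simp only [Enc.prod, Enc.list_ofFn, Enc.mon, Enc.nat, Enc.fin, ScalarTree.ofMonIdx]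
  exact ⟨fun hu => hu.of_enc_eq fun c x => (h c x).symm, fun hu => hu.of_enc_eq h⟩

theorem monIdx {m : ∀ c, Γ c → XYMon c.n c.s c.p} (hm : Computes eΓ .mon m) :
    Computes eΓ .monIdx fun c x => (m c x).1 :=
  treeFst (hm.of_enc_eq fun _ _ => rfl : Computes eΓ .tree fun c x => Enc.mon c (m c x))
    |>.of_enc_eq fun _ _ => rfl

theorem listAdd {l l' : ∀ c, Γ c → List ℕ} (hl : Computes eΓ (.list .nat) l)
    (hl' : Computes eΓ (.list .nat) l') :
    Computes eΓ (.list .nat) fun c x => ((l c x).zip (l' c x)).map fun a => a.1 + a.2 :=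
  map (eα := .prod .nat .nat) (eβ := .nat) (f := fun _ y => y.2.1 + y.2.2) (zip hl hl') (natAdd (fst (snd id)) (snd (snd id)))

theorem map_add_zip_ofFn {k : ℕ} (f g : Fin k →₀ ℕ) :
    (((List.ofFn f).zip (List.ofFn g)).map fun a => a.1 + a.2) = List.ofFn ⇑(f + g) := by
  apply List.ext_getElem <;> simp

theorem act {u : ∀ c, Γ c → XYExp c.n c.p} {m : ∀ c, Γ c → XYMon c.n c.s c.p}
    (hu : Computes eΓ .exp u) (hm : Computes eΓ .mon m) :
    Computes eΓ .mon fun c x => XYMon.act (u c x) (m c x) := by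
  rw [exp_iff] at hu
  rw [mon_iff] at hm ⊢
  refine (pair (pair (listAdd (fst hu) (fst (fst hm))) (snd (fst hm)))
    (listAdd (snd hu) (snd hm))).congr fun c x => ?_
  simp only [map_add_zip_ofFn]
  rfl

open Classical in
theorem less {a b : ∀ c, Γ c → MonIdx c.n c.s} (ha : Computes eΓ .monIdx a)
    (hb : Computes eΓ .monIdx b) :
    Computes eΓ .bool fun c x => decide (c.lt (a c x) (b c x)) := by
  obtain ⟨A, hA⟩ := pair ha hb
  refine ⟨.comp .less A, fun c x => .comp (hA c x) ?_⟩
  have h : Enc.bool c (decide (c.lt (a c x) (b c x))) =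
      .ofProp (∃ a' b', Enc.prod .monIdx .monIdx c (a c x, b c x) =
        ScalarTree.cons (.ofMonIdx a') (.ofMonIdx b') ∧ c.lt a' b') := by
    have hiff : (∃ a' b', Enc.prod .monIdx .monIdx c (a c x, b c x) =
        ScalarTree.cons (.ofMonIdx a') (.ofMonIdx b') ∧ c.lt a' b') ↔ c.lt (a c x) (b c x) := by
      constructor
      · rintro ⟨a', b', h1, h2⟩
        obtain ⟨h3, h4⟩ := ScalarTree.cons.inj h1
        have h5 : a c x = a' := ScalarTree.ofMonIdx_injective h3
        have h6 : b c x = b' := ScalarTree.ofMonIdx_injective h4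
        rw [h5, h6]
        exact h2
      · intro h
        exact ⟨_, _, rfl, h⟩
    rw [ScalarTree.ofProp, propext hiff]
    by_cases h : c.lt (a c x) (b c x) <;> simp [Enc.bool, h]
  rw [h]
  exact .less _

/-- Lexicographic comparison of lists of the same length. -/
def lexB (l l' : List ℕ) : Bool :=
  (l.zip l').foldr (fun a y => decide (a.1 < a.2) || (!decide (a.2 < a.1) && y)) Bool.false

theorem lexB_iff {l l' : List ℕ} (h : l.length = l'.length) :
    lexB l l' = Bool.true ↔ l < l' := by
  induction l generalizing l' with
  | nil => cases l' with
    | nil => simp [lexB]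
    | cons b l' => simp at h
  | cons a l ih => cases l' with
    | nil => simp at h
    | cons b l' =>
      have := ih (l' := l') (by simpa using h)
      rw [lexB] at this
      rw [lexB, List.zip_cons_cons, List.foldr_cons, List.cons_lt_cons_iff]
      simp only [Bool.or_eq_true, decide_eq_true_eq, Bool.and_eq_true, Bool.not_eq_true',
        decide_eq_false_iff_not, not_lt, this]
      constructor
      · rintro (h | ⟨h, h'⟩)
        · exact Or.inl h
        · rcases h.lt_or_eq with h1 | h1
          · exact Or.inl h1
          · exact Or.inr ⟨h1, h'⟩
      · rintro (h | ⟨h, h'⟩)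
        · exact Or.inl h
        · exact Or.inr ⟨h.le, h'⟩

theorem lex {l l' : ∀ c, Γ c → List ℕ} (hl : Computes eΓ (.list .nat) l)
    (hl' : Computes eΓ (.list .nat) l') : Computes eΓ .bool fun c x => lexB (l c x) (l' c x) :=
  foldr (eα := .prod .nat .nat) (eβ := .bool)
    (f := fun _ y => decide (y.2.1.1 < y.2.1.2) || (!decide (y.2.1.2 < y.2.1.1) && y.2.2))
    (zip hl hl') false
    (or (natLt (fst (fst (snd id))) (snd (fst (snd id))))
      (and (not (natLt (snd (fst (snd id))) (fst (fst (snd id))))) (snd (snd id))))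

theorem yKey_eq {k : ℕ} (β : Fin k →₀ ℕ) :
    XYMon.yKey β = (List.ofFn β).sum :: List.ofFn β := by
  rw [XYMon.yKey, Finsupp.degree_eq_sum, List.sum_ofFn]

/-- Equality of `x`-parts need not be tested: by totality it is enough that neither precedes the
other, and the test is reached only in that case or when the answer is already decided. -/
theorem ltB {a b : ∀ c, Γ c → XYMon c.n c.s c.p} (ha : Computes eΓ .mon a)
    (hb : Computes eΓ .mon b) :
    Computes eΓ .bool fun c x => XYMon.ltB c.lt (a c x) (b c x) := by
  have ha' := snd (mon_iff.mp ha)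
  have hb' := snd (mon_iff.mp hb)
  refine (or (less ha.monIdx hb.monIdx) (and (not (less hb.monIdx ha.monIdx))
    (lex (cons (sum ha') ha') (cons (sum hb') hb')))).congr fun c x => ?_
  simp only [← yKey_eq]
  rw [Bool.eq_iff_iff, XYMon.ltB]
  simp only [Bool.or_eq_true, decide_eq_true_eq, Bool.and_eq_true, Bool.not_eq_true',
    decide_eq_false_iff_not]
  rw [lexB_iff (by simp [XYMon.yKey]), XYMon.Lt]
  constructor
  · rintro (h | ⟨h, h'⟩)
    · exact Or.inl h
    · rcases c.ord.total (a c x).1 (b c x).1 with h1 | h1 | h1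
      · exact Or.inl h1
      · exact Or.inr ⟨h1, h'⟩
      · exact absurd h1 h
  · rintro (h | ⟨h, h'⟩)
    · exact Or.inl h
    · exact Or.inr ⟨h ▸ c.ord.irrefl _, h'⟩

theorem eqB {a b : ∀ c, Γ c → XYMon c.n c.s c.p} (ha : Computes eΓ .mon a)
    (hb : Computes eΓ .mon b) :
    Computes eΓ .bool fun c x => XYMon.eqB c.lt (a c x) (b c x) :=
  and (not (ltB ha hb)) (not (ltB hb ha))

/-! #### Polynomial vectors -/

theorem coeff {a : ∀ c, Γ c → XYMon c.n c.s c.p} {F : ∀ c, Γ c → VecData c.K c.n c.s c.p}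
    (ha : Computes eΓ .mon a) (hF : Computes eΓ .vec F) :
    Computes eΓ .scalar fun c x => VecData.coeff c.lt (a c x) (F c x) :=
  foldr (eα := .prod .mon .scalar) (eβ := .scalar)
    (f := fun c y => bif XYMon.eqB c.lt y.2.1.1 (a c y.1) then y.2.1.2 + y.2.2 else y.2.2)
    hF zero (cond (eqB (fst (fst (snd id))) ha.weak)
      (scalarAdd (snd (fst (snd id))) (snd (snd id))) (snd (snd id)))

theorem scale {k : ∀ c, Γ c → c.K} {F : ∀ c, Γ c → VecData c.K c.n c.s c.p}
    (hk : Computes eΓ .scalar k) (hF : Computes eΓ .vec F) :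
    Computes eΓ .vec fun c x => VecData.scale (k c x) (F c x) :=
  map (eα := .prod .mon .scalar) (eβ := .prod .mon .scalar)
    (f := fun c y => (y.2.1, k c y.1 * y.2.2)) hF
    (pair (fst (snd id)) (scalarMul hk.weak (snd (snd id))))

theorem mulMon {u : ∀ c, Γ c → XYExp c.n c.p} {F : ∀ c, Γ c → VecData c.K c.n c.s c.p}
    (hu : Computes eΓ .exp u) (hF : Computes eΓ .vec F) :
    Computes eΓ .vec fun c x => VecData.mulMon (u c x) (F c x) :=
  map (eα := .prod .mon .scalar) (eβ := .prod .mon .scalar)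
    (f := fun c y => (XYMon.act (u c y.1) y.2.1, y.2.2)) hF
    (pair (act hu.weak (fst (snd id))) (snd (snd id)))

open Classical in
theorem supp {F : ∀ c, Γ c → VecData c.K c.n c.s c.p} (hF : Computes eΓ .vec F) :
    Computes eΓ (.list .mon) fun c x => VecData.supp c.lt (F c x) :=
  map (eα := .prod .mon .scalar) (eβ := .mon) (f := fun _ y => y.2.1)
    (filter (eα := .prod .mon .scalar) (f := fun c y => !decide (VecData.coeff c.lt y.2.1 (F c y.1) = 0)) hF
      (not (isZero (coeff (fst (snd id)) hF.weak)))) (fst (snd id))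

theorem lead {F : ∀ c, Γ c → VecData c.K c.n c.s c.p} (hF : Computes eΓ .vec F) :
    Computes eΓ (.list .mon) fun c x => VecData.lead c.lt (F c x) :=
  filter (eα := .mon) (f := fun c y => (VecData.supp c.lt (F c y.1)).all fun a' => !XYMon.ltB c.lt a' y.2)
    (supp hF) (all (eΓ := eΓ.prod .mon) (eα := .mon) (f := fun c z => !XYMon.ltB c.lt z.2 z.1.2) (supp hF).weak
      (not (ltB (snd id) (snd (fst id)))))

/-! #### Lists of polynomial vectors -/

variable {E : ∀ c, Γ c → BasisData c.K c.n c.s c.p} (hE : Computes eΓ .basis E)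
  {U : ∀ c, Γ c → List (XYExp c.n c.p)} (hU : Computes eΓ (.list .exp) U)
include hE

theorem reduce {F : ∀ c, Γ c → VecData c.K c.n c.s c.p} (hF : Computes eΓ .vec F) :
    Computes eΓ .vec fun c x => BasisData.reduce c.lt (E c x) (F c x) :=
  foldl (eα := .prod .mon .vec) (eβ := .vec)
    (f := fun c y => y.2.1 ++ VecData.scale (-VecData.coeff c.lt y.2.2.1 y.2.1) y.2.2.2) hE hF
    (append (fst (snd id)) (scale (scalarNeg (coeff (fst (snd (snd id))) (fst (snd id))))
      (snd (snd (snd id)))))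

theorem insert {F : ∀ c, Γ c → VecData c.K c.n c.s c.p} (hF : Computes eΓ .vec F) :
    Computes eΓ .basis fun c x => BasisData.insert c.lt (E c x) (F c x) := by
  have hR := reduce hE hF
  refine listCases (eα := .mon) (g := fun c y => E c y.1 ++ [(y.2.1, VecData.scale
    (VecData.coeff c.lt y.2.1 (BasisData.reduce c.lt (E c y.1) (F c y.1)))⁻¹
    (BasisData.reduce c.lt (E c y.1) (F c y.1)))]) (lead hR) hE ?_ ?_ ?_
  · exact append hE.weak (cons (pair (fst (snd id))
      (scale (scalarInv (coeff (fst (snd id)) hR.weak)) hR.weak)) nil)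
  · intro c x h
    simp only [BasisData.insert, h]
  · intro c x a t h
    simp only [BasisData.insert, h]

theorem bound : Computes eΓ .nat fun c x => BasisData.bound (E c x) :=
  succ (sum (map (eα := .prod .mon .vec) (eβ := .nat)
    (f := fun _ y => (List.ofFn y.2.1.1.1).sum + (List.ofFn y.2.1.2).sum) hE
    (natAdd (sum (fst (fst (mon_iff.mp (fst (snd id)))))) (sum (snd (mon_iff.mp (fst (snd id))))))))

include hU

theorem multiples : Computes eΓ .basis fun c x => BasisData.multiples (U c x) (E c x) :=
  flatMap (eα := .prod .mon .vec) (eβ := .prod .mon .vec) (f := fun c y => (U c y.1).map fun u =>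
      (XYMon.act u y.2.1, VecData.mulMon u y.2.2)) hE
    (map (eΓ := eΓ.prod (.prod .mon .vec)) (eα := .exp) (eβ := .prod .mon .vec)
      (f := fun _ z => (XYMon.act z.2 z.1.2.1, VecData.mulMon z.2 z.1.2.2)) hU.weak
      (pair (act (snd id) (fst (snd (fst id)))) (mulMon (snd id) (snd (snd (fst id))))))

theorem extend : Computes eΓ .basis fun c x => BasisData.extend c.lt (U c x) (E c x) :=
  foldl (eα := .prod .mon .vec) (eβ := .basis) (f := fun c y => BasisData.insert c.lt y.2.1 y.2.2.2) (multiples hE hU) hE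
    (insert (fst (snd id)) (snd (snd (snd id))))

theorem stepB {E' : ∀ c, Γ c → BasisData c.K c.n c.s c.p} (hE' : Computes eΓ .basis E') :
    Computes eΓ .bool fun c x => BasisData.stepB c.lt (U c x) (E c x) (E' c x) :=
  all (eα := .prod .mon .vec) (f := fun c y => (E c y.1 ++ BasisData.multiples (U c y.1) (E c y.1)).any fun e =>
      XYMon.eqB c.lt e.1 y.2.1) hE'
    (any (eΓ := eΓ.prod (.prod .mon .vec)) (eα := .prod .mon .vec) (f := fun c z => XYMon.eqB c.lt z.2.1 z.1.2.1) (append hE (multiples hE hU)).weak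
      (eqB (fst (snd id)) (fst (snd (fst id)))))

theorem check : Computes eΓ .bool fun c x => BasisData.check c.lt (U c x) (E c x) :=
  snd (iterate (eβ := .prod .basis .bool) (f := fun c y => (BasisData.extend c.lt (U c y.1) y.2.1,
      y.2.2 && BasisData.stepB c.lt (U c y.1) y.2.1 (BasisData.extend c.lt (U c y.1) y.2.1)))
    (bound hE) (pair hE true)
    (pair (extend (fst (snd id)) hU.weak)
      (and (snd (snd id)) (stepB (fst (snd id)) hU.weak (extend (fst (snd id)) hU.weak)))))

omit hE hU

/-! #### Input and output -/

theorem ofFn_single {k : ℕ} (i : Fin k) :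
    List.ofFn ⇑(Finsupp.single i 1) =
      (List.range k).map fun j => bif decide ((i : ℕ) = j) then 1 else 0 := by
  apply List.ext_getElem
  · simp
  · intro j h1 h2
    simp [Finsupp.single_apply, Fin.ext_iff, Bool.cond_decide]

theorem ofFn_zero (k : ℕ) : List.ofFn ⇑(0 : Fin k →₀ ℕ) = (List.range k).map fun _ => 0 := by
  apply List.ext_getElem <;> simp

/-- The list depends on the context alone, but a program has to read `n` and `p` from its input. -/
theorem unitExps (hn : Computes eΓ .nat fun c _ => c.n) (hp : Computes eΓ .nat fun c _ => c.p) :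
    Computes eΓ (.list .exp) fun c _ => unitExps c.n c.p := by
  have hz : ∀ {k : Context.{u} → ℕ}, Computes eΓ .nat (fun c _ => k c) →
      Computes eΓ (.list .nat) fun c _ => (List.range (k c)).map fun _ => 0 := fun hk =>
    map (eα := .nat) (eβ := .nat) (f := fun _ _ => 0) (range hk) natZero
  have hu : ∀ {k : Context.{u} → ℕ}, Computes eΓ .nat (fun c _ => k c) →
      Computes (eΓ.prod .nat) (.list .nat) fun c y =>
        (List.range (k c)).map fun j => bif decide (y.2 = j) then 1 else 0 := fun hk =>
    map (eΓ := eΓ.prod .nat) (eα := .nat) (eβ := .nat) (f := fun _ z => bif decide (z.1.2 = z.2) then 1 else 0) (range hk.weak)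
      (cond (natEq (snd (fst id)) (snd id)) (succ natZero) natZero)
  refine (append
    (map (eα := .nat) (eβ := .prod (.list .nat) (.list .nat))
      (f := fun c y => (((List.range c.n).map fun j => bif decide (y.2 = j) then 1 else 0),
        (List.range c.p).map fun _ => 0)) (range hn) (pair (hu hn) (hz hp).weak))
    (map (eα := .nat) (eβ := .prod (.list .nat) (.list .nat))
      (f := fun c y => ((List.range c.n).map fun _ => 0,
        ((List.range c.p).map fun j => bif decide (y.2 = j) then 1 else 0))) (range hp)
      (pair (hz hn).weak (hu hp)))).of_enc_eq fun c x => ?_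
  have h : (((List.range c.n).map fun i => (((List.range c.n).map fun j =>
        bif decide (i = j) then 1 else 0), (List.range c.p).map fun _ => 0)) ++
      (List.range c.p).map fun i => ((List.range c.n).map fun _ => 0,
        ((List.range c.p).map fun j => bif decide (i = j) then 1 else 0))) =
      (_root_.unitExps c.n c.p).map fun u => (List.ofFn u.1, List.ofFn u.2) := by
    rw [_root_.unitExps, List.map_append, List.map_map, List.map_map]
    congr 1
    · rw [← List.map_coe_finRange_eq_range (n := c.n), List.map_map]
      refine List.map_congr_left fun i _ => ?_
      simp only [Function.comp_apply, ofFn_single, ofFn_zero, List.map_coe_finRange_eq_range]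
    · rw [← List.map_coe_finRange_eq_range (n := c.p), List.map_map]
      refine List.map_congr_left fun i _ => ?_
      simp only [Function.comp_apply, ofFn_single, ofFn_zero, List.map_coe_finRange_eq_range]
  have h' := congrArg (Enc.list (.prod (.list .nat) (.list .nat)) c) h
  refine h'.trans ?_
  rw [Enc.list, Enc.list, List.map_map]
  congr 1
  refine List.map_congr_left fun u _ => ?_
  simp only [Function.comp_apply, Enc.prod, Enc.list_ofFn, Enc.exp, Enc.nat]

end Computes

/-! ### The part of the basis that is returned -/

section Output

variable {K : Type u} [Field K] {n s p : ℕ}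

/-- The elements whose designated monomial vectors do not involve `y`. -/
def BasisData.yFree (E : BasisData K n s p) : BasisData K n s p :=
  E.filter fun e => (List.ofFn e.1.2).all fun k => k == 0

/-- The code with given mother code which consists of the polynomial vectors in a list. -/
noncomputable def BasisData.code (H : Fin p → PolyData K n p) (E : BasisData K n s p) :
    CodeData K n s p E.length :=
  ⟨H, fun k ℓ => VecData.comp ℓ (E.get k).2⟩

/-- The `x`-parts of the designated monomial vectors. -/
def BasisData.initials (E : BasisData K n s p) (k : Fin E.length) : MonIdx n s := (E.get k).1.1

end Output

namespace Enc

/-- Unlike `n`, `s` and `p`, the number `r` of vectors belongs to the value and not to the context.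
-/
def code : Enc.{u} fun c => Σ r, CodeData c.K c.n c.s c.p r := fun _ x => x.2.input

def term : Enc.{u} fun c => ((Fin c.n ⊕ Fin c.p) →₀ ℕ) × c.K := fun _ t =>
  .cons (.ofFn fun i => .ofNat (t.1 (Sum.inl i)))
    (.cons (.ofFn fun j => .ofNat (t.1 (Sum.inr j))) (.atom t.2))

end Enc

namespace Computes

variable {Γ α β : Context.{u} → Type*} {eΓ : Enc Γ} {eα : Enc α} {eβ : Enc β}

/-! #### Reading a code -/

theorem codeTree : Computes .code .tree fun c (x : Σ r, CodeData c.K c.n c.s c.p r) => x.2.input :=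
  id.of_enc_eq fun _ _ => rfl

theorem codeN : Computes .code .nat fun c _ => c.n :=
  (treeFst (treeFst codeTree)).of_enc_eq fun _ _ => rfl

theorem codeS : Computes .code .nat fun c _ => c.s :=
  (treeFst (treeSnd (treeFst codeTree))).of_enc_eq fun _ _ => rfl

theorem codeP : Computes .code .nat fun c _ => c.p :=
  (treeFst (treeSnd (treeSnd (treeFst codeTree)))).of_enc_eq fun _ _ => rfl

theorem codeH : Computes .code (.list .poly) fun _ x => List.ofFn x.2.H :=
  (treeFst (treeSnd codeTree)).of_enc_eq fun c _ => (Enc.list_ofFn Enc.poly c _).symm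

theorem codeG : Computes .code (.list (.list .poly)) fun _ x =>
    List.ofFn fun k => List.ofFn (x.2.G k) :=
  (treeSnd (treeSnd codeTree)).of_enc_eq fun c x => by
    rw [Enc.list_ofFn]
    simp only [Enc.list_ofFn]
    rfl

theorem finRange (hs : Computes eΓ .nat fun c _ => c.s) :
    Computes eΓ (.list .fin) fun c _ => List.finRange c.s :=
  (range hs).of_enc_eq fun c _ => by
    rw [Enc.list, Enc.list, ← List.map_coe_finRange_eq_range, List.map_map]
    rfl

theorem term_iff {t : ∀ c, Γ c → ((Fin c.n ⊕ Fin c.p) →₀ ℕ) × c.K} : Computes eΓ .term t ↔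
    Computes eΓ (.prod (.list .nat) (.prod (.list .nat) .scalar)) fun c x =>
      (List.ofFn fun i => (t c x).1 (Sum.inl i), List.ofFn fun j => (t c x).1 (Sum.inr j),
        (t c x).2) := by
  have h : ∀ c x, Enc.prod (.list .nat) (.prod (.list .nat) .scalar) c
      (List.ofFn fun i => (t c x).1 (Sum.inl i), List.ofFn fun j => (t c x).1 (Sum.inr j),
        (t c x).2) = Enc.term c (t c x) := by
    intro c x
    simp only [Enc.prod, Enc.list_ofFn, Enc.term, Enc.nat, Enc.scalar]
  exact ⟨fun hu => hu.of_enc_eq fun c x => (h c x).symm, fun hu => hu.of_enc_eq h⟩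

theorem tag {ℓ : ∀ c, Γ c → Fin c.s} {F : ∀ c, Γ c → PolyData c.K c.n c.p}
    (hℓ : Computes eΓ .fin ℓ) (hF : Computes eΓ .poly F) :
    Computes eΓ .vec fun c x => PolyData.tag (ℓ c x) (F c x) := by
  have hF' : Computes eΓ (.list .term) F := hF.of_enc_eq fun _ _ => rfl
  have ht : Computes (eΓ.prod .term) .term fun _ y => y.2 := snd id
  rw [term_iff] at ht
  refine map (eα := .term) (eβ := .prod .mon .scalar) (f := fun c y =>
    (((y.2.1.comapDomain Sum.inl Sum.inl_injective.injOn, ℓ c y.1),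
      y.2.1.comapDomain Sum.inr Sum.inr_injective.injOn), y.2.2)) hF' (pair (mon_iff.mpr ?_) ?_)
  · have hx := fst ht
    have hy := fst (snd ht)
    exact pair (pair hx hℓ.weak) hy
  · have hk := snd (snd ht)
    exact hk

theorem comp' {ℓ : ∀ c, Γ c → Fin c.s} {F : ∀ c, Γ c → VecData c.K c.n c.s c.p}
    (hℓ : Computes eΓ .fin ℓ) (hF : Computes eΓ .vec F) :
    Computes eΓ .poly fun c x => VecData.comp (ℓ c x) (F c x) := by
  have ht : Computes (eΓ.prod (.prod .mon .scalar)) .mon fun _ y => y.2.1 := fst (snd id)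
  rw [mon_iff] at ht
  have hℓ' : Computes (eΓ.prod (.prod .mon .scalar)) .nat fun c y => (ℓ c y.1 : ℕ) :=
    hℓ.weak.of_enc_eq fun _ _ => rfl
  have hm : Computes (eΓ.prod (.prod .mon .scalar)) .nat fun _ y => (y.2.1.1.2 : ℕ) :=
    (snd (fst ht)).of_enc_eq fun _ _ => rfl
  have hmap : Computes eΓ (.list .term) fun c x => VecData.comp (ℓ c x) (F c x) := by
    refine map (eα := .prod .mon .scalar) (eβ := .term) (f := fun c y =>
      (Finsupp.sumFinsuppEquivProdFinsupp.symm (y.2.1.1.1, y.2.1.2), y.2.2))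
      (filter (eα := .prod .mon .scalar) (f := fun c y => decide ((y.2.1.1.2 : ℕ) = ℓ c y.1)) hF
        (natEq hm hℓ')) (term_iff.mpr ?_)
    have hx := fst (fst ht)
    have hy := snd ht
    have hk : Computes (eΓ.prod (.prod .mon .scalar)) .scalar fun _ y => y.2.2 := snd (snd id)
    exact pair hx (pair hy hk)
  exact hmap.of_enc_eq fun _ _ => rfl

theorem gens : Computes .code (.list .vec) fun _ x => x.2.gens := by
  refine append (map (eα := .list .poly) (eβ := .vec) (f := fun c y =>
    ((List.finRange c.s).zip y.2).flatMap fun x => PolyData.tag x.1 x.2) codeG ?_)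
    (flatMap (eα := .poly) (eβ := .vec) (f := fun c y =>
      (List.finRange c.s).map fun ℓ => PolyData.tag ℓ y.2) codeH ?_)
  · exact flatMap (eΓ := Enc.code.prod (.list .poly)) (eα := .prod .fin .poly)
      (eβ := .prod .mon .scalar) (f := fun _ z => PolyData.tag z.2.1 z.2.2)
      (zip (finRange codeS.weak) (snd id)) (tag (fst (snd id)) (snd (snd id)))
  · exact map (eΓ := Enc.code.prod .poly) (eα := .fin) (eβ := .vec)
      (f := fun _ z => PolyData.tag z.2 z.1.2) (finRange codeS.weak)
      (tag (snd id) (snd (fst id)))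

theorem start : Computes .code .basis fun c x => x.2.start c.lt :=
  foldl (eα := .vec) (eβ := .basis) (f := fun c y => BasisData.insert c.lt y.2.1 y.2.2) gens nil
    (insert (fst (snd id)) (snd (snd id)))

/-! #### Writing a code -/

theorem yFree {E : ∀ c, Γ c → BasisData c.K c.n c.s c.p} (hE : Computes eΓ .basis E) :
    Computes eΓ .basis fun c x => (E c x).yFree :=
  filter (eα := .prod .mon .vec) (f := fun _ y => (List.ofFn y.2.1.2).all fun k => k == 0) hE
    (all (eΓ := eΓ.prod (.prod .mon .vec)) (eα := .nat) (f := fun _ z => z.2 == 0)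
      (snd (mon_iff.mp (fst (snd id)))) (natIsZero (snd id)))

theorem treeCons {f : ∀ c, Γ c → α c} {g : ∀ c, Γ c → β c} (hf : Computes eΓ eα f)
    (hg : Computes eΓ eβ g) :
    Computes eΓ .tree fun c x => .cons (eα c (f c x)) (eβ c (g c x)) :=
  (pair hf hg).of_enc_eq fun _ _ => rfl

theorem output {E : ∀ c, (Σ r, CodeData c.K c.n c.s c.p r) → BasisData c.K c.n c.s c.p}
    (hE : Computes .code .basis E) : Computes .code .tree fun c x =>
      (BasisData.code x.2.H (E c x)).output (E c x).initials := by
  have hG : Computes .code (.list (.list .poly)) fun c x => (E c x).map fun e =>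
      (List.finRange c.s).map fun ℓ => VecData.comp ℓ e.2 := by
    refine map (eα := .prod .mon .vec) (eβ := .list .poly) (f := fun c y =>
      (List.finRange c.s).map fun ℓ => VecData.comp ℓ y.2.2) hE ?_
    exact map (eΓ := Enc.code.prod (.prod .mon .vec)) (eα := .fin) (eβ := .poly)
      (f := fun _ z => VecData.comp z.2 z.1.2.2) (finRange codeS.weak)
      (comp' (snd id) (snd (snd (fst id))))
  have ha : Computes .code (.list .monIdx) fun c x => (E c x).map fun e => e.1.1 :=
    map (eα := .prod .mon .vec) (eβ := .monIdx) (f := fun _ y => y.2.1.1) hE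
      (monIdx (fst (snd id)))
  refine (treeCons (cons codeP (cons (length hE) nil))
    (treeCons (treeCons codeH hG) ha)).of_enc_eq fun c x => ?_
  rw [CodeData.output, CodeData.toTree]
  have h1 : Enc.list Enc.monIdx c ((E c x).map fun e => e.1.1) =
      .ofFn fun k => .ofMonIdx ((E c x).initials k) := by
    refine Eq.trans ?_ (Enc.list_ofFn Enc.monIdx c (E c x).initials)
    congr 1
    apply List.ext_getElem <;> simp [BasisData.initials]
  have h2 : Enc.list (Enc.list Enc.poly) c ((E c x).map fun e =>
      (List.finRange c.s).map fun ℓ => VecData.comp ℓ e.2) =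
      .ofFn fun k => .ofFn fun ℓ => ((BasisData.code x.2.H (E c x)).G k ℓ).toTree := by
    have : ∀ k, (ScalarTree.ofFn fun ℓ => ((BasisData.code x.2.H (E c x)).G k ℓ).toTree) =
        Enc.list Enc.poly c (List.ofFn ((BasisData.code x.2.H (E c x)).G k)) :=
      fun k => (Enc.list_ofFn Enc.poly c _).symm
    simp only [this]
    rw [← Enc.list_ofFn (Enc.list Enc.poly)]
    congr 1
    apply List.ext_getElem
    · simp
    · intro i h1 h2
      simp [BasisData.code, List.ofFn_eq_map]
  rw [h1, h2, Enc.list_ofFn]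
  rfl

end Computes

/-! ### Correctness of the algorithm -/

section Correctness

variable {K : Type u} [Field K] {n s p : ℕ} {lt : MonIdx n s → MonIdx n s → Prop}

theorem XYMon.ltB_iff {a b : XYMon n s p} : XYMon.ltB lt a b = true ↔ XYMon.Lt lt a b := by
  simp [XYMon.ltB]

theorem XYMon.eqB_iff (hlt : IsMonomialOrder lt) {a b : XYMon n s p} :
    XYMon.eqB lt a b = true ↔ a = b := by
  simp only [XYMon.eqB, Bool.and_eq_true, Bool.not_eq_true', Bool.eq_false_iff, ne_eq,
    XYMon.ltB_iff]
  constructor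
  · rintro ⟨h1, h2⟩
    exact ((XYMon.Lt.total hlt a b).resolve_left h1).resolve_right h2
  · rintro rfl
    exact ⟨XYMon.Lt.irrefl hlt a, XYMon.Lt.irrefl hlt a⟩

/-! ### Lists of terms and the vectors they denote -/

namespace VecData

/-- The polynomial vector which a list of terms denotes. -/
noncomputable def toVec (F : VecData K n s p) : XYMon n s p →₀ K :=
  (F.map fun t => Finsupp.single t.1 t.2).sum

@[simp] theorem toVec_nil : toVec ([] : VecData K n s p) = 0 := rfl

@[simp] theorem toVec_cons (t : XYMon n s p × K) (F : VecData K n s p) :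
    toVec (t :: F) = Finsupp.single t.1 t.2 + toVec F := by
  rw [toVec, List.map_cons, List.sum_cons]; rfl

@[simp] theorem toVec_append (F G : VecData K n s p) : toVec (F ++ G) = toVec F + toVec G := by
  rw [toVec, List.map_append, List.sum_append]; rfl

@[simp] theorem toVec_scale (k : K) (F : VecData K n s p) : toVec (scale k F) = k • toVec F := by
  induction F with
  | nil => simp [scale]
  | cons t F ih =>
    rw [scale, List.map_cons, toVec_cons, toVec_cons, smul_add, ← ih]
    simp [scale]

@[simp] theorem toVec_mulMon (u : XYExp n p) (F : VecData K n s p) :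
    toVec (mulMon u F) = XYVec.shift u (toVec F) := by
  induction F with
  | nil => simp [mulMon]
  | cons t F ih =>
    rw [mulMon, List.map_cons, toVec_cons, toVec_cons, map_add, ← ih]
    simp [mulMon]

theorem coeff_eq (hlt : IsMonomialOrder lt) (a : XYMon n s p) (F : VecData K n s p) :
    coeff lt a F = toVec F a := by
  induction F with
  | nil => simp [coeff]
  | cons t F ih =>
    rw [toVec_cons, Finsupp.add_apply, ← ih, coeff, List.foldr_cons]
    by_cases h : t.1 = a
    · rw [(XYMon.eqB_iff hlt).mpr h, h, Finsupp.single_eq_same]; rfl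
    · rw [Bool.eq_false_iff.mpr fun h' => h ((XYMon.eqB_iff hlt).mp h'),
        Finsupp.single_eq_of_ne (Ne.symm h), zero_add]
      rfl

theorem mem_supp (hlt : IsMonomialOrder lt) {a : XYMon n s p} {F : VecData K n s p} :
    a ∈ supp lt F ↔ toVec F a ≠ 0 := by
  have hex : ∀ F : VecData K n s p, toVec F a ≠ 0 → ∃ t ∈ F, t.1 = a := by
    intro F
    induction F with
    | nil => intro h; simp at h
    | cons t F ih =>
      intro h
      by_cases ht : t.1 = a
      · exact ⟨t, List.mem_cons_self .., ht⟩
      · rw [toVec_cons, Finsupp.add_apply, Finsupp.single_eq_of_ne (Ne.symm ht), zero_add] at h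
        obtain ⟨t', ht', h'⟩ := ih h
        exact ⟨t', List.mem_cons_of_mem _ ht', h'⟩
  simp only [supp, List.mem_map, List.mem_filter, Bool.not_eq_true', decide_eq_false_iff_not,
    coeff_eq hlt]
  constructor
  · rintro ⟨t, ⟨-, h⟩, rfl⟩
    exact h
  · intro h
    obtain ⟨t, ht, rfl⟩ := hex F h
    exact ⟨t, ⟨ht, h⟩, rfl⟩

theorem mem_lead (hlt : IsMonomialOrder lt) {a : XYMon n s p} {F : VecData K n s p} :
    a ∈ lead lt F ↔ toVec F a ≠ 0 ∧ ∀ c, toVec F c ≠ 0 → c = a ∨ XYMon.Lt lt a c := by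
  simp only [lead, List.mem_filter, mem_supp hlt, List.all_eq_true, Bool.not_eq_true',
    Bool.eq_false_iff, ne_eq, XYMon.ltB_iff]
  refine and_congr_right fun _ => forall₂_congr fun c _ => ⟨fun h => ?_, fun h h' => ?_⟩
  · rcases XYMon.Lt.total hlt c a with h1 | h1 | h1
    · exact absurd h1 h
    · exact Or.inl h1
    · exact Or.inr h1
  · rcases h with rfl | h
    · exact XYMon.Lt.irrefl hlt _ h'
    · exact XYMon.Lt.asymm hlt h h'

theorem toVec_eq_zero_of_lead (hlt : IsMonomialOrder lt) {F : VecData K n s p}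
    (h : lead lt F = []) : toVec F = 0 := by
  by_contra h0
  obtain ⟨a, ha, hmin⟩ := XYVec.exists_min hlt h0
  have := (mem_lead hlt).mpr ⟨ha, hmin⟩
  rw [h] at this
  exact List.not_mem_nil this

end VecData

/-! ### Gauss elimination -/

namespace BasisData

open VecData

/-- The span of the polynomial vectors in a list. -/
noncomputable def span (E : BasisData K n s p) : Submodule K (XYMon n s p →₀ K) :=
  Submodule.span K {f | ∃ e ∈ E, f = toVec e.2}

theorem mem_span {E : BasisData K n s p} {e : XYMon n s p × VecData K n s p} (he : e ∈ E) :
    toVec e.2 ∈ span E := Submodule.subset_span ⟨e, he, rfl⟩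

theorem span_append_singleton (E : BasisData K n s p) (e : XYMon n s p × VecData K n s p) :
    span (E ++ [e]) = span E ⊔ Submodule.span K {toVec e.2} := by
  rw [span, span, ← Submodule.span_union]
  congr 1
  ext f
  simp only [List.mem_append, List.mem_singleton, Set.mem_union, Set.mem_singleton_iff]
  constructor
  · rintro ⟨e', h | rfl, rfl⟩
    · exact Or.inl ⟨e', h, rfl⟩
    · exact Or.inr rfl
  · rintro (⟨e', h, rfl⟩ | rfl)
    · exact ⟨e', Or.inl h, rfl⟩
    · exact ⟨e, Or.inr rfl, rfl⟩

/-- The elements of `E` are monic and each of them is reduced with respect to its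
predecessors. -/
structure IsReduced (lt : MonIdx n s → MonIdx n s → Prop) (E : BasisData K n s p) : Prop where
  monic : ∀ e ∈ E, XYVec.IsMonic lt e.1 (toVec e.2)
  pairwise : E.Pairwise fun e e' => toVec e'.2 e.1 = 0

theorem reduce_cons (e : XYMon n s p × VecData K n s p) (E : BasisData K n s p)
    (F : VecData K n s p) :
    reduce lt (e :: E) F = reduce lt E (F ++ scale (-coeff lt e.1 F) e.2) := rfl

theorem toVec_reduce_sub_mem (E : BasisData K n s p) (F : VecData K n s p) :
    toVec (reduce lt E F) - toVec F ∈ span E := by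
  induction E generalizing F with
  | nil => simp [reduce]
  | cons e E ih =>
    have hle : span E ≤ span (e :: E) :=
      Submodule.span_mono fun f ⟨e', h, h'⟩ => ⟨e', List.mem_cons_of_mem _ h, h'⟩
    have h1 := hle (ih (F ++ scale (-coeff lt e.1 F) e.2))
    rw [← reduce_cons, toVec_append, toVec_scale] at h1
    have h2 := Submodule.add_mem _ h1 (Submodule.smul_mem _ (-coeff lt e.1 F)
      (mem_span (List.mem_cons_self (a := e) (l := E))))
    convert h2 using 1
    abel

theorem toVec_reduce_apply_of_forall {E : BasisData K n s p} {c : XYMon n s p}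
    (h : ∀ e ∈ E, toVec e.2 c = 0) (F : VecData K n s p) :
    toVec (reduce lt E F) c = toVec F c := by
  induction E generalizing F with
  | nil => rfl
  | cons e E ih =>
    rw [reduce_cons, ih fun e' he' => h e' (List.mem_cons_of_mem _ he')]
    simp [h e (List.mem_cons_self ..)]

/-- Later elements of `E` vanish at the designated monomial vectors of earlier ones, so a
coefficient once eliminated stays zero and a single pass suffices. -/
theorem IsReduced.toVec_reduce_apply (hlt : IsMonomialOrder lt) {E : BasisData K n s p}
    (hE : IsReduced lt E) (F : VecData K n s p) {e : XYMon n s p × VecData K n s p} (he : e ∈ E) :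
    toVec (reduce lt E F) e.1 = 0 := by
  induction E generalizing F with
  | nil => simp at he
  | cons e' E ih =>
    obtain ⟨hp1, hp2⟩ := List.pairwise_cons.mp hE.pairwise
    rw [reduce_cons]
    rcases List.mem_cons.mp he with rfl | he
    · rw [toVec_reduce_apply_of_forall hp1, toVec_append, toVec_scale, coeff_eq hlt]
      simp [(hE.monic e he).1]
    · exact ih ⟨fun e h => hE.monic e (List.mem_cons_of_mem _ h), hp2⟩ _ he

/-- The reduced vector vanishes at all designated monomial vectors, so the new element is reduced
with respect to its predecessors. It differs from a nonzero multiple of `F` by an element of the old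
span. -/
theorem IsReduced.insert (hlt : IsMonomialOrder lt) {E : BasisData K n s p}
    (hE : IsReduced lt E) (F : VecData K n s p) :
    IsReduced lt (insert lt E F) ∧
      span (BasisData.insert lt E F) = span E ⊔ Submodule.span K {toVec F} := by
  have hsub := toVec_reduce_sub_mem (lt := lt) E F
  rw [BasisData.insert]
  cases h : lead lt (reduce lt E F) with
  | nil =>
    refine ⟨hE, ?_⟩
    rw [toVec_eq_zero_of_lead hlt h, zero_sub, neg_mem_iff] at hsub
    exact (sup_eq_left.mpr (by rwa [Submodule.span_singleton_le_iff_mem])).symm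
  | cons a l =>
    have ha := (mem_lead hlt).mp (h ▸ List.mem_cons_self (a := a) (l := l))
    set R := reduce lt E F with hR
    have hk : coeff lt a R ≠ 0 := by rw [coeff_eq hlt]; exact ha.1
    have hzero : ∀ e ∈ E, toVec R e.1 = 0 := fun e he => hE.toVec_reduce_apply hlt F he
    refine ⟨⟨fun e he => ?_, ?_⟩, ?_⟩
    · rcases List.mem_append.mp he with he | he
      · exact hE.monic e he
      · rw [List.mem_singleton.mp he]
        refine ⟨?_, fun c hc => ha.2 c fun h0 => hc ?_⟩
        · simp only [toVec_scale, Finsupp.smul_apply, smul_eq_mul, coeff_eq hlt]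
          exact inv_mul_cancel₀ ha.1
        · simp [h0]
    · rw [List.pairwise_append]
      refine ⟨hE.pairwise, List.pairwise_singleton .., fun e he e' he' => ?_⟩
      rw [List.mem_singleton.mp he']
      simp [hzero e he]
    · rw [span_append_singleton]
      simp only [toVec_scale]
      have hspan : Submodule.span K {(coeff lt a R)⁻¹ • toVec R} = Submodule.span K {toVec R} :=
        Submodule.span_singleton_smul_eq (IsUnit.mk0 _ (inv_ne_zero hk)) _
      rw [hspan]
      apply le_antisymm <;> refine sup_le le_sup_left ?_
      · rw [Submodule.span_singleton_le_iff_mem]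
        have h1 := (le_sup_left : _ ≤ span E ⊔ Submodule.span K {toVec F}) hsub
        have h2 := Submodule.add_mem _ h1
          (Submodule.mem_sup_right (Submodule.mem_span_singleton_self (toVec F)))
        rwa [sub_add_cancel] at h2
      · rw [Submodule.span_singleton_le_iff_mem]
        have h1 := (le_sup_left : _ ≤ span E ⊔ Submodule.span K {toVec R}) hsub
        have h2 := Submodule.sub_mem _
          (Submodule.mem_sup_right (Submodule.mem_span_singleton_self (toVec R))) h1
        rwa [sub_sub_cancel] at h2

theorem IsReduced.foldl_insert (hlt : IsMonomialOrder lt) {E : BasisData K n s p}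
    (hE : IsReduced lt E) (L : List (VecData K n s p)) :
    IsReduced lt (L.foldl (fun E F => BasisData.insert lt E F) E) ∧
      span (L.foldl (fun E F => BasisData.insert lt E F) E) =
        span E ⊔ Submodule.span K {f | ∃ F ∈ L, f = toVec F} := by
  induction L generalizing E with
  | nil => exact ⟨hE, by simp⟩
  | cons F L ih =>
    obtain ⟨h1, h2⟩ := hE.insert hlt F
    obtain ⟨h3, h4⟩ := ih h1
    refine ⟨h3, ?_⟩
    rw [List.foldl_cons, h4, h2, sup_assoc, ← Submodule.span_union]
    congr 2
    ext f
    simp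

omit [Field K] in
theorem mem_multiples {U : List (XYExp n p)} {E : BasisData K n s p}
    {x : XYMon n s p × VecData K n s p} :
    x ∈ multiples U E ↔ ∃ e ∈ E, ∃ u ∈ U, x = (XYMon.act u e.1, mulMon u e.2) := by
  simp only [multiples, List.mem_flatMap, List.mem_map]
  exact ⟨fun ⟨e, he, u, hu, h⟩ => ⟨e, he, u, hu, h.symm⟩,
    fun ⟨e, he, u, hu, h⟩ => ⟨e, he, u, hu, h.symm⟩⟩

/-- The products of a basis of layer `j` with the variables, together with that basis, span layer `j
+ 1` by `XYVec.filt_succ_le`. -/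
theorem IsReduced.extend (hlt : IsMonomialOrder lt) {U : List (XYExp n p)}
    (hU : ∀ z, z ∈ U ↔ z.deg = 1) {P : Set (XYMon n s p →₀ K)} {j : ℕ} {E : BasisData K n s p}
    (hE : IsReduced lt E) (hE' : span E = XYVec.filt P j) :
    IsReduced lt (extend lt U E) ∧ span (BasisData.extend lt U E) = XYVec.filt P (j + 1) := by
  have hfold : BasisData.extend lt U E =
      ((multiples U E).map fun e => e.2).foldl (fun E F => BasisData.insert lt E F) E := by
    rw [List.foldl_map]; rfl
  obtain ⟨h1, h2⟩ := hE.foldl_insert hlt ((multiples U E).map fun e => e.2)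
  rw [hfold]
  refine ⟨h1, ?_⟩
  rw [h2]
  apply le_antisymm
  · rw [hE']
    refine sup_le (XYVec.filt_mono (Nat.le_succ j)) (Submodule.span_le.mpr ?_)
    rintro _ ⟨F, hF, rfl⟩
    obtain ⟨x, hx, rfl⟩ := List.mem_map.mp hF
    obtain ⟨e, he, u, hu, rfl⟩ := mem_multiples.mp hx
    have := XYVec.shift_mem_filt (hE' ▸ mem_span he : toVec e.2 ∈ XYVec.filt P j) u
    rw [(hU u).mp hu] at this
    simpa using this
  · refine XYVec.filt_succ_le (hE' ▸ le_sup_left) fun z hz f hf => ?_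
    rw [← hE', span] at hf
    induction hf using Submodule.span_induction with
    | mem f hf =>
      obtain ⟨e, he, rfl⟩ := hf
      refine Submodule.mem_sup_right (Submodule.subset_span
        ⟨mulMon z e.2, List.mem_map.mpr ⟨_, mem_multiples.mpr ⟨e, he, z, (hU z).mpr hz, rfl⟩, rfl⟩,
          (toVec_mulMon z e.2).symm⟩)
    | zero => rw [map_zero]; exact Submodule.zero_mem _
    | add f g _ _ hf hg => rw [map_add]; exact Submodule.add_mem _ hf hg
    | smul c f _ hf => rw [map_smul]; exact Submodule.smul_mem _ _ hf

/-- The polynomial vectors denoted by the entries of a list. -/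
noncomputable def toVecs (E : BasisData K n s p) : List (XYMon n s p × (XYMon n s p →₀ K)) :=
  E.map fun e => (e.1, toVec e.2)

theorem map_fst_toVecs (E : BasisData K n s p) :
    (toVecs E).map Prod.fst = E.map Prod.fst := by
  rw [toVecs, List.map_map]; rfl

/-- If two designated monomial vectors agreed, the later vector would have both coefficient `0` and
coefficient `1` there. -/
theorem IsReduced.isEchelon {E : BasisData K n s p} (hE : IsReduced lt E) :
    XYVec.IsEchelon lt (toVecs E) (span E) where
  monic := by
    intro e he
    obtain ⟨e', he', rfl⟩ := List.mem_map.mp he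
    exact hE.monic e' he'
  nodup := by
    rw [map_fst_toVecs, List.Nodup, List.pairwise_map]
    refine (List.Pairwise.and_mem.mp hE.pairwise).imp ?_
    rintro e e' ⟨-, he', h⟩ heq
    rw [heq, (hE.monic e' he').1] at h
    exact one_ne_zero h
  span_eq := by
    rw [span]
    congr 1
    ext f
    simp only [toVecs, List.mem_map, exists_exists_and_eq_and, Set.mem_ofPred_eq]

omit [Field K] in
theorem stepB_iff (hlt : IsMonomialOrder lt) {U : List (XYExp n p)}
    (hU : ∀ z, z ∈ U ↔ z.deg = 1) (E E' : BasisData K n s p) :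
    stepB lt U E E' = true ↔ XYVec.IsStep (E.map Prod.fst) (E'.map Prod.fst) := by
  simp only [stepB, List.all_eq_true, List.any_eq_true, XYMon.eqB_iff hlt, List.mem_append,
    mem_multiples, XYVec.IsStep, List.mem_map]
  constructor
  · rintro h _ ⟨e', he', rfl⟩
    obtain ⟨x, hx | ⟨e, he, u, hu, rfl⟩, h1⟩ := h e' he'
    · exact Or.inl ⟨x, hx, h1⟩
    · exact Or.inr ⟨e.1, ⟨e, he, rfl⟩, u, (hU u).mp hu, h1.symm⟩
  · intro h e' he'
    rcases h e'.1 ⟨e', he', rfl⟩ with ⟨e, he, h1⟩ | ⟨_, ⟨e, he, rfl⟩, z, hz, h1⟩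
    · exact ⟨e, Or.inl he, h1⟩
    · exact ⟨_, Or.inr ⟨e, he, z, (hU z).mpr hz, rfl⟩, h1.symm⟩

theorem check_iff (hlt : IsMonomialOrder lt) {U : List (XYExp n p)}
    (hU : ∀ z, z ∈ U ↔ z.deg = 1) (E : BasisData K n s p) :
    check lt U E = true ↔ ∀ j < bound E, XYVec.IsStep (((extend lt U)^[j] E).map Prod.fst)
      (((extend lt U)^[j + 1] E).map Prod.fst) := by
  have key : ∀ k, ((fun y : BasisData K n s p × Bool =>
      (extend lt U y.1, y.2 && stepB lt U y.1 (extend lt U y.1)))^[k] (E, true)).1 =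
        (extend lt U)^[k] E ∧
      (((fun y : BasisData K n s p × Bool =>
        (extend lt U y.1, y.2 && stepB lt U y.1 (extend lt U y.1)))^[k] (E, true)).2 = true ↔
        ∀ j < k, XYVec.IsStep (((extend lt U)^[j] E).map Prod.fst)
          (((extend lt U)^[j + 1] E).map Prod.fst)) := by
    intro k
    induction k with
    | zero => exact ⟨rfl, by simp⟩
    | succ k ih =>
      rw [Function.iterate_succ_apply']
      refine ⟨by rw [ih.1, Function.iterate_succ_apply'], ?_⟩
      simp only [Bool.and_eq_true, ih.1, ih.2, stepB_iff hlt hU]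
      rw [← Function.iterate_succ_apply' (extend lt U)]
      constructor
      · rintro ⟨h1, h2⟩ j hj
        rcases Nat.lt_succ_iff_lt_or_eq.mp hj with h | rfl
        · exact h1 j h
        · exact h2
      · exact fun h => ⟨fun j hj => h j (by omega), h k (Nat.lt_succ_self k)⟩
  exact (key _).2

omit [Field K] in
theorem deg_lt_bound {E : BasisData K n s p} {e : XYMon n s p × VecData K n s p} (he : e ∈ E) :
    e.1.exp.deg < bound E := by
  have h1 : e.1.exp.deg = (List.ofFn e.1.1.1).sum + (List.ofFn e.1.2).sum := by
    rw [XYExp.deg, XYMon.exp, Finsupp.degree_eq_sum, Finsupp.degree_eq_sum, List.sum_ofFn,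
      List.sum_ofFn]
  rw [bound, Nat.lt_succ_iff, h1]
  exact List.single_le_sum (fun _ _ => Nat.zero_le _) _ (List.mem_map.mpr ⟨e, he, rfl⟩)

end BasisData

theorem mem_unitExps (z : XYExp n p) : z ∈ unitExps n p ↔ z.deg = 1 := by
  simp only [unitExps, List.mem_append, List.mem_map, List.mem_finRange, true_and]
  constructor
  · rintro (⟨i, rfl⟩ | ⟨j, rfl⟩) <;> simp [XYExp.deg]
  · intro hz
    obtain ⟨α, β⟩ := z
    have hz' : α.degree + β.degree = 1 := hz
    by_cases hα : α = 0
    · subst hα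
      have hβ : β ≠ 0 := by rintro rfl; simp at hz'
      obtain ⟨i, γ, rfl⟩ := exists_single_add hβ
      simp only [map_zero, map_add, Finsupp.degree_single, zero_add, Nat.add_eq_left,
        Finsupp.degree_eq_zero_iff] at hz'
      exact Or.inr ⟨i, by rw [hz', add_zero]⟩
    · obtain ⟨i, γ, rfl⟩ := exists_single_add hα
      simp only [map_add, Finsupp.degree_single, add_assoc, Nat.add_eq_left, Nat.add_eq_zero_iff,
        Finsupp.degree_eq_zero_iff] at hz'
      exact Or.inl ⟨i, by rw [hz'.1, hz'.2, add_zero]⟩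

end Correctness

section Final

variable {K : Type u} [Field K] {n s p : ℕ} {lt : MonIdx n s → MonIdx n s → Prop}

/-! ### Codes and polynomial vectors -/

theorem PolyData.toPoly_cons (t : ((Fin n ⊕ Fin p) →₀ ℕ) × K) (F : PolyData K n p) :
    PolyData.toPoly (t :: F) = MvPolynomial.monomial t.1 t.2 + F.toPoly := by
  rw [PolyData.toPoly, List.map_cons, List.sum_cons]; rfl

theorem substBaby_monomial (h : Fin p → MvPowerSeries (Fin n) K) (t : (Fin n ⊕ Fin p) →₀ ℕ)
    (c : K) (ℓ : Fin s) :
    Pi.single ℓ (substBaby h (MvPolynomial.monomial t c)) = c • XYVec.substMon h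
      (((t.comapDomain Sum.inl Sum.inl_injective.injOn, ℓ),
        t.comapDomain Sum.inr Sum.inr_injective.injOn) : XYMon n s p) := by
  classical
  rw [XYVec.substMon, ← Pi.single_smul, substBaby, MvPolynomial.aeval_monomial,
    Finsupp.prod_fintype _ _ (by simp), Fintype.prod_sum_type, Algebra.smul_def]
  congr 2
  simp only [Sum.elim_inl, Sum.elim_inr, Finsupp.comapDomain_apply]
  congr 1
  rw [MvPowerSeries.monomial_one_eq, Finsupp.prod_fintype _ _ (by simp)]
  rfl

theorem subst_tag (h : Fin p → MvPowerSeries (Fin n) K) (ℓ : Fin s) (F : PolyData K n p) :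
    XYVec.subst h (F.tag ℓ).toVec = Pi.single ℓ (substBaby h F.toPoly) := by
  induction F with
  | nil => simp [PolyData.tag, PolyData.toPoly]
  | cons t F ih =>
    rw [PolyData.toPoly_cons, map_add, Pi.single_add, ← ih, substBaby_monomial, PolyData.tag,
      List.map_cons, VecData.toVec_cons, map_add, XYVec.subst_single]
    rfl

theorem substBaby_comp (h : Fin p → MvPowerSeries (Fin n) K) (ℓ : Fin s) (F : VecData K n s p) :
    substBaby h (F.comp ℓ).toPoly = XYVec.subst h F.toVec ℓ := by
  induction F with
  | nil => simp [VecData.comp, PolyData.toPoly]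
  | cons t F ih =>
    obtain ⟨⟨⟨α, ℓ'⟩, β⟩, k⟩ := t
    rw [VecData.toVec_cons, map_add, Pi.add_apply, ← ih, XYVec.subst_single, Pi.smul_apply]
    by_cases hℓ : ℓ' = ℓ
    · subst hℓ
      have h1 : VecData.comp ℓ' ((((α, ℓ'), β), k) :: F) =
          (Finsupp.sumFinsuppEquivProdFinsupp.symm (α, β), k) :: VecData.comp ℓ' F := by
        rw [VecData.comp, List.filter_cons_of_pos (by simp), List.map_cons]; rfl
      have h2 := congrFun (substBaby_monomial h (Finsupp.sumFinsuppEquivProdFinsupp.symm (α, β)) k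
        ℓ') ℓ'
      rw [Pi.single_eq_same, Pi.smul_apply] at h2
      have h3 : (((Finsupp.sumFinsuppEquivProdFinsupp.symm (α, β)).comapDomain Sum.inl
          Sum.inl_injective.injOn, ℓ'), (Finsupp.sumFinsuppEquivProdFinsupp.symm
          (α, β)).comapDomain Sum.inr Sum.inr_injective.injOn) = (((α, ℓ'), β) : XYMon n s p) :=
        Prod.ext (Prod.ext (by ext i; simp) rfl) (by ext i; simp)
      rw [h1, PolyData.toPoly_cons, map_add, h2, h3]
    · have h1 : VecData.comp ℓ ((((α, ℓ'), β), k) :: F) = VecData.comp ℓ F := by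
        rw [VecData.comp, List.filter_cons_of_neg (by simpa [Fin.ext_iff] using hℓ)]; rfl
      rw [h1, XYVec.substMon, Pi.single_eq_of_ne (Ne.symm hℓ), smul_zero, zero_add]

theorem toVec_tag_apply (ℓ : Fin s) (F : PolyData K n p) (c : XYMon n s p) :
    (PolyData.tag ℓ F).toVec c = if c.1.2 = ℓ then
      MvPolynomial.coeff (Finsupp.sumFinsuppEquivProdFinsupp.symm (c.1.1, c.2)) F.toPoly else 0 := by
  classical
  induction F with
  | nil => simp [PolyData.tag, PolyData.toPoly]
  | cons t F ih =>
    rw [PolyData.tag, List.map_cons, VecData.toVec_cons, Finsupp.add_apply, PolyData.toPoly_cons,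
      MvPolynomial.coeff_add, MvPolynomial.coeff_monomial]
    have hF : VecData.toVec (List.map (fun t : ((Fin n ⊕ Fin p) →₀ ℕ) × K =>
      (((t.1.comapDomain Sum.inl Sum.inl_injective.injOn, ℓ),
        t.1.comapDomain Sum.inr Sum.inr_injective.injOn), t.2)) F) c = (PolyData.tag ℓ F).toVec c := rfl
    rw [hF, ih, Finsupp.single_apply]
    by_cases hc : c.1.2 = ℓ
    · rw [if_pos hc, if_pos hc]
      congr 1
      refine if_congr ?_ rfl rfl
      obtain ⟨⟨α, ℓ'⟩, β⟩ := c
      obtain rfl : ℓ' = ℓ := hc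
      rw [Equiv.eq_symm_apply]
      simp only [Prod.mk.injEq, and_true]
      constructor
      · rintro ⟨rfl, rfl⟩
        refine Prod.ext ?_ ?_ <;> ext i <;> simp
      · intro h
        have h1 := congrArg Prod.fst h
        have h2 := congrArg Prod.snd h
        simp only at h1 h2
        rw [← h1, ← h2]
        constructor <;> ext i <;> simp
    · rw [if_neg hc, if_neg hc, if_neg, add_zero]
      rintro rfl
      exact hc rfl

/-- The entries of the Jacobian matrix at the origin are the coefficients of the linear terms in
`y`. -/
theorem constantCoeff_pderiv (j : Fin p) (F : XYPoly K n p) :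
    MvPolynomial.constantCoeff (MvPolynomial.pderiv (Sum.inr j) F) =
      MvPolynomial.coeff (Finsupp.single (Sum.inr j) 1) F := by
  classical
  induction F using MvPolynomial.induction_on' with
  | monomial t c =>
    rw [MvPolynomial.pderiv_monomial, MvPolynomial.constantCoeff_eq, MvPolynomial.coeff_monomial,
      MvPolynomial.coeff_monomial]
    by_cases ht : t = Finsupp.single (Sum.inr j) 1
    · subst ht; simp
    · rw [if_neg ht]
      split_ifs with h0
      · have h1 : t (Sum.inr j) = 0 := by
          by_contra hne
          refine ht (le_antisymm (tsub_eq_zero_iff_le.mp h0) ?_)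
          rw [Finsupp.single_le_iff]
          exact Nat.one_le_iff_ne_zero.mpr hne
        simp [h1]
      · rfl
  | add F G hF hG => rw [map_add, map_add, hF, hG, MvPolynomial.coeff_add]

namespace CodeData

variable {r : ℕ} (C : CodeData K n s p r)

/-- The polynomial vectors which generate the submodule defined by a code. -/
noncomputable def genSet : Set (XYMon n s p →₀ K) := {f | ∃ F ∈ C.gens, f = VecData.toVec F}

theorem genSet_finite : C.genSet.Finite := by
  have : C.genSet = VecData.toVec '' {F | F ∈ C.gens} := by
    ext f; exact ⟨fun ⟨F, h, h'⟩ => ⟨F, h, h'.symm⟩, fun ⟨F, h, h'⟩ => ⟨F, h, h'.symm⟩⟩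
  rw [this]
  exact (List.finite_toSet _).image _

/-- The generator defined by an element of the father code. -/
noncomputable def fatherData (k : Fin r) : VecData K n s p :=
  ((List.finRange s).zip (List.ofFn (C.G k))).flatMap fun x => PolyData.tag x.1 x.2

omit [Field K] in
theorem mem_gens {F : VecData K n s p} :
    F ∈ C.gens ↔ (∃ k, F = C.fatherData k) ∨ ∃ i ℓ, F = (C.H i).tag ℓ := by
  simp only [gens, List.mem_append, List.mem_map, List.mem_flatMap, List.mem_ofFn,
    List.mem_finRange, true_and, fatherData]
  constructor
  · rintro (⟨_, ⟨k, rfl⟩, rfl⟩ | ⟨_, ⟨i, rfl⟩, ℓ, rfl⟩)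
    · exact Or.inl ⟨k, rfl⟩
    · exact Or.inr ⟨i, ℓ, rfl⟩
  · rintro (⟨k, rfl⟩ | ⟨i, ℓ, rfl⟩)
    · exact Or.inl ⟨_, ⟨k, rfl⟩, rfl⟩
    · exact Or.inr ⟨_, ⟨i, rfl⟩, ℓ, rfl⟩

theorem subst_fatherData (h : Fin p → MvPowerSeries (Fin n) K) (k : Fin r) :
    XYVec.subst h (C.fatherData k).toVec = fun ℓ => substBaby h (C.father k ℓ) := by
  have hflat : ∀ L : List (Fin s × PolyData K n p),
      XYVec.subst h (VecData.toVec (L.flatMap fun x => PolyData.tag x.1 x.2)) =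
        (L.map fun x => (Pi.single x.1 (substBaby h x.2.toPoly) : SeriesVec K n s)).sum := by
    intro L
    induction L with
    | nil => simp
    | cons x L ih =>
      rw [List.flatMap_cons, VecData.toVec_append, map_add, ih, subst_tag, List.map_cons,
        List.sum_cons]
  have hzip : (List.finRange s).zip (List.ofFn (C.G k)) = List.ofFn fun ℓ => (ℓ, C.G k ℓ) := by
    apply List.ext_getElem <;> simp
  rw [fatherData, hflat, hzip, List.map_ofFn, List.sum_ofFn]
  exact Finset.univ_sum_single fun ℓ => substBaby h (C.father k ℓ)

/-- The vectors `H_i e_ℓ` vanish at `h`, so only the father code contributes to the module. -/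
theorem span_subst_genSet {h : Fin p → MvPowerSeries (Fin n) K} (hh : IsBabySeries C.mother h) :
    Submodule.span (MvPowerSeries (Fin n) K) (XYVec.subst h '' C.genSet) =
      Submodule.span (MvPowerSeries (Fin n) K)
        (Set.range fun k ℓ => substBaby h (C.father k ℓ)) := by
  apply le_antisymm
  · rw [Submodule.span_le]
    rintro _ ⟨_, ⟨F, hF, rfl⟩, rfl⟩
    rcases C.mem_gens.mp hF with ⟨k, rfl⟩ | ⟨i, ℓ, rfl⟩
    · rw [subst_fatherData]
      exact Submodule.subset_span ⟨k, rfl⟩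
    · rw [subst_tag]
      have : substBaby h (C.H i).toPoly = 0 := hh.eq_zero i
      rw [this, Pi.single_zero]
      exact Submodule.zero_mem _
  · rw [Submodule.span_le]
    rintro _ ⟨k, rfl⟩
    refine Submodule.subset_span ⟨_, ⟨_, C.mem_gens.mpr (Or.inl ⟨k, rfl⟩), rfl⟩, ?_⟩
    rw [subst_fatherData]

/-! ### Vectors with initial monomial vector `y_j e_ℓ` -/

/-- The Jacobian matrix of the mother code at the origin. -/
noncomputable def jacobian : Matrix (Fin p) (Fin p) K :=
  Matrix.of fun i j => MvPolynomial.constantCoeff (MvPolynomial.pderiv (Sum.inr j) (C.mother i))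

/-- Combinations of the components of the mother code whose linear terms in `y` are the
variables `y_j`. -/
noncomputable def varVec (ℓ : Fin s) (j : Fin p) : XYMon n s p →₀ K :=
  ∑ i, (C.jacobian)⁻¹ j i • VecData.toVec ((C.H i).tag ℓ)

theorem varVec_mem_filt (ℓ : Fin s) (j : Fin p) : C.varVec ℓ j ∈ XYVec.filt C.genSet 0 := by
  refine Submodule.sum_mem _ fun i _ => Submodule.smul_mem _ _ (Submodule.subset_span
    ⟨_, ⟨_, C.mem_gens.mpr (Or.inr ⟨i, ℓ, rfl⟩), rfl⟩, 0, by simp [XYExp.deg], by simp⟩)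

theorem subst_varVec {h : Fin p → MvPowerSeries (Fin n) K} (hh : IsBabySeries C.mother h)
    (ℓ : Fin s) (j : Fin p) : XYVec.subst h (C.varVec ℓ j) = 0 := by
  rw [varVec, map_sum]
  refine Finset.sum_eq_zero fun i _ => ?_
  have : substBaby h (C.H i).toPoly = 0 := hh.eq_zero i
  rw [map_smul, subst_tag, this, Pi.single_zero, smul_zero]

/-- The condition `H(0,0) = 0` removes the constant term and the inverse Jacobian turns the linear
part in `y` into `y_j`. All remaining monomial vectors in the component are larger, by
`XYMon.lt_of_ne`. -/
theorem isMonic_varVec (hlt : IsMonomialOrder lt) (hC : IsMotherCode C.mother) (ℓ : Fin s)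
    (j : Fin p) : XYVec.IsMonic lt ((0, ℓ), Finsupp.single j 1) (C.varVec ℓ j) := by
  classical
  have happ : ∀ c, C.varVec ℓ j c =
      ∑ i, (C.jacobian)⁻¹ j i * VecData.toVec ((C.H i).tag ℓ) c := by
    intro c; simp [varVec, Finsupp.finsetSum_apply]
  have hvar : ∀ j', C.varVec ℓ j ((0, ℓ), Finsupp.single j' 1) = if j = j' then 1 else 0 := by
    intro j'
    have h1 : ∀ i, VecData.toVec ((C.H i).tag ℓ) ((0, ℓ), Finsupp.single j' 1) =
        C.jacobian i j' := by
      intro i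
      have h2 : Finsupp.sumFinsuppEquivProdFinsupp.symm
          ((0 : Fin n →₀ ℕ), (Finsupp.single j' 1 : Fin p →₀ ℕ)) =
          Finsupp.single (Sum.inr j') 1 := by
        ext x; rcases x with x | x <;> simp [Finsupp.single_apply]
      rw [toVec_tag_apply, if_pos rfl, h2, ← constantCoeff_pderiv]
      rfl
    rw [happ]
    simp only [h1]
    have hdet : IsUnit C.jacobian.det :=
      (Matrix.isUnit_iff_isUnit_det C.jacobian).mp hC.jacobian
    rw [← Matrix.mul_apply, Matrix.nonsing_inv_mul C.jacobian hdet, Matrix.one_apply]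
  refine ⟨by rw [hvar, if_pos rfl], fun c hc => ?_⟩
  by_cases hcj : c = ((0, ℓ), Finsupp.single j 1)
  · exact Or.inl hcj
  refine Or.inr (XYMon.lt_of_ne hlt ℓ j ?_ ?_ ?_)
  · by_contra hne
    refine hc ?_
    rw [happ]
    exact Finset.sum_eq_zero fun i _ => by rw [toVec_tag_apply, if_neg hne, mul_zero]
  · rintro rfl
    refine hc ?_
    rw [happ]
    refine Finset.sum_eq_zero fun i _ => ?_
    have h0 : Finsupp.sumFinsuppEquivProdFinsupp.symm ((0 : Fin n →₀ ℕ), (0 : Fin p →₀ ℕ)) = 0 := by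
      ext x; rcases x with x | x <;> simp
    rw [toVec_tag_apply, if_pos rfl, h0]
    have := hC.zero i
    rw [MvPolynomial.constantCoeff_eq] at this
    exact mul_eq_zero_of_right _ this
  · rintro i rfl
    rw [hvar] at hc
    split_ifs at hc with hji
    · exact hcj (by rw [hji])
    · exact hc rfl

/-! ### The algorithm -/

variable (lt) in
/-- The successive states of the algorithm. -/
noncomputable def state (j : ℕ) : BasisData K n s p :=
  (BasisData.extend lt (unitExps n p))^[j] (C.start lt)

theorem isReduced_state (hlt : IsMonomialOrder lt) (j : ℕ) :
    BasisData.IsReduced lt (C.state lt j) ∧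
      BasisData.span (C.state lt j) = XYVec.filt C.genSet j := by
  induction j with
  | zero =>
    have h0 : BasisData.IsReduced lt ([] : BasisData K n s p) := ⟨by simp, List.Pairwise.nil⟩
    obtain ⟨h1, h2⟩ := h0.foldl_insert hlt C.gens
    refine ⟨h1, h2.trans ?_⟩
    have h3 : BasisData.span ([] : BasisData K n s p) = ⊥ := by simp [BasisData.span]
    rw [h3, bot_sup_eq]
    apply le_antisymm <;> refine Submodule.span_le.mpr ?_
    · intro f hf
      exact Submodule.subset_span ⟨f, hf, 0, by simp [XYExp.deg], by simp⟩
    · rintro _ ⟨f, hf, u, hu, rfl⟩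
      have h0 : u = 0 := by
        by_contra hne
        obtain ⟨z, v, hz, rfl⟩ := XYExp.exists_unit_add hne
        rw [XYExp.deg_add] at hu
        omega
      rw [h0, XYVec.shift_zero]
      exact Submodule.subset_span hf
  | succ j ih =>
    rw [state, Function.iterate_succ_apply']
    exact ih.1.extend hlt mem_unitExps ih.2

theorem isEchelon_state (hlt : IsMonomialOrder lt) (j : ℕ) :
    XYVec.IsEchelon lt (C.state lt j).toVecs (XYVec.filt C.genSet j) :=
  (C.isReduced_state hlt j).2 ▸ (C.isReduced_state hlt j).1.isEchelon

theorem check_state_iff (hlt : IsMonomialOrder lt) (i : ℕ) :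
    BasisData.check lt (unitExps n p) (C.state lt i) = true ↔
      ∀ j < BasisData.bound (C.state lt i), XYVec.IsStep
        ((C.state lt (i + j)).toVecs.map Prod.fst) ((C.state lt (i + j + 1)).toVecs.map Prod.fst) := by
  rw [BasisData.check_iff hlt mem_unitExps]
  refine forall₂_congr fun j _ => ?_
  rw [BasisData.map_fst_toVecs, BasisData.map_fst_toVecs, state, state, state,
    ← Function.iterate_add_apply, ← Function.iterate_add_apply, Nat.add_comm j i,
    show j + 1 + i = i + j + 1 by omega]

/-- From some level on all steps are regular, so the test succeeds there however many levels it
inspects. -/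
theorem exists_check (hlt : IsMonomialOrder lt) :
    ∃ k, (!BasisData.check lt (unitExps n p) (C.state lt k)) = false := by
  obtain ⟨i, hi⟩ := XYVec.exists_forall_isStep hlt C.genSet_finite (C.isEchelon_state hlt)
  refine ⟨i, ?_⟩
  rw [Bool.not_eq_false', C.check_state_iff hlt]
  exact fun j _ => hi (i + j) (Nat.le_add_right i j)

theorem isComplete_state (hlt : IsMonomialOrder lt) (hC : IsMotherCode C.mother)
    {h : Fin p → MvPowerSeries (Fin n) K} (hh : IsBabySeries C.mother h) {i : ℕ}
    (hi : BasisData.check lt (unitExps n p) (C.state lt i) = true) :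
    XYVec.IsComplete lt h C.genSet {e | e ∈ (C.state lt i).toVecs} C.varVec := by
  refine XYVec.isComplete_of_isStep hlt hh.zero (C.isEchelon_state hlt)
    ((C.check_state_iff hlt i).mp hi) (Nat.le_add_left 1 _) (fun e he => ?_) C.varVec_mem_filt
    (C.isMonic_varVec hlt hC) (C.subst_varVec hh)
  obtain ⟨e', he', rfl⟩ := List.mem_map.mp he
  exact (BasisData.deg_lt_bound he').le

end CodeData

omit [Field K] in
theorem BasisData.mem_yFree {E : BasisData K n s p} {e : XYMon n s p × VecData K n s p} :
    e ∈ E.yFree ↔ e ∈ E ∧ e.1.2 = 0 := by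
  simp only [BasisData.yFree, List.mem_filter, List.all_eq_true, List.mem_ofFn, beq_iff_eq,
    forall_exists_index, forall_apply_eq_imp_iff]
  exact and_congr_right fun _ => ⟨fun h => Finsupp.ext h, fun h i => by rw [h]; rfl⟩

end Final

/-- The algorithm is carried out by a program. -/
theorem exists_prog : ∃ A : Prog, ∀ (c : Context.{u}) (r : ℕ) (C : CodeData c.K c.n c.s c.p r),
    ∃ i, BasisData.check c.lt (unitExps c.n c.p) (C.state c.lt i) = true ∧
      A.Runs c.lt C.input
        ((BasisData.code C.H (C.state c.lt i).yFree).output (C.state c.lt i).yFree.initials) := by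
  have hU : Computes .code (.list .exp) fun c _ => unitExps c.n c.p :=
    Computes.unitExps Computes.codeN Computes.codeP
  have hE : Computes .code .basis fun c x => (fun y => BasisData.extend c.lt (unitExps c.n c.p)
      y)^[Nat.find (x.2.exists_check c.ord)] (x.2.start c.lt) :=
    Computes.loop (eβ := .basis)
      (t := fun c y => !BasisData.check c.lt (unitExps c.n c.p) y.2)
      (f := fun c y => BasisData.extend c.lt (unitExps c.n c.p) y.2) Computes.start
      (Computes.not (Computes.check (Computes.snd Computes.id) hU.weak))
      (Computes.extend (Computes.snd Computes.id) hU.weak)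
      fun c x => x.2.exists_check c.ord
  obtain ⟨A, hA⟩ := Computes.output (Computes.yFree hE)
  -- The number of passes is the first level at which the test succeeds.
  refine ⟨A, fun c r C => ⟨Nat.find (C.exists_check c.ord), ?_, hA c ⟨r, C⟩⟩⟩
  simpa using Nat.find_spec (C.exists_check c.ord)

theorem theorem9p1 :
    ∃ A : Prog,
      ∀ (K : Type u) [Field K] (n s : ℕ) (lt : MonIdx n s → MonIdx n s → Prop),
        IsMonomialOrder lt →
      ∀ (p r : ℕ) (C : CodeData K n s p r) (g : Fin r → SeriesVec K n s),
        HasFamilyCode C.mother C.father g →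
      ∃ (p' r' : ℕ) (C' : CodeData K n s p' r') (a : Fin r' → MonIdx n s)
        (b : Fin r' → SeriesVec K n s),
        A.Runs lt C.input (C'.output a) ∧
        HasFamilyCode C'.mother C'.father b ∧
        IsStandardBasis lt (Submodule.span (MvPowerSeries (Fin n) K) (Set.range g)) b ∧
        (∀ k, IsInitial lt (b k) (a k) ∧ vecCoeff (a k) (b k) = 1) ∧
        initialModule lt (Submodule.span (MvPowerSeries (Fin n) K) (Set.range g)) =
          Submodule.span (MvPowerSeries (Fin n) K) (Set.range fun k => monVec K (a k)) := by
  obtain ⟨A, hA⟩ := exists_prog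
  refine ⟨A, fun K _ n s lt hlt p r C g ⟨hC, h, hh, hg⟩ => ?_⟩
  obtain ⟨i, hi, hrun⟩ := hA ⟨K, n, s, p, lt, hlt⟩ r C
  set E := C.state lt i with hE
  have hcomp := C.isComplete_state hlt hC hh hi
  have hmem : ∀ k, E.yFree.get k ∈ E ∧ (E.yFree.get k).1.2 = 0 := fun k =>
    BasisData.mem_yFree.mp (List.get_mem ..)
  obtain ⟨h1, h2, h3⟩ := hcomp.isStandardBasis hlt (a := E.yFree.initials)
    (F := fun k => VecData.toVec (E.yFree.get k).2) (fun k => by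
      refine List.mem_map.mpr ⟨E.yFree.get k, (hmem k).1, Prod.ext (Prod.ext rfl ?_) rfl⟩
      exact (hmem k).2) (fun e he h0 => by
      obtain ⟨e', he', rfl⟩ := List.mem_map.mp he
      obtain ⟨k, hk⟩ := List.mem_iff_get.mp (BasisData.mem_yFree.mpr ⟨he', h0⟩)
      exact ⟨k, by rw [BasisData.initials, hk]⟩)
  have hgfun : g = fun k ℓ => substBaby h (C.father k ℓ) := by
    funext k ℓ; exact hg k ℓ
  rw [C.span_subst_genSet hh, ← hgfun] at h1 h3
  -- The mother code, and with it `p` and `h`, is unchanged; only the father code is replaced.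
  exact ⟨p, E.yFree.length, BasisData.code C.H E.yFree, E.yFree.initials, _, hrun,
    ⟨hC, h, hh, fun k ℓ => (substBaby_comp h ℓ _).symm⟩, h1, h2, h3⟩
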